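/- Let $\mathbb F\in\{\mathbb R,\mathbb C,\mathbb H\}$, $d=\dim_{\mathbb R}\mathbb F$, let $0\le p<q$ be integers, let $G=\mathrm U(p+1,q+1;\mathbb F)$ be the isometry group of the Hermitian form on $\mathbb F^{p+q+2}$ with $[z,z]=\sum_{i\le p+1}|z_i|^2-\sum_{i\ge p+2}|z_i|^2$, let $H$ be the stabilizer of the line $\mathbb F x_0$, $x_0=(0,\dots,0,1)^T$, and $K=\mathrm U(p+1;\mathbb F)\times \mathrm U(q+1;\mathbb F)$. Identify $G/H$ with $\{z:[z,z]=-1\}/\!\sim$, where $z\sim zu$ for $u\in\mathbb F$, $|u|=1$. Let $a_s\in G$ ($s\in\mathbb R$) be the hyperbolic rotation by $s$ in the plane of the first and last coordinates, put $\rho_{\mathfrak q}=\frac12(dp+dq+2(d-1))$, and let $\Delta$ be the Laplace–Beltrami operator of $G/H$, normalized to have leading term $\partial_s^2$ along $a_s$. For $u\in\mathbb F^p$, $v=(v_q,\dots,v_1)\in\mathbb F^q$, $w\in\operatorname{Im}\mathbb F$ let $$N_{u,v,w}=\begin{pmatrix}-w&u&v&w\\-\bar u^T&0&0&\bar u^T\\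 \bar v^T&0&0&-\bar v^T\\-w&u&v&w\end{pmatrix},$$ let $N^*$ be the group of all $\exp N_{u,v,w}$ with $v_j=-\bar u_j$ for $1\le j\le p$, the entries $v'=(v_j)_{p<j\le q}$ being free, with Haar measure $dn^*=du\,dv'\,dw$, and put $Rf(g)=\int_{N^*}f(gn^*H)\,dn^*$ for $g\in G$. A discrete series parameter is a real $\lambda>0$ such that $\mu_\lambda:=\lambda-\frac12(dq-dp)+1$ lies in $2\mathbb Z$. Its generating function $\psi_\lambda$ is a smooth function on $G/H$ with $\Delta\psi_\lambda=(\lambda^2-\rho_{\mathfrak q}^2)\psi_\lambda$ and, for all $k\in K$, $s\in\mathbb R$, $$\psi_\lambda(ka_sH)=\phi_{\mu_\lambda}(k)(\cosh s)^{-\lambda-\rho_{\mathfrak q}}\ \ (\mu_\lambda\ge0),\qquad \psi_\lambda(ka_sH)=P_\lambda(\cosh^2 s)(\cosh s)^{-\lambda-\rho_{\mathfrak q}-2m}\ \ (\mu_\lambda=-2m\le0),$$ where $\phi_{\mu_\lambda}$ is a $K\cap H$-invariant zonal spherical function on $K$ and $P_\lambda$ is a polynomial of degree $m$. In the exceptional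 case $q=d=1$ (so $p=0$), the parameters are instead the real $\lambda\ne0$ with $|\lambda|+\rho_{\mathfrak q}\in2\mathbb Z$, one puts $\mu_\lambda:=|\lambda|-\frac12(dq-dp)+1$ (which is always positive), and $\psi_\lambda(k_\theta a_sH)=e^{i(\lambda\pm\rho_{\mathfrak q})\theta}(\cosh s)^{-|\lambda|-\rho_{\mathfrak q}}$ for all $\theta,s\in\mathbb R$, with $\pm$ the sign of $\lambda$ and $k_\theta$ the rotation in the last two coordinates with $k_\theta x_0=(0,\sin\theta,\cos\theta)^T$. Then, for every discrete series parameter $\lambda$, the integral $R\psi_\lambda(g)$ converges absolutely for every $g\in G$, and: (i) if $\mu_\lambda>0$, then $R\psi_\lambda(g)=0$ for all $g\in G$; (ii) if $\mu_\lambda\le0$, then there is a constant $C\ne0$, independent of $s$, such that $R\psi_\lambda(a_s)=C\,e^{(\mu_\lambda-d)s}$ for all $s\in\mathbb R$. -/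

import Mathlib

open MeasureTheory
open scoped Matrix ContDiff Laplacian

noncomputable section

namespace ProjHyp

/-- `F` is one of the classical fields `ℝ`, `ℂ`, `ℍ`, with its standard conjugation (`star`)
and its Euclidean norm. -/
def IsClassicalField (F : Type*) [NormedDivisionRing F] [StarRing F] [InnerProductSpace ℝ F] :
    Prop :=
  (∃ e : F ≃⋆ₐ[ℝ] ℝ, Isometry e) ∨ (∃ e : F ≃⋆ₐ[ℝ] ℂ, Isometry e) ∨
    (∃ e : F ≃⋆ₐ[ℝ] Quaternion ℝ, Isometry e)

theorem isClassicalField_real : IsClassicalField ℝ :=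
  Or.inl ⟨StarAlgEquiv.refl ℝ ℝ, isometry_id⟩

theorem isClassicalField_complex : IsClassicalField ℂ :=
  Or.inr (Or.inl ⟨StarAlgEquiv.refl ℝ ℂ, isometry_id⟩)

theorem isClassicalField_quaternion : IsClassicalField (Quaternion ℝ) :=
  Or.inr (Or.inr ⟨StarAlgEquiv.refl ℝ (Quaternion ℝ), isometry_id⟩)

/-- Conjugation on `ℍ` is real linear, so that `ℍ` is covered by the definitions below. -/
instance instStarModuleQuaternion : StarModule ℝ (Quaternion ℝ) :=
  ⟨fun r x => by simp⟩

/-- Labels of the `p + q + 2` coordinates. `Sum.inl i` labels the coordinate `x_{i+1}`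
(`0 ≤ i ≤ p`), and `Sum.inr j` labels `x_{p+q+2-j}` (`0 ≤ j ≤ q`). So the negative coordinates are
numbered from right to left: the last coordinate, the one of the base point, is `Sum.inr 0`, and
the entry `v_j` of `v = (v_q, …, v_1)` sits at the label `Sum.inr j`. -/
abbrev Idx (p q : ℕ) : Type := Fin (p + 1) ⊕ Fin (q + 1)

/-- Column vectors in `F ^ (p + q + 2)`, a right vector space over `F`. -/
abbrev Vec (F : Type*) (p q : ℕ) : Type _ := Idx p q → F

/-- Square matrices of size `p + q + 2` over `F`. -/
abbrev Mat (F : Type*) (p q : ℕ) : Type _ := Matrix (Idx p q) (Idx p q) F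

section Model

variable {F : Type*} [NormedDivisionRing F] {p q : ℕ}

/-- The value `[z, z] = ∑ |z_i|² - ∑ |z_j|²` of the Hermitian form of signature
`(p + 1, q + 1)`. -/
def form (z : Vec F p q) : ℝ :=
  ∑ i : Fin (p + 1), ‖z (Sum.inl i)‖ ^ 2 - ∑ j : Fin (q + 1), ‖z (Sum.inr j)‖ ^ 2

/-- The open cone `[z, z] < 0`, whose image in projective space is `𝕏 = G / H`. -/
def negCone (F : Type*) [NormedDivisionRing F] (p q : ℕ) : Set (Vec F p q) := {z | form z < 0}

/-- Functions on the projective hyperbolic space `𝕏 = G / H`: functions on the cone `[z, z] < 0`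
(equivalently, on the hyperboloid `[z, z] = -1`) that are invariant under `z ↦ z u`, `u ∈ F^*`.
Values outside the cone play no role. -/
def IsFunctionOnX (f : Vec F p q → ℂ) : Prop :=
  ∀ z ∈ negCone F p q, ∀ u : F, u ≠ 0 → f (fun i => z i * u) = f z

/-- The base point `x₀ = (0, …, 0, 1)ᵀ`. -/
def basePt (F : Type*) [NormedDivisionRing F] (p q : ℕ) : Vec F p q := Pi.single (Sum.inr 0) 1

/-- The matrix `diag(1, …, 1, -1, …, -1)` of the Hermitian form. -/
def formMatrix (F : Type*) [NormedDivisionRing F] (p q : ℕ) : Mat F p q :=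
  Matrix.fromBlocks 1 0 0 (-1)

/-- `G = U(p + 1, q + 1; F)`, the matrices preserving the Hermitian form. -/
def groupG (F : Type*) [NormedDivisionRing F] [StarRing F] (p q : ℕ) : Set (Mat F p q) :=
  {g | gᴴ * formMatrix F p q * g = formMatrix F p q}

/-- `H = U(p + 1, q; F) × U(1; F)`, the stabilizer in `G` of the line `F x₀`. -/
def groupH (F : Type*) [NormedDivisionRing F] [StarRing F] (p q : ℕ) : Set (Mat F p q) :=
  {h | h ∈ groupG F p q ∧ ∃ u : F, h *ᵥ basePt F p q = fun i => basePt F p q i * u}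

/-- The maximal compact subgroup `K = U(p + 1; F) × U(q + 1; F)`, the elements of `G` that are
fixed by the Cartan involution `g ↦ (g^*)⁻¹`. -/
def groupK (F : Type*) [NormedDivisionRing F] [StarRing F] (p q : ℕ) : Set (Mat F p q) :=
  {k | k ∈ groupG F p q ∧ kᴴ * k = 1}

variable [InnerProductSpace ℝ F]

/-- The element `a_s = exp X_s` of `A_𝔮`: a hyperbolic rotation in the plane of the first and the
last coordinate. -/
def aElt (F : Type*) [NormedDivisionRing F] [InnerProductSpace ℝ F] (p q : ℕ) (s : ℝ) :
    Mat F p q :=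
  Matrix.fromBlocks
    (Matrix.diagonal (Function.update 1 0 (Real.cosh s • 1)))
    (Matrix.single 0 0 (Real.sinh s • 1))
    (Matrix.single 0 0 (Real.sinh s • 1))
    (Matrix.diagonal (Function.update 1 0 (Real.cosh s • 1)))

/-- The rotation `k_θ` in the plane of the last two coordinates (used only for `q = 1`). -/
def kElt (F : Type*) [NormedDivisionRing F] [InnerProductSpace ℝ F] (p q : ℕ) (θ : ℝ) :
    Mat F p q :=
  Matrix.fromBlocks 1 0 0 (Matrix.of fun i j : Fin (q + 1) =>
    if i = 0 ∧ j = 0 then Real.cos θ • (1 : F)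
    else if i = 1 ∧ j = 1 then Real.cos θ • (1 : F)
    else if i = 1 ∧ j = 0 then Real.sin θ • (1 : F)
    else if i = 0 ∧ j = 1 then -(Real.sin θ • (1 : F))
    else if i = j then 1 else 0)

/-- The matrix with corner entry `a`, first row `(a, r)`, first column `(a, c)`, and zeros
elsewhere. -/
def cross {m n : ℕ} (a : F) (r : Fin n → F) (c : Fin m → F) :
    Matrix (Fin (m + 1)) (Fin (n + 1)) F :=
  Matrix.of (Fin.cons (Fin.cons a r : Fin (n + 1) → F)
    (fun i => (Fin.cons (c i) 0 : Fin (n + 1) → F)))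

/-- The nilpotent Lie algebra element `N_{u,v,w}`. -/
def nilElt [StarRing F] (u : Fin p → F) (v : Fin q → F) (w : F) : Mat F p q :=
  Matrix.fromBlocks
    (cross (-w) u (fun j => -star (u j))) (cross w v (fun j => star (u j)))
    (cross (-w) u (fun j => star (v j))) (cross w v (fun j => -star (v j)))

/-- `exp N_{u,v,w} = I + N_{u,v,w} + N_{u,v,w}² / 2` (for `w ∈ Im F` the cube of `N_{u,v,w}`
vanishes). -/
def expNil [StarRing F] (u : Fin p → F) (v : Fin q → F) (w : F) : Mat F p q :=
  1 + nilElt u v w + (1 / 2 : ℝ) • (nilElt u v w * nilElt u v w)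

/-- For `p < q`, the vector `v ∈ F^q` with `v_j = -conj(u_j)` for `1 ≤ j ≤ p`, and with free
entries `v'` for `p < j ≤ q`. These are the `v` that occur in `𝔫^*`. -/
def vStar [StarRing F] (u : Fin p → F) (v' : Fin (q - p) → F) : Fin q → F := fun k =>
  if h : k.val < p then -star (u ⟨k.val, h⟩) else v' ⟨k.val - p, by omega⟩

/-- Lebesgue measure on a Euclidean space. -/
def lebesgue (E : Type*) [NormedAddCommGroup E] [InnerProductSpace ℝ E] [FiniteDimensional ℝ E]
    [MeasurableSpace E] [BorelSpace E] : Measure E :=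
  (stdOrthonormalBasis ℝ E).toBasis.addHaar

/-- `Im F = {w : conj w = -w}` as a real subspace of `F`. -/
abbrev imPart (F : Type*) [NormedDivisionRing F] [StarRing F] [InnerProductSpace ℝ F]
    [StarModule ℝ F] : Submodule ℝ F := skewAdjoint.submodule ℝ F

/-- The coordinates `(u, v', w) ∈ F^p × F^{q-p} × Im F` on `𝔫^* ≅ N^*` (for `p < q`). -/
abbrev NStarCoord (F : Type*) [NormedDivisionRing F] [StarRing F] [InnerProductSpace ℝ F]
    [StarModule ℝ F] (p q : ℕ) : Type _ :=
  (Fin p → F) × (Fin (q - p) → F) × imPart F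

/-- The element of `N^* = exp 𝔫^*` with given coordinates, for `p < q`. -/
def nStar [StarRing F] [StarModule ℝ F] (n : NStarCoord F p q) : Mat F p q :=
  expNil n.1 (vStar n.1 n.2.1) (n.2.2 : F)

/-- The Haar measure `dn^* = du dv' dw` of the nilpotent group `N^*`, which in exponential
coordinates is Lebesgue measure. -/
def haarNStar (F : Type*) [NormedDivisionRing F] [StarRing F] [InnerProductSpace ℝ F]
    [StarModule ℝ F] [FiniteDimensional ℝ F] [MeasurableSpace F] [BorelSpace F] (p q : ℕ) :
    Measure (NStarCoord F p q) :=
  (Measure.pi fun _ => lebesgue F).prod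
    ((Measure.pi fun _ => lebesgue F).prod (lebesgue (imPart F)))

/-- The function `n^* ↦ f(g n^* H)` on `N^*`, for `p < q`. -/
def radonIntegrand [StarRing F] [StarModule ℝ F] (f : Vec F p q → ℂ) (g : Mat F p q)
    (n : NStarCoord F p q) : ℂ :=
  f ((g * nStar n) *ᵥ basePt F p q)

/-- The Radon transform `Rf(g) = ∫_{N^*} f(g n^* H) dn^*`, for `p < q`. -/
def radon [StarRing F] [StarModule ℝ F] [FiniteDimensional ℝ F] [MeasurableSpace F]
    [BorelSpace F] (f : Vec F p q → ℂ) (g : Mat F p q) : ℂ :=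
  ∫ n, radonIntegrand f g n ∂(haarNStar F p q)

/-- The Laplace–Beltrami operator `Δ` of `𝕏`, evaluated on the hyperboloid `[z, z] = -1`: the
flat Laplacian of signature `(d(p + 1), d(q + 1))` applied to `f`, viewed as a function on the cone
that is homogeneous of degree zero. In the coordinates `(u sinh t; v cosh t)` its leading term
is `∂²/∂t²`. -/
def laplaceBeltrami [FiniteDimensional ℝ F] (f : Vec F p q → ℂ) (z : Vec F p q) : ℂ :=
  ∑ i : Fin (p + 1), Δ (fun y : F => f (Function.update z (Sum.inl i) y)) (z (Sum.inl i)) -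
    ∑ j : Fin (q + 1), Δ (fun y : F => f (Function.update z (Sum.inr j) y)) (z (Sum.inr j))

/-- `φ : K → ℂ` is a `K ∩ H`-invariant zonal spherical function: it is continuous,
`K ∩ H`-biinvariant, takes the value `1` at the identity, and satisfies
`∫_{K ∩ H} φ(x h y) dh = φ(x) φ(y)`, where `dh` is the normalized Haar measure of the compact group
`K ∩ H`, here a Borel probability measure on the space of matrices carried by `K ∩ H` and
invariant under it. -/
structure IsZonalSpherical [StarRing F] (φ : Mat F p q → ℂ) : Prop where
  continuousOn : ContinuousOn φ (groupK F p q)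
  map_one : φ 1 = 1
  biinvariant : ∀ k ∈ groupK F p q, ∀ h₁ ∈ groupK F p q ∩ groupH F p q,
    ∀ h₂ ∈ groupK F p q ∩ groupH F p q, φ (h₁ * k * h₂) = φ k
  functional_eq : letI : MeasurableSpace (Mat F p q) := borel _
    ∀ m : Measure (Mat F p q), IsProbabilityMeasure m →
      m (groupK F p q ∩ groupH F p q)ᶜ = 0 →
      (∀ h ∈ groupK F p q ∩ groupH F p q, m.map (fun x => h * x) = m) →
      ∀ x ∈ groupK F p q, ∀ y ∈ groupK F p q, ∫ h, φ (x * h * y) ∂m = φ x * φ y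

end Model

section DiscreteSeries

variable (F : Type*) [NormedDivisionRing F] [InnerProductSpace ℝ F] (p q : ℕ)

/-- `d = dim_ℝ F`. -/
def dimF : ℕ := Module.finrank ℝ F

/-- `ρ_𝔮 = (dp + dq + 2(d - 1)) / 2`. -/
def rhoQ : ℝ := ((dimF F : ℝ) * p + (dimF F : ℝ) * q + 2 * ((dimF F : ℝ) - 1)) / 2

/-- The number `μ_λ`, defined by `|λ| = (dq - dp) / 2 - 1 + μ_λ`. The absolute value matters only
for `q = d = 1`, since otherwise discrete series parameters are positive. -/
def muParam (lam : ℝ) : ℝ := |lam| - ((dimF F : ℝ) * q - (dimF F : ℝ) * p) / 2 + 1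

/-- The case `q = d = 1`, in which the discrete series is parametrized differently. -/
def IsSpecial : Prop := q = 1 ∧ dimF F = 1

/-- `λ` is the parameter of a discrete series of `G / H`: `λ > 0` and `μ_λ ∈ 2ℤ`; for `q = d = 1`
the conditions are `λ ≠ 0` and `|λ| + ρ_𝔮 ∈ 2ℤ`. -/
def IsDiscreteSeriesParam (lam : ℝ) : Prop :=
  (¬ IsSpecial F q ∧ 0 < lam ∧ ∃ n : ℤ, muParam F p q lam = 2 * n) ∨
    (IsSpecial F q ∧ lam ≠ 0 ∧ ∃ n : ℤ, |lam| + rhoQ F p q = 2 * n)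

variable {F p q}

/-- `ψ` is the generating function `ψ_λ` of the discrete series with parameter `λ`: a smooth
function on `G / H` with `Δψ = (λ² - ρ_𝔮²)ψ` such that
* for `μ_λ ≥ 0`, `ψ(k a_s H) = φ(k) (cosh s)^{-λ-ρ_𝔮}` with a zonal spherical function `φ`;
* for `μ_λ = -2m ≤ 0`, `ψ(k a_s H) = P(cosh² s) (cosh s)^{-λ-ρ_𝔮-2m}` with a polynomial `P`
  of degree `m`;
* for `q = d = 1`, instead, `ψ(k_θ a_s H) = exp(i(λ ± ρ_𝔮)θ) (cosh s)^{-|λ|-ρ_𝔮}`, where `±` is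
  the sign of `λ`.
By the eigenvalue equation, `φ` and (up to a constant factor) `P` are determined by `λ`. -/
structure IsGeneratingFunction [StarRing F] [FiniteDimensional ℝ F] (lam : ℝ)
    (ψ : Vec F p q → ℂ) : Prop where
  isFunctionOnX : IsFunctionOnX ψ
  smooth : ContDiffOn ℝ ∞ ψ (negCone F p q)
  eigen : ∀ z : Vec F p q, form z = -1 →
    laplaceBeltrami ψ z = ((lam ^ 2 - rhoQ F p q ^ 2 : ℝ) : ℂ) * ψ z
  formula_nonneg : ¬ IsSpecial F q → 0 ≤ muParam F p q lam →
    ∃ φ : Mat F p q → ℂ, IsZonalSpherical φ ∧ ∀ k ∈ groupK F p q, ∀ s : ℝ,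
      ψ ((k * aElt F p q s) *ᵥ basePt F p q) =
        φ k * ((Real.cosh s ^ (-lam - rhoQ F p q) : ℝ) : ℂ)
  formula_nonpos : ¬ IsSpecial F q → ∀ m : ℕ, muParam F p q lam = -2 * m →
    ∃ P : Polynomial ℂ, P.degree = m ∧ ∀ k ∈ groupK F p q, ∀ s : ℝ,
      ψ ((k * aElt F p q s) *ᵥ basePt F p q) =
        P.eval ((Real.cosh s ^ 2 : ℝ) : ℂ) *
          ((Real.cosh s ^ (-lam - rhoQ F p q - 2 * m) : ℝ) : ℂ)
  formula_special : IsSpecial F q → ∀ θ s : ℝ,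
    ψ ((kElt F p q θ * aElt F p q s) *ᵥ basePt F p q) =
      Complex.exp (Complex.I * ((lam + SignType.sign lam * rhoQ F p q : ℝ) : ℂ) * θ) *
        ((Real.cosh s ^ (-|lam| - rhoQ F p q) : ℝ) : ℂ)

end DiscreteSeries

end ProjHyp

end

open ProjHyp

/-! Write σ = |λ| + ρ_𝔮. On the hyperboloid `form z = -1` the function ψ is replaced by a function Ψ
that agrees with it there, is homogeneous of degree -σ, and is smooth wherever the negative part of
z is nonzero, hence across the isotropic cone as well (`exists_extension`). For this degree the
equation Δψ = (λ² - ρ_𝔮²)ψ says precisely that Ψ solves the flat ultrahyperbolic equation on the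
negative cone (`boxTrace_extension`), because λ² - ρ_𝔮² - σ² + 2σρ_𝔮 = λ² - (σ - ρ_𝔮)² = 0.

The `N^*`-orbit of the base point is a paraboloid with isotropic axis. Sliding it along the axis
gives a family whose member with parameter b lies in `form z = -b`; the Radon transform is the case
b = 1. Let V(b) be the integral of Ψ over the g-translate of the member b. The ultrahyperbolic
equation, Euler's identity and integration by parts along the paraboloid give (|λ| + 1) V' + b V'' =
0, so b^(|λ|+1) V' is constant. Smoothness of Ψ up to the isotropic cone bounds V' near b = 0, so
that constant is zero and V is constant on b ≥ 0 (`Paraboloid.Admissible.integral_eq`). This is the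
analogue of Newton's theorem that a homogeneous shell exerts no force in its interior.

It remains to evaluate V at an end of the range. If μ_λ > 0, then μ_λ ≥ 2 by parity, so σ exceeds
dim `N^*`, and dominated convergence as b → ∞ gives V = 0. If μ_λ ≤ 0, take b = 0: on the isotropic
cone only the leading coefficient of P_λ survives, so Ψ is a nonzero constant times a positive
function. There a_s acts as e^(-s) times a dilation of `N^*`; homogeneity and the Jacobian then
produce the exponential, and positivity shows that C ≠ 0.

Absolute convergence rests on anisotropic growth: the orbit grows linearly in u and w but
quadratically in v', so the critical exponent is pd + (q - p)d/2 + (d - 1) = ρ_𝔮, which σ exceeds by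
|λ|. -/

noncomputable section

namespace ProjHyp

open Filter Topology Set

/-! ### Homogeneous functions on open cones -/

section Homogeneous

variable {E W : Type*} [NormedAddCommGroup E] [NormedSpace ℝ E]
  [NormedAddCommGroup W] [NormedSpace ℝ W]

/-- `h` is positively homogeneous of degree `-τ` on the open cone `U`. -/
structure HomogOn (τ : ℝ) (U : Set E) (h : E → W) : Prop where
  isOpen : IsOpen U
  smul_mem : ∀ c : ℝ, 0 < c → ∀ z ∈ U, c • z ∈ U
  map_smul : ∀ c : ℝ, 0 < c → ∀ z ∈ U, h (c • z) = c ^ (-τ) • h z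

/-- Differentiate h(cz) = c^(-τ) h(z) in z: the chain rule contributes one factor c. Each derivative
thus gains one power of decay, which later absorbs one power of the parameter n. -/
theorem HomogOn.fderiv {τ : ℝ} {U : Set E} {h : E → W} (hh : HomogOn τ U h)
    (hd : DifferentiableOn ℝ h U) : HomogOn (τ + 1) U (fderiv ℝ h) where
  isOpen := hh.isOpen
  smul_mem := hh.smul_mem
  map_smul c hc z hz := by
    have h1 : (fun x => h (c • x)) =ᶠ[𝓝 z] fun x => c ^ (-τ) • h x := by
      filter_upwards [hh.isOpen.mem_nhds hz] with x hx using hh.map_smul c hc x hx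
    have h2 := h1.fderiv_eq (𝕜 := ℝ)
    rw [fderiv_comp_smul, fderiv_fun_const_smul (hd.differentiableAt (hh.isOpen.mem_nhds hz))] at h2
    have h3 : _root_.fderiv ℝ h (c • z) = c⁻¹ • (c • _root_.fderiv ℝ h (c • z)) := by
      rw [smul_smul, inv_mul_cancel₀ hc.ne', one_smul]
    rw [h3, h2, smul_smul]
    congr 1
    rw [neg_add, Real.rpow_add hc, Real.rpow_neg_one, mul_comm]

/-- Euler's identity, from differentiating the homogeneity relation in the scalar at 1. -/
theorem HomogOn.fderiv_self {τ : ℝ} {U : Set E} {h : E → W} (hh : HomogOn τ U h)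
    (hd : DifferentiableOn ℝ h U) {z : E} (hz : z ∈ U) : _root_.fderiv ℝ h z z = (-τ) • h z := by
  have h1 : HasDerivAt (fun t : ℝ => h (t • z)) (_root_.fderiv ℝ h z z) 1 := by
    have h2 : HasDerivAt (fun t : ℝ => t • z) ((1 : ℝ) • z) 1 := (hasDerivAt_id (1 : ℝ)).smul_const z
    have h3 : HasFDerivAt h (_root_.fderiv ℝ h z) ((1 : ℝ) • z) := by
      rw [one_smul]
      exact (hd.differentiableAt (hh.isOpen.mem_nhds hz)).hasFDerivAt
    exact (h3.comp_hasDerivAt (1 : ℝ) h2).congr_deriv (by rw [one_smul])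
  have h4 : HasDerivAt (fun t : ℝ => t ^ (-τ) • h z) ((-τ) • h z) 1 := by
    have := (Real.hasDerivAt_rpow_const (x := 1) (p := -τ) (Or.inl one_ne_zero)).smul_const (h z)
    simpa using this
  refine h1.unique (h4.congr_of_eventuallyEq ?_)
  filter_upwards [lt_mem_nhds (show (0 : ℝ) < 1 by norm_num)] with t ht
  exact hh.map_smul t ht z hz

/-- Compactness of the unit sphere of the closed cone `C`, combined with scaling. The cone must be
closed and, apart from 0, contained in `U`; on the open cone `U` itself no uniform bound need hold.
-/
theorem HomogOn.exists_bound [FiniteDimensional ℝ E] {τ : ℝ} {U : Set E} {h : E → W}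
    (hh : HomogOn τ U h) (hc : ContinuousOn h U) {C : Set E} (hC : IsClosed C)
    (hCs : ∀ c : ℝ, 0 < c → ∀ z ∈ C, c • z ∈ C) (hCU : ∀ z ∈ C, z ≠ 0 → z ∈ U) :
    ∃ M, 0 ≤ M ∧ ∀ z ∈ C, z ≠ 0 → ‖h z‖ ≤ M * ‖z‖ ^ (-τ) := by
  have : ProperSpace E := FiniteDimensional.proper ℝ E
  have hcomp : IsCompact (Metric.sphere (0 : E) 1 ∩ C) := (isCompact_sphere _ _).inter_right hC
  have hsub : Metric.sphere (0 : E) 1 ∩ C ⊆ U := fun z hz => hCU z hz.2 (by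
    rintro rfl
    simpa using hz.1)
  obtain ⟨M, hM⟩ := hcomp.exists_bound_of_continuousOn (hc.mono hsub)
  refine ⟨max M 0, le_max_right _ _, fun z hz hz0 => ?_⟩
  have hn : 0 < ‖z‖ := norm_pos_iff.2 hz0
  have hw : ‖z‖⁻¹ • z ∈ Metric.sphere (0 : E) 1 ∩ C :=
    ⟨by simp [norm_smul, hn.ne'], hCs _ (inv_pos.2 hn) z hz⟩
  have h1 : h z = ‖z‖ ^ (-τ) • h (‖z‖⁻¹ • z) := by
    rw [← hh.map_smul _ hn _ (hsub hw), smul_smul, mul_inv_cancel₀ hn.ne', one_smul]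
  rw [h1, norm_smul, Real.norm_of_nonneg (by positivity), mul_comm]
  gcongr
  exact (hM _ hw).trans (le_max_left _ _)

end Homogeneous

/-! ### Paraboloids and integration by parts -/

section Paraboloid

variable {E X ι : Type*} [NormedAddCommGroup E] [NormedSpace ℝ E]
  [NormedAddCommGroup X] [NormedSpace ℝ X] [Fintype ι]

/-- A family of paraboloids `n ↦ f + (b - ∑ c_j n_j²) e + L n` with axis `e`. -/
structure Paraboloid (E X ι : Type*) [NormedAddCommGroup E] [NormedSpace ℝ E]
    [NormedAddCommGroup X] [NormedSpace ℝ X] where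
  basis : Module.Basis ι ℝ X
  c : ι → ℝ
  f : E
  e : E
  L : X →L[ℝ] E

namespace Paraboloid

variable (P : Paraboloid E X ι)

/-- The quadratic form `∑ c_j n_j²`. -/
def Q (n : X) : ℝ := ∑ j, P.c j * P.basis.repr n j ^ 2

/-- The point of the paraboloid with parameter `b` over `n`. -/
def pt (b : ℝ) (n : X) : E := P.f + (b - P.Q n) • P.e + P.L n

theorem hasDerivAt_pt (b : ℝ) (n : X) : HasDerivAt (fun b => P.pt b n) P.e b := by
  have := (((hasDerivAt_id b).sub_const (P.Q n)).smul_const P.e).const_add P.f |>.add_const (P.L n)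
  simpa [pt] using this

theorem continuous_repr [FiniteDimensional ℝ X] (j : ι) :
    Continuous fun n : X => P.basis.repr n j :=
  (P.basis.coord j).continuous_of_finiteDimensional

theorem continuous_pt [FiniteDimensional ℝ X] (b : ℝ) : Continuous (P.pt b) := by
  have := P.continuous_repr
  unfold pt Q
  fun_prop

theorem hasLineDerivAt_pt [DecidableEq ι] (b : ℝ) (n : X) (j : ι) :
    HasLineDerivAt ℝ (P.pt b) (P.L (P.basis j) - (2 * P.c j * P.basis.repr n j) • P.e) n
      (P.basis j) := by
  have hQ : ∀ t : ℝ, P.Q (n + t • P.basis j) =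
      P.Q n + P.c j * (2 * P.basis.repr n j * t + t ^ 2) := by
    intro t
    unfold Q
    rw [← sub_eq_iff_eq_add', ← Finset.sum_sub_distrib, Finset.sum_eq_single j]
    · simp only [map_add, map_smul, Finsupp.add_apply, Finsupp.smul_apply, Module.Basis.repr_self,
        Finsupp.single_eq_same, smul_eq_mul]
      ring
    · intro i _ hi
      simp [hi.symm]
    · simp
  unfold HasLineDerivAt pt
  simp only [hQ]
  have h1 : HasDerivAt (fun t : ℝ => b - (P.Q n + P.c j * (2 * P.basis.repr n j * t + t ^ 2)))
      (- (2 * P.c j * P.basis.repr n j)) 0 := by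
    have h : HasDerivAt (fun t : ℝ => 2 * P.basis.repr n j * t + t ^ 2)
        (2 * P.basis.repr n j) 0 := by
      exact (((hasDerivAt_id (0 : ℝ)).const_mul (2 * P.basis.repr n j)).add
        (hasDerivAt_pow 2 (0 : ℝ))).congr_deriv (by simp)
    exact (((h.const_mul (P.c j)).const_add (P.Q n)).const_sub b).congr_deriv (by ring)
  have h2 : HasDerivAt (fun t : ℝ => P.L (n + t • P.basis j)) (P.L (P.basis j)) 0 := by
    have : HasDerivAt (fun t : ℝ => n + t • P.basis j) (P.basis j) 0 := by
      simpa using ((hasDerivAt_id (0 : ℝ)).smul_const (P.basis j)).const_add n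
    exact P.L.hasFDerivAt.comp_hasDerivAt (0 : ℝ) this
  exact (((h1.smul_const P.e).const_add P.f).add h2).congr_deriv (by rw [neg_smul]; abel)

end Paraboloid

theorem hasLineDerivAt_repr {X ι : Type*} [NormedAddCommGroup X] [NormedSpace ℝ X]
    (ξ : Module.Basis ι ℝ X) (n : X) (j : ι) :
    HasLineDerivAt ℝ (fun n => ξ.repr n j) 1 n (ξ j) := by
  unfold HasLineDerivAt
  have : (fun t : ℝ => ξ.repr (n + t • ξ j) j) = fun t => ξ.repr n j + t := by
    funext t
    simp
  rw [this]
  exact (hasDerivAt_id (0 : ℝ)).const_add _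

theorem HasFDerivAt.comp_hasLineDerivAt {X E W : Type*} [NormedAddCommGroup X] [NormedSpace ℝ X]
    [NormedAddCommGroup E] [NormedSpace ℝ E] [NormedAddCommGroup W] [NormedSpace ℝ W]
    {h : E → W} {h' : E →L[ℝ] W} {z : X → E} {z' : E} {n v : X}
    (hh : HasFDerivAt h h' (z n)) (hz : HasLineDerivAt ℝ z z' n v) :
    HasLineDerivAt ℝ (fun n => h (z n)) (h' z') n v := by
  unfold HasLineDerivAt at *
  have hh' : HasFDerivAt h h' (z (n + (0 : ℝ) • v)) := by simpa using hh
  exact hh'.comp_hasDerivAt (0 : ℝ) hz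

/-- Integration by parts against the constant function 1. Integrability of both `g` and `g'`
replaces compact support. -/
theorem integral_eq_zero_of_hasLineDerivAt {X : Type*} [NormedAddCommGroup X] [NormedSpace ℝ X]
    [FiniteDimensional ℝ X] [MeasurableSpace X] [BorelSpace X] {ν : Measure X}
    [ν.IsAddHaarMeasure] {g g' : X → ℂ} {v : X} (hg : Integrable g ν) (hg' : Integrable g' ν)
    (h : ∀ n, HasLineDerivAt ℝ g (g' n) n v) : ∫ n, g' n ∂ν = 0 := by
  have := integral_bilinear_hasLineDerivAt_right_eq_neg_left_of_integrable (μ := ν)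
    (f := fun _ => (1 : ℂ)) (f' := fun _ => (0 : ℂ)) (g := g) (g' := g') (v := v)
    (B := ContinuousLinearMap.mul ℝ ℂ) (by simp) (by simpa using hg') (by simpa using hg)
    (fun n _ => by simpa [HasLineDerivAt] using hasDerivAt_const (0 : ℝ) (1 : ℂ)) (fun n _ => h n)
  simpa using this

end Paraboloid

/-! ### Newton's theorem for admissible paraboloids -/

variable {E X ι : Type*} [NormedAddCommGroup E] [NormedSpace ℝ E] [FiniteDimensional ℝ E]
  [NormedAddCommGroup X] [NormedSpace ℝ X] [FiniteDimensional ℝ X] [Fintype ι]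
  [MeasurableSpace X] [BorelSpace X]

/-- The paraboloids `P.pt b`, `b ≥ 0`, lie in a closed cone `C`, on a neighbourhood `U` of which
`Ψ` is smooth and homogeneous of degree `-σ`; along them, for `b > 0`, `Ψ` satisfies a second order
equation of constant coefficients that is adapted to the tangent directions. -/
structure Paraboloid.Admissible (P : Paraboloid E X ι) (ν : Measure X) (σ lam : ℝ) (U C : Set E)
    (Ψ : E → ℂ) (x : ι → E) : Prop where
  hom : HomogOn σ U Ψ
  smooth : ContDiffOn ℝ ∞ Ψ U
  closed : IsClosed C
  smul_mem : ∀ c : ℝ, 0 < c → ∀ z ∈ C, c • z ∈ C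
  subset : ∀ z ∈ C, z ≠ 0 → z ∈ U
  mem : ∀ b : ℝ, 0 ≤ b → ∀ n, P.pt b n ∈ C
  lower : ∃ κ : ℝ, 0 < κ ∧ ∀ b : ℝ, 0 ≤ b → ∀ n, κ * (1 + ‖n‖) ≤ ‖P.pt b n‖
  dom : ∀ B : ℝ, ∃ M : X → ℝ, Integrable M ν ∧
    ∀ b ∈ Icc 0 B, ∀ n, ‖P.pt b n‖ ^ (-σ) ≤ M n
  coeff : ∀ j, P.c j = 0 ∨ (P.c j = 1 ∧ x j = -P.L (P.basis j))
  pde : ∀ b : ℝ, 0 < b → ∀ n,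
    -4 * fderiv ℝ (fderiv ℝ Ψ) (P.pt b n) P.f P.e +
      ∑ j, fderiv ℝ (fderiv ℝ Ψ) (P.pt b n) (P.L (P.basis j)) (x j) = 0
  lam_pos : 0 < lam
  lam_eq : σ - Fintype.card ι + (∑ j, P.c j) / 2 = lam

namespace Paraboloid.Admissible

variable {P : Paraboloid E X ι} {ν : Measure X} {σ lam : ℝ} {U C : Set E}
  {Ψ : E → ℂ} {x : ι → E} (hP : P.Admissible ν σ lam U C Ψ x)
  {W : Type*} [NormedAddCommGroup W] [NormedSpace ℝ W]

include hP

theorem pt_ne_zero {b : ℝ} (hb : 0 ≤ b) (n : X) : P.pt b n ≠ 0 := by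
  obtain ⟨κ, hκ, h⟩ := hP.lower
  rw [← norm_pos_iff]
  exact lt_of_lt_of_le (by positivity) (h b hb n)

theorem pt_mem {b : ℝ} (hb : 0 ≤ b) (n : X) : P.pt b n ∈ U :=
  hP.subset _ (hP.mem b hb n) (hP.pt_ne_zero hb n)

/-- A function of degree -(σ + k) beats the weight (1 + ‖n‖)^k, since `lower` bounds 1 + ‖n‖ by a
multiple of the norm of the point. One majorant, for ‖pt‖^(-σ), therefore serves for Ψ and for all
its weighted derivatives. -/
theorem exists_bound {k : ℕ} {h : E → W} (hh : HomogOn (σ + k) U h) (hc : ContinuousOn h U) :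
    ∃ M, 0 ≤ M ∧ ∀ b : ℝ, 0 ≤ b → ∀ n,
      (1 + ‖n‖) ^ k * ‖h (P.pt b n)‖ ≤ M * ‖P.pt b n‖ ^ (-σ) := by
  obtain ⟨κ, hκ, hl⟩ := hP.lower
  obtain ⟨M, hM, hb⟩ := hh.exists_bound hc hP.closed hP.smul_mem hP.subset
  refine ⟨(κ⁻¹) ^ k * M, by positivity, fun b hb0 n => ?_⟩
  have hpos : 0 < ‖P.pt b n‖ := norm_pos_iff.2 (hP.pt_ne_zero hb0 n)
  have h1 : 1 + ‖n‖ ≤ κ⁻¹ * ‖P.pt b n‖ := by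
    rw [inv_mul_eq_div, le_div_iff₀ hκ, mul_comm]
    exact hl b hb0 n
  calc (1 + ‖n‖) ^ k * ‖h (P.pt b n)‖
      ≤ (κ⁻¹ * ‖P.pt b n‖) ^ k * (M * ‖P.pt b n‖ ^ (-(σ + k))) := by
        gcongr
        exact hb _ (hP.mem b hb0 n) (hP.pt_ne_zero hb0 n)
    _ = κ⁻¹ ^ k * M * ‖P.pt b n‖ ^ (-σ) := by
        rw [neg_add, Real.rpow_add hpos, Real.rpow_neg hpos.le (k : ℝ), Real.rpow_natCast, mul_pow]
        field_simp

theorem integrable_smul {k : ℕ} {h : E → W} (hh : HomogOn (σ + k) U h) (hc : ContinuousOn h U)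
    (T : W →L[ℝ] ℂ) {w : X → ℝ} (hw : Continuous w) {A : ℝ}
    (hA : ∀ n, |w n| ≤ A * (1 + ‖n‖) ^ k) {b : ℝ} (hb : 0 ≤ b) :
    Integrable (fun n => w n • T (h (P.pt b n))) ν := by
  obtain ⟨M, hM, hbd⟩ := hP.exists_bound hh hc
  obtain ⟨N, hN, hNb⟩ := hP.dom b
  have hA0 : 0 ≤ A := by
    have := (abs_nonneg _).trans (hA 0)
    simpa using this
  have hcont : Continuous fun n => w n • T (h (P.pt b n)) :=
    hw.smul (T.continuous.comp (hc.comp_continuous (P.continuous_pt b) (hP.pt_mem hb)))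
  refine (hN.const_mul (A * ‖T‖ * M)).mono' hcont.aestronglyMeasurable
    (Eventually.of_forall fun n => ?_)
  rw [norm_smul, Real.norm_eq_abs]
  calc |w n| * ‖T (h (P.pt b n))‖ ≤ (A * (1 + ‖n‖) ^ k) * (‖T‖ * ‖h (P.pt b n)‖) := by
        gcongr
        · exact hA n
        · exact T.le_opNorm _
    _ = A * ‖T‖ * ((1 + ‖n‖) ^ k * ‖h (P.pt b n)‖) := by ring
    _ ≤ A * ‖T‖ * (M * N n) := by
        refine mul_le_mul_of_nonneg_left ((hbd b hb n).trans ?_) (by positivity)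
        exact mul_le_mul_of_nonneg_left (hNb b ⟨hb, le_rfl⟩ n) hM
    _ = _ := by ring

theorem bound_on {k : ℕ} {h : E → W} (hh : HomogOn (σ + k) U h) (hc : ContinuousOn h U)
    (T : W →L[ℝ] ℂ) (B : ℝ) : ∃ M : X → ℝ, Integrable M ν ∧ ∀ b ∈ Icc 0 B, ∀ n,
      ‖T (h (P.pt b n))‖ ≤ M n := by
  obtain ⟨M, hM, hbd⟩ := hP.exists_bound hh hc
  obtain ⟨N, hN, hNb⟩ := hP.dom B
  refine ⟨_, hN.const_mul (‖T‖ * M), fun b hb n => ?_⟩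
  have h1 : ‖h (P.pt b n)‖ ≤ (1 + ‖n‖) ^ k * ‖h (P.pt b n)‖ :=
    le_mul_of_one_le_left (norm_nonneg _) (one_le_pow₀ (by linarith [norm_nonneg n]))
  calc ‖T (h (P.pt b n))‖ ≤ ‖T‖ * ‖h (P.pt b n)‖ := T.le_opNorm _
    _ ≤ ‖T‖ * (M * N n) := by
        gcongr
        exact (h1.trans (hbd b hb.1 n)).trans (by gcongr; exact hNb b hb n)
    _ = _ := by ring

theorem hasDerivAt_integral {k : ℕ} {h : E → W} (hh : HomogOn (σ + k) U h)
    (hc : ContDiffOn ℝ ∞ h U) (T : W →L[ℝ] ℂ) {b : ℝ} (hb : 0 < b) :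
    HasDerivAt (fun b => ∫ n, T (h (P.pt b n)) ∂ν)
      (∫ n, T (fderiv ℝ h (P.pt b n) P.e) ∂ν) b := by
  have hd : DifferentiableOn ℝ h U := hc.differentiableOn (by simp)
  have hh' : HomogOn (σ + (k + 1 : ℕ)) U (fderiv ℝ h) := by
    have := hh.fderiv hd
    push_cast
    rwa [← add_assoc]
  have hc' : ContinuousOn (fderiv ℝ h) U := hc.continuousOn_fderiv_of_isOpen hh.isOpen (by simp)
  let T' : (E →L[ℝ] W) →L[ℝ] ℂ := T.comp (ContinuousLinearMap.apply ℝ W P.e)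
  obtain ⟨M, hM, hMb⟩ := hP.bound_on hh' hc' T' (b + 1)
  have hcont : ∀ b, 0 ≤ b → Continuous fun n => T (h (P.pt b n)) := fun b hb =>
    T.continuous.comp (hc.continuousOn.comp_continuous (P.continuous_pt b) (hP.pt_mem hb))
  have hcont' : Continuous fun n => T' (fderiv ℝ h (P.pt b n)) :=
    T'.continuous.comp (hc'.comp_continuous (P.continuous_pt b) (hP.pt_mem hb.le))
  refine (hasDerivAt_integral_of_dominated_loc_of_deriv_le (s := Ioo 0 (b + 1))
    (F := fun b n => T (h (P.pt b n))) (F' := fun b n => T (fderiv ℝ h (P.pt b n) P.e))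
    (bound := M)
    (Ioo_mem_nhds hb (by linarith)) ?_ ?_ hcont'.aestronglyMeasurable ?_ hM ?_).2
  · filter_upwards [lt_mem_nhds hb] with b hb
    exact (hcont b hb.le).aestronglyMeasurable
  · obtain ⟨N, hN, hNb⟩ := hP.bound_on hh hc.continuousOn T b
    exact hN.mono' (hcont b hb.le).aestronglyMeasurable
      (Eventually.of_forall fun n => hNb b ⟨hb.le, le_rfl⟩ n)
  · exact Eventually.of_forall fun n b hb => hMb b ⟨hb.1.le, hb.2.le⟩ n
  · refine Eventually.of_forall fun n b hb => ?_
    have h1 := (hd.differentiableAt (hh.isOpen.mem_nhds (hP.pt_mem hb.1.le n))).hasFDerivAt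
    exact (T.hasFDerivAt (x := h (P.pt b n))).comp_hasDerivAt b
      (h1.comp_hasDerivAt b (P.hasDerivAt_pt b n))

theorem integrable {b : ℝ} (hb : 0 ≤ b) : Integrable (fun n => Ψ (P.pt b n)) ν := by
  have h0 : HomogOn (σ + (0 : ℕ)) U Ψ := by simpa using hP.hom
  have := hP.integrable_smul h0 hP.smooth.continuousOn (ContinuousLinearMap.id ℝ ℂ)
    (w := fun _ => 1) continuous_const (A := 1) (by simp) hb
  simpa using this

/-- The left side is the divergence in n of the field with components (1 - c_j/2) n_j ∂_eΨ + (1/4)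
∂_{x_j}Ψ. The second order equation turns the x_j terms into H(f, e), with H the second derivative
of Ψ; Euler's identity for ∂_eΨ then eliminates H(f, e) + H(L n, e). What is left involves only
derivatives along the axis, and `lam_eq` identifies the coefficient as λ + 1. -/
theorem divergence_identity [DecidableEq ι] {b : ℝ} (hb : 0 < b) (n : X) :
    ∑ j, ((1 - P.c j / 2) • fderiv ℝ Ψ (P.pt b n) P.e +
      ((1 - P.c j / 2) * P.basis.repr n j) •
        fderiv ℝ (fderiv ℝ Ψ) (P.pt b n) (P.L (P.basis j)) P.e -
      ((1 - P.c j / 2) * (2 * P.c j) * P.basis.repr n j ^ 2) •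
        fderiv ℝ (fderiv ℝ Ψ) (P.pt b n) P.e P.e +
      (1 / 4 : ℝ) • fderiv ℝ (fderiv ℝ Ψ) (P.pt b n) (P.L (P.basis j)) (x j) -
      (P.c j / 2 * P.basis.repr n j) • fderiv ℝ (fderiv ℝ Ψ) (P.pt b n) P.e (x j)) =
    -((lam + 1) • fderiv ℝ Ψ (P.pt b n) P.e + b • fderiv ℝ (fderiv ℝ Ψ) (P.pt b n) P.e P.e) := by
  have hz := hP.pt_mem hb.le n
  have hd : DifferentiableOn ℝ Ψ U := hP.smooth.differentiableOn (by simp)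
  have hdd : DifferentiableOn ℝ (fderiv ℝ Ψ) U :=
    (hP.smooth.fderiv_of_isOpen (m := ∞) hP.hom.isOpen (by simp)).differentiableOn (by simp)
  have heuler := (hP.hom.fderiv hd).fderiv_self hdd hz
  have hsymm : ∀ v w, fderiv ℝ (fderiv ℝ Ψ) (P.pt b n) v w =
      fderiv ℝ (fderiv ℝ Ψ) (P.pt b n) w v := by
    have : IsSymmSndFDerivAt ℝ Ψ (P.pt b n) :=
      (hP.smooth.contDiffAt (hP.hom.isOpen.mem_nhds hz)).isSymmSndFDerivAt
        (by rw [minSmoothness_of_isRCLikeNormedField]; exact WithTop.coe_le_coe.2 le_top)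
    exact fun v w => this.eq v w
  have hpde := hP.pde b hb n
  set D := fderiv ℝ Ψ (P.pt b n) with hD
  set H := fderiv ℝ (fderiv ℝ Ψ) (P.pt b n) with hH
  -- The coefficients c_j are 0 or 1. When c_j = 1, x_j = -L(e_j) makes the last term supply the
  -- half of the mixed derivative missing from 1 - c_j/2, and (1 - c_j/2) · 2c_j = c_j.
  have hterm : ∀ j, ((1 - P.c j / 2) • D P.e +
      ((1 - P.c j / 2) * P.basis.repr n j) • H (P.L (P.basis j)) P.e -
      ((1 - P.c j / 2) * (2 * P.c j) * P.basis.repr n j ^ 2) • H P.e P.e +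
      (1 / 4 : ℝ) • H (P.L (P.basis j)) (x j) -
      (P.c j / 2 * P.basis.repr n j) • H P.e (x j)) =
      (1 - P.c j / 2) • D P.e + P.basis.repr n j • H (P.L (P.basis j)) P.e -
      (P.c j * P.basis.repr n j ^ 2) • H P.e P.e +
      (1 / 4 : ℝ) • H (P.L (P.basis j)) (x j) := by
    intro j
    rcases hP.coeff j with h | ⟨h, h'⟩
    · simp [h]
    · rw [h, h', map_neg, map_neg, hsymm P.e (P.L (P.basis j))]
      module
  have hLn : H (P.L n) P.e = ∑ j, P.basis.repr n j • H (P.L (P.basis j)) P.e := by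
    have : P.L n = ∑ j, P.basis.repr n j • P.L (P.basis j) := by
      conv_lhs => rw [← P.basis.sum_repr n, map_sum]
      simp only [map_smul]
    rw [this]
    simp only [map_sum, map_smul, _root_.sum_apply, _root_.smul_apply]
  have hpt : H (P.pt b n) P.e = H P.f P.e + (b - P.Q n) • H P.e P.e + H (P.L n) P.e := by
    simp [Paraboloid.pt]
  rw [heuler] at hpt
  simp only [hterm, Finset.sum_add_distrib, Finset.sum_sub_distrib, ← Finset.sum_smul,
    ← Finset.smul_sum]
  rw [← hLn, show ∑ j, P.c j * P.basis.repr n j ^ 2 = P.Q n from rfl, ← Finset.sum_div,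
    ← hP.lam_eq]
  have h4 : ∑ j, H (P.L (P.basis j)) (x j) = (4 : ℝ) • H P.f P.e := by
    have := hpde
    rw [Complex.real_smul]
    push_cast
    linear_combination this
  have h5 : H (P.L n) P.e =
      (-(σ + 1)) • D P.e - H P.f P.e - (b - P.Q n) • H P.e P.e := by
    have : (-(σ + 1)) • D P.e = ((-(σ + 1)) • D) P.e := rfl
    rw [this, hpt]
    module
  rw [h4, h5]
  simp only [Finset.sum_const, Finset.card_univ, nsmul_eq_mul, mul_one]
  module

/-- Integrate the divergence identity over n. Weights linear in n meet first or second derivatives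
of Ψ and quadratic weights meet only second derivatives, so every term is integrable separately. -/
theorem integral_identity [ν.IsAddHaarMeasure] {b : ℝ} (hb : 0 < b) :
    (lam + 1) • ∫ n, fderiv ℝ Ψ (P.pt b n) P.e ∂ν +
      b • ∫ n, fderiv ℝ (fderiv ℝ Ψ) (P.pt b n) P.e P.e ∂ν = 0 := by
  classical
  have hd : DifferentiableOn ℝ Ψ U := hP.smooth.differentiableOn (by simp)
  have hs1 : ContDiffOn ℝ ∞ (fderiv ℝ Ψ) U :=
    hP.smooth.fderiv_of_isOpen (m := ∞) hP.hom.isOpen (by simp)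
  have hs2 : ContDiffOn ℝ ∞ (fderiv ℝ (fderiv ℝ Ψ)) U :=
    hs1.fderiv_of_isOpen (m := ∞) hP.hom.isOpen (by simp)
  have hh1 : HomogOn (σ + (1 : ℕ)) U (fderiv ℝ Ψ) := by simpa using hP.hom.fderiv hd
  have hh2 : HomogOn (σ + (2 : ℕ)) U (fderiv ℝ (fderiv ℝ Ψ)) := by
    have := hh1.fderiv (hs1.differentiableOn (by simp))
    convert this using 1
    push_cast
    ring
  have hcoord : ∀ j, ∃ A, 0 ≤ A ∧ ∀ n, |P.basis.repr n j| ≤ A * (1 + ‖n‖) := by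
    intro j
    refine ⟨‖(P.basis.coord j).toContinuousLinearMap‖, norm_nonneg _, fun n => ?_⟩
    have := (P.basis.coord j).toContinuousLinearMap.le_opNorm n
    calc |P.basis.repr n j| ≤ ‖(P.basis.coord j).toContinuousLinearMap‖ * ‖n‖ := this
      _ ≤ _ := by gcongr; linarith
  have i1 : ∀ v (w : X → ℝ), Continuous w → (∃ A, ∀ n, |w n| ≤ A * (1 + ‖n‖)) →
      Integrable (fun n => w n • fderiv ℝ Ψ (P.pt b n) v) ν := by
    rintro v w hw ⟨A, hA⟩
    exact hP.integrable_smul hh1 hs1.continuousOn (ContinuousLinearMap.apply ℝ ℂ v) hw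
      (A := A) (by simpa using hA) hb.le
  have i2 : ∀ u v (w : X → ℝ), Continuous w → (∃ A, ∀ n, |w n| ≤ A * (1 + ‖n‖) ^ 2) →
      Integrable (fun n => w n • fderiv ℝ (fderiv ℝ Ψ) (P.pt b n) u v) ν := by
    rintro u v w hw ⟨A, hA⟩
    exact hP.integrable_smul hh2 hs2.continuousOn
      ((ContinuousLinearMap.apply ℝ ℂ v).comp (ContinuousLinearMap.apply ℝ (E →L[ℝ] ℂ) u)) hw
      (A := A) hA hb.le
  have c1 : ∀ r : ℝ, ∃ A, ∀ n : X, |r| ≤ A * (1 + ‖n‖) := fun r =>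
    ⟨|r|, fun n => le_mul_of_one_le_right (abs_nonneg _) (by linarith [norm_nonneg n])⟩
  have c2 : ∀ r : ℝ, ∃ A, ∀ n : X, |r| ≤ A * (1 + ‖n‖) ^ 2 := fun r =>
    ⟨|r|, fun n => le_mul_of_one_le_right (abs_nonneg _)
      (one_le_pow₀ (by linarith [norm_nonneg n]))⟩
  have d1 : ∀ (r : ℝ) j, ∃ A, ∀ n : X, |r * P.basis.repr n j| ≤ A * (1 + ‖n‖) := fun r j => by
    obtain ⟨A, hA, h⟩ := hcoord j
    refine ⟨|r| * A, fun n => ?_⟩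
    rw [abs_mul, mul_assoc]
    gcongr
    exact h n
  have d2 : ∀ (r : ℝ) j, ∃ A, ∀ n : X, |r * P.basis.repr n j| ≤ A * (1 + ‖n‖) ^ 2 :=
    fun r j => by
    obtain ⟨A, hA, h⟩ := hcoord j
    refine ⟨|r| * A, fun n => ?_⟩
    rw [abs_mul, mul_assoc]
    gcongr
    refine (h n).trans ?_
    gcongr
    exact le_self_pow₀ (by linarith [norm_nonneg n]) two_ne_zero
  have e2 : ∀ (r : ℝ) j, ∃ A, ∀ n : X, |r * P.basis.repr n j ^ 2| ≤ A * (1 + ‖n‖) ^ 2 :=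
    fun r j => by
    obtain ⟨A, hA, h⟩ := hcoord j
    refine ⟨|r| * A ^ 2, fun n => ?_⟩
    rw [abs_mul, mul_assoc, abs_pow, ← mul_pow]
    gcongr
    exact h n
  have hrc := P.continuous_repr
  have hint : ∀ j, Integrable (fun n =>
      ((1 - P.c j / 2) • fderiv ℝ Ψ (P.pt b n) P.e +
      ((1 - P.c j / 2) * P.basis.repr n j) •
        fderiv ℝ (fderiv ℝ Ψ) (P.pt b n) (P.L (P.basis j)) P.e -
      ((1 - P.c j / 2) * (2 * P.c j) * P.basis.repr n j ^ 2) •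
        fderiv ℝ (fderiv ℝ Ψ) (P.pt b n) P.e P.e +
      (1 / 4 : ℝ) • fderiv ℝ (fderiv ℝ Ψ) (P.pt b n) (P.L (P.basis j)) (x j) -
      (P.c j / 2 * P.basis.repr n j) • fderiv ℝ (fderiv ℝ Ψ) (P.pt b n) P.e (x j))) ν := by
    intro j
    exact ((((i1 _ _ continuous_const (c1 _)).add (i2 _ _ _ (by fun_prop) (d2 _ j))).sub
      (i2 _ _ _ (by fun_prop) (e2 _ j))).add (i2 _ _ _ continuous_const (c2 _))).sub
      (i2 _ _ _ (by fun_prop) (d2 _ j))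
  have hzero : ∀ j, ∫ n,
      ((1 - P.c j / 2) • fderiv ℝ Ψ (P.pt b n) P.e +
      ((1 - P.c j / 2) * P.basis.repr n j) •
        fderiv ℝ (fderiv ℝ Ψ) (P.pt b n) (P.L (P.basis j)) P.e -
      ((1 - P.c j / 2) * (2 * P.c j) * P.basis.repr n j ^ 2) •
        fderiv ℝ (fderiv ℝ Ψ) (P.pt b n) P.e P.e +
      (1 / 4 : ℝ) • fderiv ℝ (fderiv ℝ Ψ) (P.pt b n) (P.L (P.basis j)) (x j) -
      (P.c j / 2 * P.basis.repr n j) • fderiv ℝ (fderiv ℝ Ψ) (P.pt b n) P.e (x j)) ∂ν = 0 := by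
    intro j
    refine integral_eq_zero_of_hasLineDerivAt (v := P.basis j)
      -- The j-th component of the vector field; the integrand is its derivative in the direction
      -- n_j.
      (g := fun n => ((1 - P.c j / 2) * P.basis.repr n j) • fderiv ℝ Ψ (P.pt b n) P.e +
        (1 / 4 : ℝ) • fderiv ℝ Ψ (P.pt b n) (x j))
      ((i1 _ _ (by fun_prop) (d1 _ j)).add (i1 _ _ continuous_const (c1 _))) (hint j)
      fun n => ?_
    have hz := hP.pt_mem hb.le n
    have hH := ((hs1.differentiableOn (by simp)).differentiableAt
      (hP.hom.isOpen.mem_nhds hz)).hasFDerivAt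
    have hline := HasFDerivAt.comp_hasLineDerivAt hH (P.hasLineDerivAt_pt b n j)
    have hev : ∀ v, HasLineDerivAt ℝ (fun n => fderiv ℝ Ψ (P.pt b n) v)
        (fderiv ℝ (fderiv ℝ Ψ) (P.pt b n)
          (P.L (P.basis j) - (2 * P.c j * P.basis.repr n j) • P.e) v) n (P.basis j) := fun v =>
      HasFDerivAt.comp_hasLineDerivAt (z := fun n => fderiv ℝ Ψ (P.pt b n))
        ((ContinuousLinearMap.apply ℝ ℂ v).hasFDerivAt (x := fderiv ℝ Ψ (P.pt b n))) hline
    have hr := (hasLineDerivAt_repr P.basis n j)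
    have h1 := HasDerivAt.add (HasDerivAt.smul (HasDerivAt.const_mul (1 - P.c j / 2) hr)
      (hev P.e)) (HasDerivAt.const_smul (1 / 4 : ℝ) (hev (x j)))
    refine HasDerivAt.congr_deriv h1 ?_
    simp only [zero_smul, add_zero, map_sub, map_smul, _root_.sub_apply,
      _root_.smul_apply]
    rcases hP.coeff j with h | ⟨h, -⟩
    · rw [h]; module
    · rw [h]; module
  have hsum : ∫ n, -((lam + 1) • fderiv ℝ Ψ (P.pt b n) P.e +
      b • fderiv ℝ (fderiv ℝ Ψ) (P.pt b n) P.e P.e) ∂ν = 0 := by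
    simp_rw [← hP.divergence_identity hb]
    rw [integral_finsetSum _ fun j _ => hint j]
    exact Finset.sum_eq_zero fun j _ => hzero j
  rw [integral_neg, neg_eq_zero, integral_add (i1 _ _ continuous_const (c1 _))
    (i2 _ _ _ continuous_const (c2 _)), integral_smul, integral_smul] at hsum
  exact hsum

/-- Newton's shell theorem for paraboloids. -/
theorem integral_eq [ν.IsAddHaarMeasure] {b : ℝ} (hb : 0 ≤ b) :
    ∫ n, Ψ (P.pt b n) ∂ν = ∫ n, Ψ (P.pt 0 n) ∂ν := by
  have hd : DifferentiableOn ℝ Ψ U := hP.smooth.differentiableOn (by simp)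
  have hs1 : ContDiffOn ℝ ∞ (fderiv ℝ Ψ) U :=
    hP.smooth.fderiv_of_isOpen (m := ∞) hP.hom.isOpen (by simp)
  have hh0 : HomogOn (σ + (0 : ℕ)) U Ψ := by simpa using hP.hom
  have hh1 : HomogOn (σ + (1 : ℕ)) U (fderiv ℝ Ψ) := by simpa using hP.hom.fderiv hd
  let T := ContinuousLinearMap.apply ℝ ℂ P.e
  set V : ℝ → ℂ := fun b => ∫ n, Ψ (P.pt b n) ∂ν with hV
  set V1 : ℝ → ℂ := fun b => ∫ n, fderiv ℝ Ψ (P.pt b n) P.e ∂ν with hV1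
  set V2 : ℝ → ℂ := fun b => ∫ n, fderiv ℝ (fderiv ℝ Ψ) (P.pt b n) P.e P.e ∂ν with hV2
  have hVd : ∀ b, 0 < b → HasDerivAt V (V1 b) b := fun b hb =>
    hP.hasDerivAt_integral hh0 hP.smooth (ContinuousLinearMap.id ℝ ℂ) hb
  have hV1d : ∀ b, 0 < b → HasDerivAt V1 (V2 b) b := fun b hb =>
    hP.hasDerivAt_integral hh1 hs1 T hb
  have hode : ∀ b, 0 < b → (lam + 1) • V1 b + b • V2 b = 0 := fun b hb => hP.integral_identity hb
  -- b^(λ+1) is the integrating factor of (λ + 1) V' + b V'' = 0.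
  have hGd : ∀ b, 0 < b → HasDerivAt (fun b : ℝ => b ^ (lam + 1) • V1 b) 0 b := by
    intro b hb
    have h1 := (Real.hasDerivAt_rpow_const (x := b) (p := lam + 1) (Or.inl hb.ne')).smul
      (hV1d b hb)
    refine h1.congr_deriv ?_
    have h2 : b ^ (lam + 1) = b ^ lam * b := by
      rw [Real.rpow_add hb, Real.rpow_one]
    rw [h2, show lam + 1 - 1 = lam by ring]
    have : b ^ lam • ((lam + 1) • V1 b + b • V2 b) = 0 := by rw [hode b hb, smul_zero]
    rw [← this]
    module
  have hGconst : ∀ b, 0 < b → b ^ (lam + 1) • V1 b = V1 1 := by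
    intro b hb
    have h1 := (convex_Ioi (0 : ℝ)).is_const_of_fderivWithin_eq_zero (𝕜 := ℝ)
      (f := fun b : ℝ => b ^ (lam + 1) • V1 b)
      (fun x hx => (hGd x hx).differentiableAt.differentiableWithinAt)
      (fun x hx => by
        rw [fderivWithin_of_isOpen isOpen_Ioi hx]
        exact (hGd x hx).hasFDerivAt.fderiv.trans (by ext; simp)) hb (mem_Ioi.2 one_pos)
    simpa using h1
  -- V' is bounded on (0, 1] while b^(λ+1) tends to 0, so the conserved quantity vanishes. This uses
  -- the regularity of Ψ at the isotropic cone and rules out the singular solution b^(-λ).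
  have hV1one : V1 1 = 0 := by
    obtain ⟨M, hM, hMb⟩ := hP.bound_on hh1 hs1.continuousOn T 1
    have hb1 : ∀ b ∈ Ioc (0 : ℝ) 1, ‖V1 1‖ ≤ b ^ (lam + 1) * ∫ n, M n ∂ν := by
      intro b hb
      rw [← hGconst b hb.1, norm_smul, Real.norm_of_nonneg (Real.rpow_nonneg hb.1.le _)]
      gcongr
      · exact Real.rpow_nonneg hb.1.le _
      · exact norm_integral_le_of_norm_le hM
          (Eventually.of_forall fun n => hMb b ⟨hb.1.le, hb.2⟩ n)
    have hlim : Tendsto (fun b : ℝ => b ^ (lam + 1) * ∫ n, M n ∂ν) (𝓝[>] 0) (𝓝 0) := by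
      have h1 : ContinuousAt (fun b : ℝ => b ^ (lam + 1) * ∫ n, M n ∂ν) 0 :=
        (Real.continuousAt_rpow_const _ _ (Or.inr (by linarith [hP.lam_pos]))).mul_const _
      have h2 := h1.tendsto
      rw [Real.zero_rpow (by linarith [hP.lam_pos]), zero_mul] at h2
      exact h2.mono_left nhdsWithin_le_nhds
    have : ‖V1 1‖ ≤ 0 := ge_of_tendsto hlim (by
      filter_upwards [Ioc_mem_nhdsGT (zero_lt_one' ℝ)] with b hb using hb1 b hb)
    exact norm_le_zero_iff.1 this
  have hV1zero : ∀ b, 0 < b → V1 b = 0 := by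
    intro b hb
    have := hGconst b hb
    rw [hV1one] at this
    exact (smul_eq_zero.1 this).resolve_left (Real.rpow_pos_of_pos hb _).ne'
  have hVconst : ∀ b, 0 < b → V b = V 1 := by
    intro b hb
    exact (convex_Ioi (0 : ℝ)).is_const_of_fderivWithin_eq_zero (𝕜 := ℝ) (f := V)
      (fun x hx => (hVd x hx).differentiableAt.differentiableWithinAt)
      (fun x hx => by
        rw [fderivWithin_of_isOpen isOpen_Ioi hx]
        exact (hVd x hx).hasFDerivAt.fderiv.trans (by ext; simp [hV1zero x hx])) hb
      (mem_Ioi.2 one_pos)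
  -- The differential equation is available only for b > 0; the endpoint is reached by dominated
  -- convergence.
  have hV0 : V 0 = V 1 := by
    obtain ⟨M, hM, hMb⟩ := hP.bound_on hh0 hP.smooth.continuousOn (ContinuousLinearMap.id ℝ ℂ) 1
    have h1 : Tendsto V (𝓝[>] 0) (𝓝 (V 0)) := by
      refine tendsto_integral_filter_of_dominated_convergence M ?_ ?_ hM ?_
      · filter_upwards [self_mem_nhdsWithin] with b hb
        exact (hP.integrable (mem_Ioi.1 hb).le).aestronglyMeasurable
      · filter_upwards [Ioc_mem_nhdsGT (zero_lt_one' ℝ)] with b hb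
        exact Eventually.of_forall fun n => hMb b ⟨hb.1.le, hb.2⟩ n
      · refine Eventually.of_forall fun n => ?_
        have hc : ContinuousAt (fun b => Ψ (P.pt b n)) 0 :=
          ContinuousAt.comp (f := fun b => P.pt b n)
            (hP.smooth.continuousOn.continuousAt (hP.hom.isOpen.mem_nhds (hP.pt_mem le_rfl n)))
            (P.hasDerivAt_pt 0 n).continuousAt
        exact hc.tendsto.mono_left nhdsWithin_le_nhds
    have h2 : Tendsto V (𝓝[>] 0) (𝓝 (V 1)) :=
      tendsto_const_nhds.congr' (by
        filter_upwards [self_mem_nhdsWithin] with b hb using (hVconst b hb).symm)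
    exact tendsto_nhds_unique h1 h2
  rcases hb.eq_or_lt with rfl | hb
  · rfl
  · change V b = V 0
    rw [hVconst b hb, hV0]

/-- V is constant, and it tends to 0 as b → ∞: every point of the paraboloid goes to infinity along
the axis. The bound κ(1 + ‖n‖) ≤ ‖pt‖ is uniform in b, so for σ > dim X it gives a majorant
independent of b. -/
theorem integral_eq_zero [ν.IsAddHaarMeasure] (hσ : Module.finrank ℝ X < σ)
    (he : P.e ≠ 0) {b : ℝ} (hb : 0 ≤ b) : ∫ n, Ψ (P.pt b n) ∂ν = 0 := by
  obtain ⟨κ, hκ, hl⟩ := hP.lower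
  obtain ⟨M, hM, hMb⟩ := hP.hom.exists_bound hP.smooth.continuousOn hP.closed hP.smul_mem
    hP.subset
  have hσ0 : 0 < σ := lt_of_le_of_lt (Nat.cast_nonneg _) hσ
  have hlim : Tendsto (fun b => ∫ n, Ψ (P.pt b n) ∂ν) atTop (𝓝 (∫ _, (0 : ℂ) ∂ν)) := by
    refine tendsto_integral_filter_of_dominated_convergence
      (fun n => M * κ ^ (-σ) * (1 + ‖n‖) ^ (-σ)) ?_ ?_
      ((integrable_one_add_norm hσ).const_mul _) ?_
    · filter_upwards [eventually_ge_atTop 0] with b hb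
      exact (hP.integrable hb).aestronglyMeasurable
    · filter_upwards [eventually_ge_atTop 0] with b hb
      refine Eventually.of_forall fun n => (hMb _ (hP.mem b hb n) (hP.pt_ne_zero hb n)).trans ?_
      rw [mul_assoc, ← Real.mul_rpow hκ.le (by positivity)]
      gcongr M * ?_
      exact Real.rpow_le_rpow_of_nonpos (by positivity) (hl b hb n) (by linarith)
    · refine Eventually.of_forall fun n => ?_
      have hnorm : Tendsto (fun b => ‖P.pt b n‖) atTop atTop := by
        have h1 : Tendsto (fun b : ℝ => b * ‖P.e‖ + -‖P.f - P.Q n • P.e + P.L n‖) atTop atTop :=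
          tendsto_atTop_add_const_right _ _
            (tendsto_id.atTop_mul_const (norm_pos_iff.2 he))
        refine tendsto_atTop_mono' _ ?_ h1
        filter_upwards [eventually_ge_atTop 0] with b hb
        have h2 : P.pt b n = b • P.e - -(P.f - P.Q n • P.e + P.L n) := by
          unfold Paraboloid.pt
          module
        have h3 := norm_sub_norm_le (b • P.e) (-(P.f - P.Q n • P.e + P.L n))
        rw [h2]
        rw [norm_smul, Real.norm_of_nonneg hb, norm_neg] at h3
        linarith
      have h1 : Tendsto (fun b => M * ‖P.pt b n‖ ^ (-σ)) atTop (𝓝 0) := by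
        simpa using ((tendsto_rpow_neg_atTop hσ0).comp hnorm).const_mul M
      refine squeeze_zero_norm' ?_ h1
      filter_upwards [eventually_ge_atTop 0] with b hb
      exact hMb _ (hP.mem b hb n) (hP.pt_ne_zero hb n)
  have hconst : Tendsto (fun b => ∫ n, Ψ (P.pt b n) ∂ν) atTop (𝓝 (∫ n, Ψ (P.pt 0 n) ∂ν)) :=
    tendsto_const_nhds.congr' (by
      filter_upwards [eventually_ge_atTop 0] with b hb using (hP.integral_eq hb).symm)
  rw [hP.integral_eq hb, tendsto_nhds_unique hconst hlim, integral_zero]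

end Paraboloid.Admissible

/-! ### Algebra of ℝ, ℂ and ℍ -/

section Field

variable {F : Type*} [NormedDivisionRing F] [StarRing F] [InnerProductSpace ℝ F]

/-- The ring product and the real scalar action on `F` are not assumed to be compatible;
compatibility is transported from the model field. -/
theorem IsClassicalField.smul_mul (hF : IsClassicalField F) (r : ℝ) (a b : F) :
    r • a * b = r • (a * b) := by
  rcases hF with ⟨e, -⟩ | ⟨e, -⟩ | ⟨e, -⟩ <;>
  · refine EquivLike.injective e ?_
    rw [map_mul, map_smul, map_smul, map_mul, smul_mul_assoc]

theorem IsClassicalField.mul_smul (hF : IsClassicalField F) (r : ℝ) (a b : F) :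
    a * r • b = r • (a * b) := by
  rcases hF with ⟨e, -⟩ | ⟨e, -⟩ | ⟨e, -⟩ <;>
  · refine EquivLike.injective e ?_
    rw [map_mul, map_smul, map_smul, map_mul, mul_smul_comm]

theorem IsClassicalField.isScalarTower (hF : IsClassicalField F) : IsScalarTower ℝ F F :=
  ⟨hF.smul_mul⟩

theorem IsClassicalField.smulCommClass (hF : IsClassicalField F) : SMulCommClass ℝ F F :=
  ⟨fun r a b => (hF.mul_smul r a b).symm⟩

theorem IsClassicalField.star_mul_self (hF : IsClassicalField F) (a : F) :
    star a * a = (‖a‖ ^ 2) • (1 : F) := by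
  rcases hF with ⟨e, he⟩ | ⟨e, he⟩ | ⟨e, he⟩ <;>
    (refine EquivLike.injective e ?_
     rw [map_mul, map_star, map_smul, map_one, ← he.norm_map_of_map_zero (map_zero e)])
  · simp [sq]
  · rw [Complex.star_def, Complex.conj_mul']
    simp
  · rw [Quaternion.star_mul_self, Quaternion.normSq_eq_norm_mul_self, ← sq, Algebra.smul_def,
      mul_one]
    rfl

theorem IsClassicalField.mul_star_self (hF : IsClassicalField F) (a : F) :
    a * star a = (‖a‖ ^ 2) • (1 : F) := by
  rcases hF with ⟨e, he⟩ | ⟨e, he⟩ | ⟨e, he⟩ <;>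
    (refine EquivLike.injective e ?_
     rw [map_mul, map_star, map_smul, map_one, ← he.norm_map_of_map_zero (map_zero e)])
  · simp [sq]
  · rw [Complex.star_def, Complex.mul_conj']
    simp
  · rw [Quaternion.self_mul_star, Quaternion.normSq_eq_norm_mul_self, ← sq, Algebra.smul_def,
      mul_one]
    rfl

theorem smul_one_injective : Function.Injective fun r : ℝ => r • (1 : F) :=
  smul_left_injective ℝ one_ne_zero

theorem IsClassicalField.norm_star (hF : IsClassicalField F) (a : F) : ‖star a‖ = ‖a‖ := by
  have h := hF.mul_star_self a
  have h' := hF.star_mul_self (star a)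
  rw [star_star, h] at h'
  have := smul_one_injective h'
  exact ((sq_eq_sq₀ (norm_nonneg _) (norm_nonneg _)).1 this).symm

/-- Polarize a* a = ‖a‖²: expand (1 + a)* (1 + a) and compare with the expansion of ‖1 + a‖². -/
theorem IsClassicalField.add_star (hF : IsClassicalField F) (a : F) :
    a + star a = (2 * inner ℝ 1 a) • (1 : F) := by
  have h := hF.star_mul_self (1 + a)
  have h1 := hF.star_mul_self a
  rw [@norm_add_sq_real, star_add, star_one, add_mul, mul_add, mul_add, h1, norm_one] at h
  have : a + star a = (1 ^ 2 + 2 * inner ℝ 1 a + ‖a‖ ^ 2 : ℝ) • (1 : F) - 1 - (‖a‖ ^ 2) • 1 := by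
    rw [← h]
    noncomm_ring
  rw [this]
  module

variable [StarModule ℝ F]

theorem star_coe_imPart (w : imPart F) : star (w : F) = -(w : F) := skewAdjoint.mem_iff.1 w.2

theorem IsClassicalField.inner_one_imPart (hF : IsClassicalField F) (w : imPart F) :
    inner ℝ (1 : F) (w : F) = 0 := by
  have h := hF.add_star (w : F)
  rw [star_coe_imPart, add_neg_cancel] at h
  have := (smul_eq_zero.1 h.symm).resolve_right one_ne_zero
  linarith

theorem IsClassicalField.norm_sq_smul_one_add (hF : IsClassicalField F) (r : ℝ) (w : imPart F) :
    ‖r • (1 : F) + w‖ ^ 2 = r ^ 2 + ‖w‖ ^ 2 := by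
  rw [@norm_add_sq_real, inner_smul_left, hF.inner_one_imPart, norm_smul, norm_one]
  simp

/-- The decomposition a = ⟨1, a⟩ + (a - a*)/2 is orthogonal. A basis adapted to it is needed because
the line ℝ·1 is spanned by the directions of axis and apex, whereas Im F consists of directions of
`N^*`. -/
theorem IsClassicalField.exists_basis [FiniteDimensional ℝ F] (hF : IsClassicalField F) :
    ∃ o : OrthonormalBasis (Unit ⊕ Fin (Module.finrank ℝ (imPart F))) ℝ F,
      (∀ i, o (Sum.inl i) = 1) ∧
      ∀ j, o (Sum.inr j) = (stdOrthonormalBasis ℝ (imPart F) j : F) := by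
  set c := stdOrthonormalBasis ℝ (imPart F) with hc
  let v : Unit ⊕ Fin (Module.finrank ℝ (imPart F)) → F := Sum.elim (fun _ => 1) fun j => (c j : F)
  have hon : Orthonormal ℝ v := by
    rw [orthonormal_iff_ite]
    rintro (i | i) (j | j)
    · simp [v]
    · simpa [v] using hF.inner_one_imPart (c j)
    · simpa [v, real_inner_comm] using hF.inner_one_imPart (c i)
    · simpa [v] using orthonormal_iff_ite.1 c.orthonormal i j
  have hsp : ⊤ ≤ Submodule.span ℝ (Set.range v) := by
    intro a _
    have h1 : a = inner ℝ 1 a • (1 : F) + (1 / 2 : ℝ) • (a - star a) := by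
      have := hF.add_star a
      have h2 : inner ℝ 1 a • (1 : F) = (1 / 2 : ℝ) • (a + star a) := by
        rw [this]
        module
      rw [h2]
      module
    rw [h1]
    refine Submodule.add_mem _ (Submodule.smul_mem _ _ (Submodule.subset_span ⟨Sum.inl (), rfl⟩))
      (Submodule.smul_mem _ _ ?_)
    have hw : a - star a ∈ imPart F := skewAdjoint.mem_iff.2 (by simp)
    have h2 : (⟨a - star a, hw⟩ : imPart F) = ∑ j, c.repr ⟨a - star a, hw⟩ j • c j :=
      (c.sum_repr _).symm
    have h3 : a - star a = ∑ j, c.repr ⟨a - star a, hw⟩ j • (c j : F) := by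
      have := congrArg (Subtype.val) h2
      simpa using this
    rw [h3]
    exact Submodule.sum_mem _ fun j _ =>
      Submodule.smul_mem _ _ (Submodule.subset_span ⟨Sum.inr j, rfl⟩)
  refine ⟨OrthonormalBasis.mk hon hsp, fun i => ?_, fun j => ?_⟩ <;> simp [v]

theorem IsClassicalField.dimF_eq [FiniteDimensional ℝ F] (hF : IsClassicalField F) :
    dimF F = 1 + Module.finrank ℝ (imPart F) := by
  obtain ⟨o, -⟩ := hF.exists_basis
  rw [dimF, Module.finrank_eq_card_basis o.toBasis]
  simp

end Field

/-! ### The Hermitian form and its isometries -/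

section Form

variable {F : Type*} [NormedDivisionRing F] [InnerProductSpace ℝ F] {p q : ℕ}

/-- The signs of the Hermitian form. -/
def sgn {p q : ℕ} : Idx p q → ℝ := Sum.elim (fun _ => 1) fun _ => -1

theorem sgn_mul_self {p q : ℕ} (i : Idx p q) : sgn i * sgn i = 1 := by
  rcases i with i | i <;> simp [sgn]

/-- The real bilinear form that polarizes `form`. -/
def bform (x y : Vec F p q) : ℝ := ∑ i, sgn i * inner ℝ (x i) (y i)

theorem form_eq_sum (z : Vec F p q) : form z = ∑ i, sgn i * ‖z i‖ ^ 2 := by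
  simp [form, sgn, Fintype.sum_sum_type, sub_eq_add_neg]

theorem bform_eq (x y : Vec F p q) : bform x y = (form (x + y) - form x - form y) / 2 := by
  simp only [form_eq_sum, bform, ← Finset.sum_sub_distrib, Finset.sum_div]
  refine Finset.sum_congr rfl fun i _ => ?_
  rw [Pi.add_apply, @norm_add_sq_real]
  ring

variable [StarRing F]

theorem star_dotProduct_formMatrix (hF : IsClassicalField F) (z : Vec F p q) :
    star z ⬝ᵥ (formMatrix F p q *ᵥ z) = form z • (1 : F) := by
  have h : formMatrix F p q *ᵥ z = fun i => sgn i • z i := by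
    funext i
    rcases i with i | i <;>
      simp [formMatrix, Matrix.mulVec, dotProduct, Fintype.sum_sum_type, sgn, Matrix.one_apply,
        Matrix.fromBlocks]
  rw [h, dotProduct, form_eq_sum, Finset.sum_smul]
  refine Finset.sum_congr rfl fun i _ => ?_
  rw [hF.mul_smul, Pi.star_apply, hF.star_mul_self, smul_smul]

theorem form_mulVec (hF : IsClassicalField F) {g : Mat F p q} (hg : g ∈ groupG F p q)
    (z : Vec F p q) : form (g *ᵥ z) = form z := by
  apply smul_one_injective (F := F)
  simp only [← star_dotProduct_formMatrix hF]
  rw [Matrix.star_mulVec, ← Matrix.dotProduct_mulVec, Matrix.mulVec_mulVec, Matrix.mulVec_mulVec]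
  have : gᴴ * formMatrix F p q * g = formMatrix F p q := hg
  rw [this]

theorem bform_mulVec (hF : IsClassicalField F) {g : Mat F p q} (hg : g ∈ groupG F p q)
    (x y : Vec F p q) : bform (g *ᵥ x) (g *ᵥ y) = bform x y := by
  rw [bform_eq, bform_eq, ← Matrix.mulVec_add, form_mulVec hF hg, form_mulVec hF hg,
    form_mulVec hF hg]

theorem formMatrix_mul_self : formMatrix F p q * formMatrix F p q = 1 := by
  simp [formMatrix, Matrix.fromBlocks_multiply, ← Matrix.fromBlocks_one]

theorem mulVec_leftInverse {g : Mat F p q} (hg : g ∈ groupG F p q) (z : Vec F p q) :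
    (formMatrix F p q * gᴴ * formMatrix F p q) *ᵥ (g *ᵥ z) = z := by
  have h : gᴴ * formMatrix F p q * g = formMatrix F p q := hg
  rw [Matrix.mulVec_mulVec, Matrix.mul_assoc, Matrix.mul_assoc, ← Matrix.mul_assoc gᴴ, h,
    formMatrix_mul_self, Matrix.one_mulVec]

/-- Multiplication by a matrix as a real linear map. -/
def mulVecL [FiniteDimensional ℝ F] (hF : IsClassicalField F) (g : Mat F p q) :
    Vec F p q →L[ℝ] Vec F p q :=
  LinearMap.toContinuousLinearMap
    { toFun := fun z => g *ᵥ z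
      map_add' := fun x y => Matrix.mulVec_add g x y
      map_smul' := fun r x => by
        have := hF.smulCommClass
        exact Matrix.mulVec_smul g r x }

@[simp] theorem mulVecL_apply [FiniteDimensional ℝ F] (hF : IsClassicalField F) (g : Mat F p q)
    (z : Vec F p q) : mulVecL hF g z = g *ᵥ z := rfl

end Form

/-! ### Invariance of the ultrahyperbolic operator -/

section Trace

variable {F : Type*} [NormedDivisionRing F] [InnerProductSpace ℝ F] {p q : ℕ} {κ : Type*}
  [Fintype κ]

/-- The contraction of a bilinear form with the (inverse) form of signature
`(d(p + 1), d(q + 1))`. -/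
def boxTrace (o : OrthonormalBasis κ ℝ F) (B : Vec F p q →L[ℝ] Vec F p q →L[ℝ] ℂ) : ℂ :=
  ∑ i, sgn i • ∑ k, B (Pi.single i (o k)) (Pi.single i (o k))

theorem vec_eq_sum (o : OrthonormalBasis κ ℝ F) (z : Vec F p q) :
    z = ∑ a : Idx p q × κ, inner ℝ (o a.2) (z a.1) • (Pi.single a.1 (o a.2) : Vec F p q) := by
  funext i
  rw [Fintype.sum_prod_type, Finset.sum_apply, Finset.sum_eq_single i]
  · rw [Finset.sum_apply]
    simp only [Pi.smul_apply, Pi.single_eq_same]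
    exact (o.sum_repr' (z i)).symm
  · intro j _ hj
    simp [Pi.single_eq_of_ne hj.symm]
  · simp

theorem bform_eq_sum (o : OrthonormalBasis κ ℝ F) (x y : Vec F p q) :
    bform x y = ∑ a : Idx p q × κ, sgn a.1 * (inner ℝ (o a.2) (x a.1) * inner ℝ (o a.2) (y a.1)) := by
  rw [Fintype.sum_prod_type, bform]
  refine Finset.sum_congr rfl fun i _ => ?_
  rw [← o.sum_inner_mul_inner (x i) (y i), Finset.mul_sum]
  refine Finset.sum_congr rfl fun k _ => ?_
  rw [real_inner_comm]

/-- If M is the real matrix of g and J the sign matrix, isometry means Mᵀ J M = J, while the trace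
transforms by M J Mᵀ. For invertible matrices the two conditions are equivalent, as J² = 1. -/
theorem boxTrace_comp (o : OrthonormalBasis κ ℝ F) (g : Vec F p q →L[ℝ] Vec F p q)
    (hg : ∀ x y, bform (g x) (g y) = bform x y) (B : Vec F p q →L[ℝ] Vec F p q →L[ℝ] ℂ) :
    boxTrace o (B.bilinearComp g g) = boxTrace o B := by
  classical
  let E : Idx p q × κ → Vec F p q := fun a => Pi.single a.1 (o a.2)
  let J : Matrix (Idx p q × κ) (Idx p q × κ) ℝ := Matrix.diagonal fun a => sgn a.1
  let M : Matrix (Idx p q × κ) (Idx p q × κ) ℝ := Matrix.of fun c a => inner ℝ (o c.2) (g (E a) c.1)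
  have hE : ∀ a, g (E a) = ∑ c, M c a • E c := fun a => vec_eq_sum o (g (E a))
  have hJJ : J * J = 1 := by
    simp only [J, Matrix.diagonal_mul_diagonal, sgn_mul_self]
    exact Matrix.diagonal_one
  have h1 : Mᵀ * J * M = J := by
    ext a b
    have h := hg (E a) (E b)
    rw [bform_eq_sum o, bform_eq_sum o] at h
    rw [Matrix.mul_assoc, Matrix.mul_apply]
    have hl : ∑ j, Mᵀ a j * (J * M) j b = ∑ c : Idx p q × κ, sgn c.1 *
        (inner ℝ (o c.2) (g (E a) c.1) * inner ℝ (o c.2) (g (E b) c.1)) := by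
      refine Finset.sum_congr rfl fun c _ => ?_
      simp only [J, M, Matrix.diagonal_mul, Matrix.transpose_apply, Matrix.of_apply]
      ring
    rw [hl, h]
    have hin : ∀ c a : Idx p q × κ, inner ℝ (o c.2) (E a c.1) = if c = a then (1 : ℝ) else 0 := by
      rintro ⟨i, k⟩ ⟨j, l⟩
      by_cases hij : i = j
      · subst hij
        simp [E, orthonormal_iff_ite.1 o.orthonormal, Prod.ext_iff]
      · simp [E, hij]
    simp only [hin, J, Matrix.diagonal_apply]
    by_cases hab : a = b
    · subst hab
      simp
    · rw [if_neg hab]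
      refine Finset.sum_eq_zero fun c _ => ?_
      by_cases hc : c = a
      · subst hc
        simp [hab]
      · simp [hc]
  have h2 : M * J * Mᵀ = J := by
    have h3 : J * Mᵀ * J * M = 1 := by
      rw [Matrix.mul_assoc J, Matrix.mul_assoc J, h1, hJJ]
    -- For square matrices a left inverse is a right inverse; this passes from the form to its dual.
    have h4 : M * (J * Mᵀ * J) = 1 := mul_eq_one_comm.1 h3
    calc M * J * Mᵀ = M * (J * Mᵀ * J) * J := by
          simp only [Matrix.mul_assoc, hJJ, Matrix.mul_one]
      _ = J := by rw [h4, Matrix.one_mul]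
  have hb : ∀ B : Vec F p q →L[ℝ] Vec F p q →L[ℝ] ℂ, boxTrace o B = ∑ a, sgn a.1 • B (E a) (E a) := by
    intro B
    simp only [boxTrace, Fintype.sum_prod_type, Finset.smul_sum, E]
  rw [hb, hb]
  have hB : ∀ a, B (g (E a)) (g (E a)) = ∑ c, ∑ d, (M c a * M d a) • B (E c) (E d) := by
    intro a
    conv_lhs => rw [hE a]
    simp only [map_sum, map_smul, _root_.sum_apply, _root_.smul_apply, Finset.smul_sum, smul_smul]
    rw [Finset.sum_comm]
    simp only [mul_comm]
  have hJ : ∀ c d, J c d = ∑ a, sgn a.1 * (M c a * M d a) := by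
    intro c d
    rw [← h2, Matrix.mul_apply]
    refine Finset.sum_congr rfl fun a _ => ?_
    simp only [J, Matrix.mul_diagonal, Matrix.transpose_apply]
    ring
  calc ∑ a, sgn a.1 • (B.bilinearComp g g) (E a) (E a)
      = ∑ a, ∑ c, ∑ d, (sgn a.1 * (M c a * M d a)) • B (E c) (E d) := by
        refine Finset.sum_congr rfl fun a _ => ?_
        rw [ContinuousLinearMap.bilinearComp_apply, hB]
        simp only [Finset.smul_sum, smul_smul]
    _ = ∑ c, ∑ d, J c d • B (E c) (E d) := by
        rw [Finset.sum_comm]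
        refine Finset.sum_congr rfl fun c _ => ?_
        rw [Finset.sum_comm]
        refine Finset.sum_congr rfl fun d _ => ?_
        rw [hJ, Finset.sum_smul]
    _ = ∑ a, sgn a.1 • B (E a) (E a) := by
        refine Finset.sum_congr rfl fun c _ => ?_
        rw [Finset.sum_eq_single c]
        · simp [J]
        · intro d _ hd
          simp [J, hd.symm]
        · simp

end Trace

theorem sum_fin_split {M : Type*} [AddCommMonoid M] {p q : ℕ} (hpq : p < q) (f : Fin q → M) :
    ∑ k, f k = ∑ i : Fin p, f (Fin.castLE hpq.le i) +
      ∑ m : Fin (q - p), f ⟨p + m, by omega⟩ := by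
  let e : Fin p ⊕ Fin (q - p) ≃ Fin q := finSumFinEquiv.trans (finCongr (by omega))
  rw [← e.sum_comp, Fintype.sum_sum_type]
  congr 1

/-! ### The orbits of N^* -/

section Surface

variable {F : Type*} [NormedDivisionRing F] [StarRing F] [InnerProductSpace ℝ F]
    [StarModule ℝ F] {p q : ℕ}

theorem vStar_add (u u' : Fin p → F) (v v' : Fin (q - p) → F) :
    vStar (q := q) (u + u') (v + v') = vStar u v + vStar u' v' := by
  funext k
  simp only [vStar, Pi.add_apply]
  split_ifs
  · rw [star_add, neg_add]
  · rfl

theorem vStar_smul (r : ℝ) (u : Fin p → F) (v : Fin (q - p) → F) :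
    vStar (q := q) (r • u) (r • v) = r • vStar u v := by
  funext k
  simp only [vStar, Pi.smul_apply]
  split_ifs
  · rw [star_smul, star_trivial, smul_neg]
  · rfl

theorem vStar_castLE (hpq : p < q) (u : Fin p → F) (v : Fin (q - p) → F) (i : Fin p) :
    vStar u v (Fin.castLE hpq.le i) = -star (u i) := by
  simp [vStar]

theorem vStar_add_right (hpq : p < q) (u : Fin p → F) (v : Fin (q - p) → F) (m : Fin (q - p)) :
    vStar u v (⟨p + m, by omega⟩ : Fin q) = v m := by
  simp [vStar]

theorem sum_norm_vStar (hF : IsClassicalField F) (hpq : p < q) (u : Fin p → F)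
    (v : Fin (q - p) → F) :
    ∑ k, ‖vStar u v (k : Fin q)‖ ^ 2 = ∑ i, ‖u i‖ ^ 2 + ∑ m, ‖v m‖ ^ 2 := by
  rw [sum_fin_split hpq]
  simp only [vStar_castLE hpq, vStar_add_right hpq, norm_neg, hF.norm_star]

/-- The linear part of the orbit map of `N^*`. -/
def orbitLin (F : Type*) [NormedDivisionRing F] [StarRing F] [InnerProductSpace ℝ F]
    [StarModule ℝ F] (p q : ℕ) : NStarCoord F p q →ₗ[ℝ] Vec F p q where
  toFun n := Sum.elim (Fin.cons (n.2.2 : F) fun i => star (n.1 i))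
    (Fin.cons (n.2.2 : F) fun k => -star (vStar n.1 n.2.1 k))
  map_add' n n' := by
    funext i
    rcases i with i | i
    · refine Fin.cases ?_ (fun i => ?_) i <;> simp
    · refine Fin.cases ?_ (fun i => ?_) i
      · simp
      · simp [vStar_add, add_comm]
  map_smul' r n := by
    funext i
    rcases i with i | i
    · refine Fin.cases ?_ (fun i => ?_) i <;> simp
    · refine Fin.cases ?_ (fun i => ?_) i
      · simp
      · simp [vStar_smul]

/-- The common axis of the orbits, the isotropic vector `(e_1 + e_n) / 2`. -/
def axis (F : Type*) [NormedDivisionRing F] [InnerProductSpace ℝ F] (p q : ℕ) : Vec F p q :=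
  Pi.single (Sum.inl 0) ((1 / 2 : ℝ) • 1) + Pi.single (Sum.inr 0) ((1 / 2 : ℝ) • 1)

/-- The isotropic vector `(e_n - e_1) / 2`. -/
def apex (F : Type*) [NormedDivisionRing F] [InnerProductSpace ℝ F] (p q : ℕ) : Vec F p q :=
  Pi.single (Sum.inr 0) ((1 / 2 : ℝ) • 1) - Pi.single (Sum.inl 0) ((1 / 2 : ℝ) • 1)

/-- The orbit of `N^*` through `apex + b • axis`. -/
def orbitPt (b : ℝ) (n : NStarCoord F p q) : Vec F p q :=
  apex F p q + (b - ∑ m, ‖n.2.1 m‖ ^ 2) • axis F p q + orbitLin F p q n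

theorem orbitPt_inl_zero (b : ℝ) (n : NStarCoord F p q) :
    orbitPt b n (Sum.inl 0) = ((b - ∑ m, ‖n.2.1 m‖ ^ 2 - 1) / 2) • (1 : F) + n.2.2 := by
  simp [orbitPt, apex, axis, orbitLin]
  module

theorem orbitPt_inr_zero (b : ℝ) (n : NStarCoord F p q) :
    orbitPt b n (Sum.inr 0) = ((b - ∑ m, ‖n.2.1 m‖ ^ 2 + 1) / 2) • (1 : F) + n.2.2 := by
  simp [orbitPt, apex, axis, orbitLin]
  module

theorem orbitPt_inl_succ (b : ℝ) (n : NStarCoord F p q) (i : Fin p) :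
    orbitPt b n (Sum.inl i.succ) = star (n.1 i) := by
  simp [orbitPt, apex, axis, orbitLin]

theorem orbitPt_inr_succ (b : ℝ) (n : NStarCoord F p q) (k : Fin q) :
    orbitPt b n (Sum.inr k.succ) = -star (vStar n.1 n.2.1 k) := by
  simp [orbitPt, apex, axis, orbitLin]

/-- The coordinates u and w occur with equal norms in positive and negative slots and cancel. With Q
= ∑ |v'_m|², the first and last coordinates contribute -(b - Q), and the free negative coordinates
contribute -Q. -/
theorem form_orbitPt (hF : IsClassicalField F) (hpq : p < q) (b : ℝ) (n : NStarCoord F p q) :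
    form (orbitPt b n) = -b := by
  rw [form, Fin.sum_univ_succ, Fin.sum_univ_succ]
  simp only [orbitPt_inl_zero, orbitPt_inr_zero, orbitPt_inl_succ, orbitPt_inr_succ, norm_neg,
    hF.norm_star, hF.norm_sq_smul_one_add, sum_norm_vStar hF hpq]
  ring

/-- The base point is apex + axis. Applying the square of `nilElt` to it gives (∑ |u_i|² - ∑
|v_k|²)(e_1 + e_n), which on 𝔫^* reduces to -2 ∑ |v'_m|² times the axis; this is the quadratic term
of the paraboloid. -/
theorem nStar_mulVec_basePt (hF : IsClassicalField F) (hpq : p < q) (n : NStarCoord F p q) :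
    nStar n *ᵥ basePt F p q = orbitPt 1 n := by
  have h1 : ∀ (u : Fin p → F) (v : Fin q → F) (w : F), nilElt u v w *ᵥ basePt F p q =
      Sum.elim (Fin.cons w fun i => star (u i)) (Fin.cons w fun k => -star (v k)) := by
    intro u v w
    funext i
    rw [basePt, Matrix.mulVec_single_one]
    rcases i with i | i <;> refine Fin.cases ?_ (fun i => ?_) i <;>
      simp [nilElt, cross, Matrix.col, Matrix.fromBlocks]
  have h2 : ∀ (u : Fin p → F) (v : Fin q → F) (w : F), nilElt u v w *ᵥ
      (nilElt u v w *ᵥ basePt F p q) =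
      Sum.elim (Fin.cons ((∑ i, ‖u i‖ ^ 2 - ∑ k, ‖v k‖ ^ 2) • 1) 0)
        (Fin.cons ((∑ i, ‖u i‖ ^ 2 - ∑ k, ‖v k‖ ^ 2) • 1) 0) := by
    intro u v w
    rw [h1]
    funext i
    rcases i with i | i <;> refine Fin.cases ?_ (fun i => ?_) i <;>
      simp [nilElt, cross, Matrix.mulVec, dotProduct, Fintype.sum_sum_type, Fin.sum_univ_succ,
        Matrix.fromBlocks, hF.mul_star_self, sub_smul, Finset.sum_smul] <;> abel
  have := hF.isScalarTower
  rw [nStar, expNil, Matrix.add_mulVec, Matrix.add_mulVec, Matrix.one_mulVec, Matrix.smul_mulVec,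
    ← Matrix.mulVec_mulVec, h2, h1, sum_norm_vStar hF hpq]
  funext i
  rcases i with i | i <;> refine Fin.cases ?_ (fun i => ?_) i
  · rw [orbitPt_inl_zero]
    simp [basePt]
    module
  · rw [orbitPt_inl_succ]
    simp [basePt]
  · rw [orbitPt_inr_zero]
    simp [basePt]
    module
  · rw [orbitPt_inr_succ]
    simp [basePt]

end Surface

/-! ### Haar measure on N^* and integrable majorants -/

section Measure

variable {F : Type*} [NormedDivisionRing F] [StarRing F] [InnerProductSpace ℝ F]
    [StarModule ℝ F] [FiniteDimensional ℝ F] [MeasurableSpace F] [BorelSpace F]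

instance {E : Type*} [NormedAddCommGroup E] [InnerProductSpace ℝ E] [FiniteDimensional ℝ E]
    [MeasurableSpace E] [BorelSpace E] : (lebesgue E).IsAddHaarMeasure :=
  inferInstanceAs ((stdOrthonormalBasis ℝ E).toBasis.addHaar).IsAddHaarMeasure

theorem secondCountable_of_finiteDimensional (E : Type*) [NormedAddCommGroup E] [NormedSpace ℝ E]
    [FiniteDimensional ℝ E] : SecondCountableTopology E := by
  have : ProperSpace E := FiniteDimensional.proper ℝ E
  infer_instance

theorem borelSpace_nStarCoord (p q : ℕ) : BorelSpace (NStarCoord F p q) := by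
  have := secondCountable_of_finiteDimensional F
  infer_instance

theorem isAddHaarMeasure_haarNStar (p q : ℕ) : (haarNStar F p q).IsAddHaarMeasure := by
  have := secondCountable_of_finiteDimensional F
  have h1 : ∀ n, (Measure.pi fun _ : Fin n => lebesgue F).IsAddHaarMeasure := fun n =>
    inferInstance
  have h2 : (lebesgue (imPart F)).IsAddHaarMeasure := inferInstance
  have h3 : ((Measure.pi fun _ : Fin (q - p) => lebesgue F).prod
    (lebesgue (imPart F))).IsAddHaarMeasure := Measure.prod.instIsAddHaarMeasure _ _
  exact Measure.prod.instIsAddHaarMeasure _ _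

/-- Separate exponents for u, v' and w are kept because the orbit grows at different rates in these
directions. -/
theorem integrable_bracket_prod (p q : ℕ) {s₁ s₂ s₃ : ℝ} (h₁ : (p * dimF F : ℕ) < s₁)
    (h₂ : ((q - p : ℕ) * dimF F : ℕ) < s₂) (h₃ : Module.finrank ℝ (imPart F) < s₃) :
    Integrable (fun n : NStarCoord F p q =>
      (1 + ‖n.1‖) ^ (-s₁) * ((1 + ‖n.2.1‖) ^ (-s₂) * (1 + ‖n.2.2‖) ^ (-s₃)))
      (haarNStar F p q) := by
  have := secondCountable_of_finiteDimensional F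
  refine Integrable.mul_prod (f := fun u : Fin p → F => (1 + ‖u‖) ^ (-s₁))
    (g := fun n : (Fin (q - p) → F) × imPart F => (1 + ‖n.1‖) ^ (-s₂) * (1 + ‖n.2‖) ^ (-s₃)) ?_ ?_
  · exact integrable_one_add_norm (by simpa [Module.finrank_pi_fintype, dimF] using h₁)
  · refine Integrable.mul_prod (f := fun u : Fin (q - p) → F => (1 + ‖u‖) ^ (-s₂))
      (g := fun w : imPart F => (1 + ‖w‖) ^ (-s₃)) ?_ ?_
    · exact integrable_one_add_norm (by simpa [Module.finrank_pi_fintype, dimF] using h₂)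
    · exact integrable_one_add_norm h₃

end Measure

/-! ### A frame adapted to the orbits -/

section Frame

variable {F : Type*} [NormedDivisionRing F] [StarRing F] [InnerProductSpace ℝ F]
    [StarModule ℝ F] [FiniteDimensional ℝ F] {p q : ℕ}

/-- Indices for an orthonormal basis of `F` that consists of `1` and a basis of `Im F`. -/
abbrev FieldIdx (F : Type*) [NormedDivisionRing F] [StarRing F] [InnerProductSpace ℝ F]
    [StarModule ℝ F] : Type := Unit ⊕ Fin (Module.finrank ℝ (imPart F))

/-- An orthonormal basis of `F` that consists of `1` and a basis of `Im F`. -/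
def IsClassicalField.basis (hF : IsClassicalField F) : OrthonormalBasis (FieldIdx F) ℝ F :=
  hF.exists_basis.choose

theorem IsClassicalField.basis_inl (hF : IsClassicalField F) (i : Unit) :
    hF.basis (Sum.inl i) = 1 := hF.exists_basis.choose_spec.1 i

theorem IsClassicalField.basis_inr (hF : IsClassicalField F)
    (j : Fin (Module.finrank ℝ (imPart F))) :
    hF.basis (Sum.inr j) = (stdOrthonormalBasis ℝ (imPart F) j : F) :=
  hF.exists_basis.choose_spec.2 j

theorem IsClassicalField.star_basis (hF : IsClassicalField F) (k : FieldIdx F) :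
    star (hF.basis k) = hF.basis k ∨ star (hF.basis k) = -hF.basis k := by
  rcases k with k | k
  · left
    rw [hF.basis_inl, star_one]
  · right
    rw [hF.basis_inr, star_coe_imPart]

/-- Indices for the real coordinates of `N^*`. -/
abbrev NStarIdx (F : Type*) [NormedDivisionRing F] [StarRing F] [InnerProductSpace ℝ F]
    [StarModule ℝ F] (p q : ℕ) : Type :=
  (Σ _ : Fin p, FieldIdx F) ⊕ ((Σ _ : Fin (q - p), FieldIdx F) ⊕
    Fin (Module.finrank ℝ (imPart F)))

/-- Real coordinates on `N^*`. -/
def nStarBasis (hF : IsClassicalField F) (p q : ℕ) :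
    Module.Basis (NStarIdx F p q) ℝ (NStarCoord F p q) :=
  (Pi.basis fun _ => hF.basis.toBasis).prod
    ((Pi.basis fun _ => hF.basis.toBasis).prod (stdOrthonormalBasis ℝ (imPart F)).toBasis)

theorem orbitLin_basis_u (hF : IsClassicalField F) (hpq : p < q) (i : Fin p) (k : FieldIdx F) :
    orbitLin F p q (nStarBasis hF p q (Sum.inl ⟨i, k⟩)) =
      Pi.single (Sum.inl i.succ) (star (hF.basis k)) +
        Pi.single (Sum.inr (Fin.castLE hpq.le i).succ) (hF.basis k) := by
  have h : nStarBasis hF p q (Sum.inl ⟨i, k⟩) = (Pi.single i (hF.basis k), 0, 0) := by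
    simp [nStarBasis, Pi.basis_apply, Prod.ext_iff]
  rw [h]
  funext a
  rcases a with a | a <;> refine Fin.cases ?_ (fun a => ?_) a
  · simp [orbitLin]
  · by_cases hia : a = i
    · subst hia; simp [orbitLin]
    · simp [orbitLin, hia, Pi.single_apply]
  · simp [orbitLin]
  · by_cases hap : a.val < p
    · by_cases hia : (⟨a.val, hap⟩ : Fin p) = i
      · have : a = Fin.castLE hpq.le i := by subst hia; rfl
        subst this
        simp [orbitLin, vStar]
      · have : ¬ a = Fin.castLE hpq.le i := by
          rintro rfl
          exact hia rfl
        simp [orbitLin, vStar, hap, hia, Pi.single_apply, this]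
    · have : ¬ a = Fin.castLE hpq.le i := by
        rintro rfl
        exact hap i.2
      simp [orbitLin, vStar, hap, Pi.single_apply, this]

theorem orbitLin_basis_v (hF : IsClassicalField F) (hpq : p < q) (m : Fin (q - p))
    (k : FieldIdx F) :
    orbitLin F p q (nStarBasis hF p q (Sum.inr (Sum.inl ⟨m, k⟩))) =
      -Pi.single (Sum.inr (⟨p + m, by omega⟩ : Fin q).succ) (star (hF.basis k)) := by
  have h : nStarBasis hF p q (Sum.inr (Sum.inl ⟨m, k⟩)) = (0, Pi.single m (hF.basis k), 0) := by
    simp [nStarBasis, Pi.basis_apply]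
  have hk : ((⟨p + m, by omega⟩ : Fin q) : ℕ) = p + m := rfl
  revert hk
  generalize (⟨p + m, by omega⟩ : Fin q) = k₀
  intro hk
  rw [h]
  funext a
  rcases a with a | a <;> refine Fin.cases ?_ (fun a => ?_) a
  · simp [orbitLin]
  · simp [orbitLin]
  · simp [orbitLin]
  · by_cases hap : a.val < p
    · have : ¬ a = k₀ := by
        rintro rfl
        omega
      simp [orbitLin, vStar, hap, Pi.single_apply, this]
    · by_cases hia : a = k₀
      · subst hia
        have : (⟨a.val - p, by omega⟩ : Fin (q - p)) = m := by
          ext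
          simp
          omega
        simp [orbitLin, vStar, hap, this]
      · have : ¬ (⟨a.val - p, by omega⟩ : Fin (q - p)) = m := by
          intro h'
          apply hia
          ext
          rw [hk, ← h']
          simp
          omega
        simp [orbitLin, vStar, hap, hia, Pi.single_apply, this]

theorem orbitLin_basis_w (hF : IsClassicalField F) (j : Fin (Module.finrank ℝ (imPart F))) :
    orbitLin F p q (nStarBasis hF p q (Sum.inr (Sum.inr j))) =
      Pi.single (Sum.inl 0) (hF.basis (Sum.inr j)) +
        Pi.single (Sum.inr 0) (hF.basis (Sum.inr j)) := by
  have h : nStarBasis hF p q (Sum.inr (Sum.inr j)) =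
      (0, 0, stdOrthonormalBasis ℝ (imPart F) j) := by
    simp [nStarBasis]
  rw [h, hF.basis_inr]
  funext a
  rcases a with a | a <;> refine Fin.cases ?_ (fun a => ?_) a <;> simp [orbitLin, vStar]

/-- Vectors that are dual to the coordinate directions of `N^*`. -/
def conormal (hF : IsClassicalField F) (hpq : p < q) : NStarIdx F p q → Vec F p q :=
  Sum.elim (fun a => Pi.single (Sum.inl a.1.succ) (star (hF.basis a.2)) -
      Pi.single (Sum.inr (Fin.castLE hpq.le a.1).succ) (hF.basis a.2))
    (Sum.elim (fun a => -orbitLin F p q (nStarBasis hF p q (Sum.inr (Sum.inl a))))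
      fun j => Pi.single (Sum.inl 0) (hF.basis (Sum.inr j)) -
        Pi.single (Sum.inr 0) (hF.basis (Sum.inr j)))

/-- The trace is read off in a frame adapted to the paraboloid. Each difference B(x, x) - B(y, y) of
a positive and a negative square factors as B(x + y, x - y): for u and w, x + y is tangential and x
- y is the conormal, and for the pair ±apex, axis it yields -4 B(apex, axis). The v' directions are
unpaired negative squares, whence conormal = -tangent there. -/
theorem boxTrace_eq (hF : IsClassicalField F) (hpq : p < q)
    (B : Vec F p q →L[ℝ] Vec F p q →L[ℝ] ℂ) (hB : ∀ x y, B x y = B y x) :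
    boxTrace hF.basis B = -4 * B (apex F p q) (axis F p q) +
      ∑ a, B (orbitLin F p q (nStarBasis hF p q a)) (conormal hF hpq a) := by
  -- Conjugation changes an adapted basis vector at most by a sign, which a quadratic expression
  -- does not see.
  have hstar : ∀ (i : Idx p q) k, B (Pi.single i (star (hF.basis k)))
      (Pi.single i (star (hF.basis k))) = B (Pi.single i (hF.basis k)) (Pi.single i (hF.basis k)) := by
    intro i k
    rcases hF.star_basis k with h | h <;> rw [h]
    simp [Pi.single_neg]
  have hu : ∑ a : (Σ _ : Fin p, FieldIdx F), B (orbitLin F p q (nStarBasis hF p q (Sum.inl a)))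
      (conormal hF hpq (Sum.inl a)) =
      ∑ i : Fin p, (∑ k, B (Pi.single (Sum.inl i.succ) (hF.basis k))
          (Pi.single (Sum.inl i.succ) (hF.basis k)) -
        ∑ k, B (Pi.single (Sum.inr (Fin.castLE hpq.le i).succ) (hF.basis k))
          (Pi.single (Sum.inr (Fin.castLE hpq.le i).succ) (hF.basis k))) := by
    rw [Fintype.sum_sigma]
    refine Finset.sum_congr rfl fun i _ => ?_
    rw [← Finset.sum_sub_distrib]
    refine Finset.sum_congr rfl fun k _ => ?_
    rw [orbitLin_basis_u hF hpq]
    simp only [conormal, Sum.elim_inl, map_add, map_sub, _root_.add_apply]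
    rw [hstar, hB (Pi.single (Sum.inl i.succ) _) (Pi.single (Sum.inr _) _)]
    ring
  have hv : ∑ a : (Σ _ : Fin (q - p), FieldIdx F),
      B (orbitLin F p q (nStarBasis hF p q (Sum.inr (Sum.inl a))))
        (conormal hF hpq (Sum.inr (Sum.inl a))) =
      -∑ m : Fin (q - p), ∑ k,
        B (Pi.single (Sum.inr (⟨p + m, by omega⟩ : Fin q).succ) (hF.basis k))
          (Pi.single (Sum.inr (⟨p + m, by omega⟩ : Fin q).succ) (hF.basis k)) := by
    rw [Fintype.sum_sigma, ← Finset.sum_neg_distrib]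
    refine Finset.sum_congr rfl fun i _ => ?_
    rw [← Finset.sum_neg_distrib]
    refine Finset.sum_congr rfl fun k _ => ?_
    simp only [conormal, Sum.elim_inl, Sum.elim_inr]
    rw [orbitLin_basis_v hF hpq]
    simp only [map_neg, _root_.neg_apply]
    rw [hstar]
    ring
  have hw : ∑ j, B (orbitLin F p q (nStarBasis hF p q (Sum.inr (Sum.inr j))))
        (conormal hF hpq (Sum.inr (Sum.inr j))) =
      ∑ j, B (Pi.single (Sum.inl 0) (hF.basis (Sum.inr j)))
          (Pi.single (Sum.inl 0) (hF.basis (Sum.inr j))) -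
      ∑ j, B (Pi.single (Sum.inr 0) (hF.basis (Sum.inr j)))
          (Pi.single (Sum.inr 0) (hF.basis (Sum.inr j))) := by
    rw [← Finset.sum_sub_distrib]
    refine Finset.sum_congr rfl fun j _ => ?_
    rw [orbitLin_basis_w]
    simp only [conormal, Sum.elim_inr, map_add, map_sub, _root_.add_apply]
    rw [hB (Pi.single (Sum.inl 0) _) (Pi.single (Sum.inr 0) _)]
    ring
  have hf : -4 * B (apex F p q) (axis F p q) =
      B (Pi.single (Sum.inl 0) 1) (Pi.single (Sum.inl 0) 1) -
        B (Pi.single (Sum.inr 0) 1) (Pi.single (Sum.inr 0) 1) := by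
    simp only [apex, axis, Pi.single_smul, map_add, map_sub, map_smul, _root_.sub_apply,
      _root_.smul_apply, Complex.real_smul]
    rw [hB (Pi.single (Sum.inl 0) _) (Pi.single (Sum.inr 0) _)]
    push_cast
    ring
  rw [boxTrace, Fintype.sum_sum_type, Fintype.sum_sum_type, Fintype.sum_sum_type, hu, hv, hw, hf]
  simp only [sgn, Sum.elim_inl, Sum.elim_inr, one_smul, neg_smul, Finset.sum_neg_distrib]
  rw [Fin.sum_univ_succ, Fin.sum_univ_succ, sum_fin_split hpq]
  rw [Fintype.sum_sum_type (f := fun k => B (Pi.single (Sum.inl 0) (hF.basis k)) _),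
    Fintype.sum_sum_type (f := fun k => B (Pi.single (Sum.inr 0) (hF.basis k)) _)]
  simp only [hF.basis_inl, Finset.sum_sub_distrib, Finset.univ_unique, Finset.sum_singleton]
  ring

/-- The translate by `g` of the orbits of `N^*`, as a family of paraboloids. -/
def orbitParaboloid (hF : IsClassicalField F) (g : Mat F p q) :
    Paraboloid (Vec F p q) (NStarCoord F p q) (NStarIdx F p q) where
  basis := nStarBasis hF p q
  c := Sum.elim 0 (Sum.elim 1 0)
  f := g *ᵥ apex F p q
  e := g *ᵥ axis F p q
  L := (mulVecL hF g).comp (LinearMap.toContinuousLinearMap (orbitLin F p q))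

theorem OrthonormalBasis.sum_repr_sq {κ E : Type*} [Fintype κ] [NormedAddCommGroup E]
    [InnerProductSpace ℝ E] (o : OrthonormalBasis κ ℝ E) (x : E) :
    ∑ k, o.repr x k ^ 2 = ‖x‖ ^ 2 := by
  rw [← o.repr.norm_map, EuclideanSpace.norm_sq_eq]
  simp

theorem orbitParaboloid_Q (hF : IsClassicalField F) (g : Mat F p q) (n : NStarCoord F p q) :
    (orbitParaboloid hF g).Q n = ∑ m, ‖n.2.1 m‖ ^ 2 := by
  have h : ∀ (m : Fin (q - p)) (k : FieldIdx F),
      (nStarBasis hF p q).repr n (Sum.inr (Sum.inl ⟨m, k⟩)) = hF.basis.repr (n.2.1 m) k := by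
    intro m k
    simp [nStarBasis, Pi.basis_repr]
  simp only [Paraboloid.Q, orbitParaboloid, Fintype.sum_sum_type, Sum.elim_inl, Sum.elim_inr,
    Pi.zero_apply, Pi.one_apply, zero_mul, one_mul, Finset.sum_const_zero, zero_add, add_zero,
    Fintype.sum_sigma, h, OrthonormalBasis.sum_repr_sq]

theorem orbitParaboloid_pt (hF : IsClassicalField F) (g : Mat F p q) (b : ℝ)
    (n : NStarCoord F p q) : (orbitParaboloid hF g).pt b n = g *ᵥ orbitPt b n := by
  rw [Paraboloid.pt, orbitParaboloid_Q, orbitPt]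
  simp only [orbitParaboloid]
  simp only [← mulVecL_apply hF, map_add, map_smul]
  rfl

theorem norm_le_norm_add_imPart (hF : IsClassicalField F) (r : ℝ) (w : imPart F) :
    ‖w‖ ≤ ‖r • (1 : F) + w‖ := by
  refine (sq_le_sq₀ (norm_nonneg _) (norm_nonneg _)).1 ?_
  rw [hF.norm_sq_smul_one_add]
  nlinarith

theorem abs_le_norm_add_imPart (hF : IsClassicalField F) (r : ℝ) (w : imPart F) :
    |r| ≤ ‖r • (1 : F) + w‖ := by
  refine (sq_le_sq₀ (abs_nonneg _) (norm_nonneg _)).1 ?_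
  rw [hF.norm_sq_smul_one_add, sq_abs]
  nlinarith [sq_nonneg ‖w‖]

/-- The difference of the last and the first coordinate is constantly 1 on every orbit, which keeps
the orbits away from the origin. -/
theorem one_le_two_mul_norm_orbitPt (b : ℝ) (n : NStarCoord F p q) :
    1 ≤ 2 * ‖orbitPt b n‖ := by
  have h : orbitPt b n (Sum.inr 0) - orbitPt b n (Sum.inl 0) = 1 := by
    rw [orbitPt_inr_zero, orbitPt_inl_zero]
    module
  have h1 := norm_sub_le (orbitPt b n (Sum.inr 0)) (orbitPt b n (Sum.inl 0))
  rw [h, norm_one] at h1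
  linarith [norm_le_pi_norm (orbitPt b n) (Sum.inr 0), norm_le_pi_norm (orbitPt b n) (Sum.inl 0)]

theorem norm_le_norm_orbitPt (hF : IsClassicalField F) (hpq : p < q) (b : ℝ)
    (n : NStarCoord F p q) : ‖n‖ ≤ ‖orbitPt b n‖ := by
  have h := norm_le_pi_norm (orbitPt b n)
  rw [Prod.norm_def, Prod.norm_def]
  refine max_le ?_ (max_le ?_ ?_)
  · refine (pi_norm_le_iff_of_nonneg (norm_nonneg _)).2 fun i => ?_
    have := h (Sum.inl i.succ)
    rwa [orbitPt_inl_succ, hF.norm_star] at this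
  · refine (pi_norm_le_iff_of_nonneg (norm_nonneg _)).2 fun m => ?_
    have := h (Sum.inr (⟨p + m, by omega⟩ : Fin q).succ)
    rwa [orbitPt_inr_succ, vStar_add_right hpq, norm_neg, hF.norm_star] at this
  · have := h (Sum.inl 0)
    rw [orbitPt_inl_zero] at this
    exact (norm_le_norm_add_imPart hF _ _).trans this

/-- The real part of the sum of the first and last coordinates is b - ∑ |v'_m|², so the orbit grows
quadratically in v'. The constant comes from (1 + t)² ≤ 2 + 2t², t² ≤ B + 2‖z‖ and 1 ≤ 2‖z‖, where t
= ‖v'‖ and z is the point. -/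
theorem sq_le_norm_orbitPt (hF : IsClassicalField F) {b B : ℝ} (hb : b ∈ Icc 0 B)
    (n : NStarCoord F p q) : (1 + ‖n.2.1‖) ^ 2 ≤ (8 + 4 * B) * ‖orbitPt b n‖ := by
  have h1 := one_le_two_mul_norm_orbitPt b n
  have hsum : orbitPt b n (Sum.inr 0) + orbitPt b n (Sum.inl 0) =
      (b - ∑ m, ‖n.2.1 m‖ ^ 2) • (1 : F) + ((2 : ℝ) • n.2.2 : imPart F) := by
    rw [orbitPt_inr_zero, orbitPt_inl_zero, Submodule.coe_smul]
    module
  have h2 := norm_add_le (orbitPt b n (Sum.inr 0)) (orbitPt b n (Sum.inl 0))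
  rw [hsum] at h2
  have h3 := abs_le_norm_add_imPart hF (b - ∑ m, ‖n.2.1 m‖ ^ 2) ((2 : ℝ) • n.2.2 : imPart F)
  have h4 := norm_le_pi_norm (orbitPt b n) (Sum.inr 0)
  have h5 := norm_le_pi_norm (orbitPt b n) (Sum.inl 0)
  have h6 := neg_abs_le (b - ∑ m, ‖n.2.1 m‖ ^ 2)
  have h7 : ‖n.2.1‖ ^ 2 ≤ ∑ m, ‖n.2.1 m‖ ^ 2 := by
    have h0 : ‖n.2.1‖ ≤ √(∑ m, ‖n.2.1 m‖ ^ 2) := by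
      refine (pi_norm_le_iff_of_nonneg (Real.sqrt_nonneg _)).2 fun m => ?_
      refine Real.le_sqrt_of_sq_le ?_
      exact Finset.single_le_sum (f := fun m => ‖n.2.1 m‖ ^ 2) (fun _ _ => sq_nonneg _)
        (Finset.mem_univ m)
    calc ‖n.2.1‖ ^ 2 ≤ √(∑ m, ‖n.2.1 m‖ ^ 2) ^ 2 := by gcongr
      _ = _ := Real.sq_sqrt (Finset.sum_nonneg fun _ _ => sq_nonneg _)
  have h8 : B ≤ B * (2 * ‖orbitPt b n‖) := le_mul_of_one_le_right (hb.1.trans hb.2) h1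
  nlinarith [sq_nonneg (1 - ‖n.2.1‖), hb.2]

theorem exists_norm_le_mulVec (hF : IsClassicalField F) {g : Mat F p q}
    (hg : g ∈ groupG F p q) : ∃ K : ℝ, 0 < K ∧ ∀ z : Vec F p q, ‖z‖ ≤ K * ‖g *ᵥ z‖ := by
  refine ⟨‖mulVecL hF (formMatrix F p q * gᴴ * formMatrix F p q)‖ + 1, by positivity, fun z => ?_⟩
  have h := (mulVecL hF (formMatrix F p q * gᴴ * formMatrix F p q)).le_opNorm (g *ᵥ z)
  rw [mulVecL_apply, mulVec_leftInverse hg] at h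
  linarith [norm_nonneg (g *ᵥ z)]

end Frame

/-! ### The cones of negative vectors and of vectors with nonzero negative part -/

section Cone

variable {F : Type*} [NormedDivisionRing F] {p q : ℕ}

/-- The vectors with nonzero negative part. -/
def negNonzero (F : Type*) [NormedDivisionRing F] (p q : ℕ) : Set (Vec F p q) :=
  {z | ∃ j, z (Sum.inr j) ≠ 0}

theorem isOpen_negNonzero : IsOpen (negNonzero F p q) := by
  simp only [negNonzero, ofPred_exists]
  exact isOpen_iUnion fun j => isOpen_ne_fun (continuous_apply _) continuous_const

theorem continuous_form : Continuous (form : Vec F p q → ℝ) := by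
  unfold form
  fun_prop

theorem negCone_subset : negCone F p q ⊆ negNonzero F p q := by
  intro z hz
  by_contra h
  simp only [negNonzero, mem_ofPred_eq, not_exists, not_not] at h
  have h1 : form z < 0 := hz
  simp only [form, h, norm_zero, ne_eq, OfNat.ofNat_ne_zero, not_false_eq_true,
    zero_pow, Finset.sum_const_zero, sub_zero] at h1
  exact absurd h1 (not_lt.2 (Finset.sum_nonneg fun i _ => sq_nonneg _))

theorem form_smul [InnerProductSpace ℝ F] (c : ℝ) (z : Vec F p q) :
    form (c • z) = c ^ 2 * form z := by
  simp only [form, Pi.smul_apply, norm_smul, mul_pow, ← Finset.mul_sum, Real.norm_eq_abs, sq_abs,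
    mul_sub]

end Cone

/-! ### Admissibility of the orbit paraboloids -/

section Admissible

variable {F : Type*} [NormedDivisionRing F] [StarRing F] [InnerProductSpace ℝ F]
    [StarModule ℝ F] [FiniteDimensional ℝ F] {p q : ℕ}

variable [MeasurableSpace F] [BorelSpace F]

theorem admissible_orbitParaboloid (hF : IsClassicalField F) (hpq : p < q) {g : Mat F p q}
    (hg : g ∈ groupG F p q) {lam : ℝ} (hlam : 0 < lam) {Ψ : Vec F p q → ℂ}
    (hom : HomogOn (lam + rhoQ F p q) (negNonzero F p q) Ψ)
    (smooth : ContDiffOn ℝ ∞ Ψ (negNonzero F p q))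
    (hbox : ∀ z ∈ negCone F p q, boxTrace hF.basis (fderiv ℝ (fderiv ℝ Ψ) z) = 0) :
    (orbitParaboloid hF g).Admissible (haarNStar F p q) (lam + rhoQ F p q) lam
      (negNonzero F p q) {z | form z ≤ 0} Ψ (fun a => g *ᵥ conormal hF hpq a) where
  hom := hom
  smooth := smooth
  closed := isClosed_le continuous_form continuous_const
  smul_mem c hc z hz := by
    rw [mem_ofPred_eq, form_smul]
    exact mul_nonpos_of_nonneg_of_nonpos (sq_nonneg _) hz
  subset z hz hz0 := by
    by_contra h
    simp only [negNonzero, mem_ofPred_eq, not_exists, not_not] at h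
    simp only [mem_ofPred_eq, form, h, norm_zero, ne_eq, OfNat.ofNat_ne_zero, not_false_eq_true,
      zero_pow, Finset.sum_const_zero, sub_zero] at hz
    have h0 := (Finset.sum_eq_zero_iff_of_nonneg (fun i _ => sq_nonneg ‖z (Sum.inl i)‖)).1
      (le_antisymm hz (Finset.sum_nonneg fun i _ => sq_nonneg _))
    apply hz0
    funext i
    rcases i with i | i
    · simpa using h0 i (Finset.mem_univ i)
    · exact h i
  mem b hb n := by
    rw [mem_ofPred_eq, orbitParaboloid_pt, form_mulVec hF hg, form_orbitPt hF hpq]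
    linarith
  lower := by
    obtain ⟨K, hK, h⟩ := exists_norm_le_mulVec hF hg
    -- For z on the orbit, 1 ≤ 2‖z‖ and ‖n‖ ≤ ‖z‖; K bounds the inverse of g.
    refine ⟨(3 * K)⁻¹, by positivity, fun b hb n => ?_⟩
    rw [orbitParaboloid_pt, inv_mul_le_iff₀ (by positivity)]
    have h1 := h (orbitPt b n)
    have h2 := one_le_two_mul_norm_orbitPt b n
    have h3 := norm_le_norm_orbitPt hF hpq b n
    linarith
  dom B := by
    obtain ⟨K, hK, h⟩ := exists_norm_le_mulVec hF hg
    set d : ℝ := (dimF F : ℝ) with hd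
    -- The critical exponents of u, v' and w add up to ρ_𝔮; the surplus λ is split evenly among
    -- them. Quadratic growth halves the exponent required for v'.
    set s₁ : ℝ := p * d + lam / 3 with hs₁
    set s₂ : ℝ := (q - p : ℕ) * d / 2 + lam / 3 with hs₂
    set s₃ : ℝ := (Module.finrank ℝ (imPart F) : ℝ) + lam / 3 with hs₃
    have hd0 : 0 ≤ d := Nat.cast_nonneg _
    have h₁ : 0 < s₁ := by positivity
    have h₂ : 0 < s₂ := by positivity
    have h₃ : 0 < s₃ := by positivity
    have hsum : lam + rhoQ F p q = s₁ + s₂ + s₃ := by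
      have h4 : d = 1 + (Module.finrank ℝ (imPart F) : ℝ) := by
        rw [hd, hF.dimF_eq]
        push_cast
        ring
      have h5 : ((q - p : ℕ) : ℝ) = q - p := Nat.cast_sub hpq.le
      rw [rhoQ, ← hd, hs₁, hs₂, hs₃, h5]
      linear_combination (1 : ℝ) * h4
    set A : ℝ := K * (8 + 4 * |B|) with hA
    have hA0 : 0 < A := by positivity
    have hint := integrable_bracket_prod (F := F) p q (s₁ := s₁) (s₂ := 2 * s₂) (s₃ := s₃)
      (by push_cast; rw [hs₁]; linarith) (by push_cast; rw [hs₂]; linarith)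
      (by rw [hs₃]; linarith)
    refine ⟨_, hint.const_mul ((A⁻¹) ^ (-(s₁ + s₂ + s₃))), fun b hb n => ?_⟩
    rw [orbitParaboloid_pt, hsum]
    have hz := h (orbitPt b n)
    have h2 := one_le_two_mul_norm_orbitPt b n
    have h3 := norm_le_norm_orbitPt hF hpq b n
    have h4 := sq_le_norm_orbitPt hF ⟨hb.1, hb.2.trans (le_abs_self B)⟩ n
    have hB := abs_nonneg B
    have hn0 := norm_nonneg (orbitPt b n)
    have hall : ‖orbitPt b n‖ * (8 + 4 * |B|) ≤ A * ‖g *ᵥ orbitPt b n‖ := by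
      rw [hA]
      nlinarith
    set Z := ‖g *ᵥ orbitPt b n‖ with hZ
    have e1 : A⁻¹ * (1 + ‖n.1‖) ≤ Z := by
      rw [inv_mul_le_iff₀ hA0]
      have := norm_fst_le n
      nlinarith
    have e2 : A⁻¹ * (1 + ‖n.2.1‖) ^ 2 ≤ Z := by
      rw [inv_mul_le_iff₀ hA0]
      linarith
    have e3 : A⁻¹ * (1 + ‖n.2.2‖) ≤ Z := by
      rw [inv_mul_le_iff₀ hA0]
      have := (norm_snd_le n.2).trans (norm_snd_le n)
      nlinarith
    have hZ0 : 0 < Z := lt_of_lt_of_le (by positivity) e1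
    have f1 : Z ^ (-s₁) ≤ A⁻¹ ^ (-s₁) * (1 + ‖n.1‖) ^ (-s₁) := by
      rw [← Real.mul_rpow (by positivity) (by positivity)]
      exact Real.rpow_le_rpow_of_nonpos (by positivity) e1 (by linarith)
    have f2 : Z ^ (-s₂) ≤ A⁻¹ ^ (-s₂) * (1 + ‖n.2.1‖) ^ (-(2 * s₂)) := by
      rw [show -(2 * s₂) = ((2 : ℕ) : ℝ) * (-s₂) by push_cast; ring, Real.rpow_mul (by positivity),
        Real.rpow_natCast, ← Real.mul_rpow (by positivity) (by positivity)]
      exact Real.rpow_le_rpow_of_nonpos (by positivity) e2 (by linarith)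
    have f3 : Z ^ (-s₃) ≤ A⁻¹ ^ (-s₃) * (1 + ‖n.2.2‖) ^ (-s₃) := by
      rw [← Real.mul_rpow (by positivity) (by positivity)]
      exact Real.rpow_le_rpow_of_nonpos (by positivity) e3 (by linarith)
    have hAinv : 0 < A⁻¹ := inv_pos.2 hA0
    calc Z ^ (-(s₁ + s₂ + s₃)) = Z ^ (-s₁) * Z ^ (-s₂) * Z ^ (-s₃) := by
          rw [← Real.rpow_add hZ0, ← Real.rpow_add hZ0]
          congr 1
          ring
      _ ≤ (A⁻¹ ^ (-s₁) * (1 + ‖n.1‖) ^ (-s₁)) * (A⁻¹ ^ (-s₂) * (1 + ‖n.2.1‖) ^ (-(2 * s₂))) *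
          (A⁻¹ ^ (-s₃) * (1 + ‖n.2.2‖) ^ (-s₃)) := by gcongr
      _ = _ := by
          rw [show -(s₁ + s₂ + s₃) = -s₁ + -s₂ + -s₃ by ring, Real.rpow_add hAinv,
            Real.rpow_add hAinv]
          ring
  coeff a := by
    rcases a with a | a | a
    · left; rfl
    · right
      refine ⟨rfl, ?_⟩
      simp only [conormal, Sum.elim_inr, Sum.elim_inl, orbitParaboloid,
        ContinuousLinearMap.comp_apply, mulVecL_apply, Matrix.mulVec_neg]
      rfl
    · left; rfl
  pde b hb n := by
    have hz : (orbitParaboloid hF g).pt b n ∈ negCone F p q := by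
      rw [negCone, mem_ofPred_eq, orbitParaboloid_pt, form_mulVec hF hg, form_orbitPt hF hpq]
      linarith
    have hzU := negCone_subset hz
    have hsymm : ∀ v w, fderiv ℝ (fderiv ℝ Ψ) ((orbitParaboloid hF g).pt b n) v w =
        fderiv ℝ (fderiv ℝ Ψ) ((orbitParaboloid hF g).pt b n) w v := by
      have : IsSymmSndFDerivAt ℝ Ψ ((orbitParaboloid hF g).pt b n) :=
        (smooth.contDiffAt (isOpen_negNonzero.mem_nhds hzU)).isSymmSndFDerivAt
          (by rw [minSmoothness_of_isRCLikeNormedField]; exact WithTop.coe_le_coe.2 le_top)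
      exact fun v w => this.eq v w
    -- The trace is first pulled back by g, so that the frame at the identity can be used; the
    -- result is the equation in the translated frame.
    have h1 := hbox _ hz
    rw [← boxTrace_comp hF.basis (mulVecL hF g) (fun x y => bform_mulVec hF hg x y),
      boxTrace_eq hF hpq _ (fun x y => by
        rw [ContinuousLinearMap.bilinearComp_apply, ContinuousLinearMap.bilinearComp_apply,
          hsymm])] at h1
    exact h1
  lam_pos := hlam
  lam_eq := by
    have h4 : (dimF F : ℝ) = 1 + (Module.finrank ℝ (imPart F) : ℝ) := by
      rw [hF.dimF_eq]
      push_cast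
      ring
    have h5 : ((q - p : ℕ) : ℝ) = q - p := Nat.cast_sub hpq.le
    simp only [orbitParaboloid, Fintype.sum_sum_type, Sum.elim_inl, Sum.elim_inr, Pi.zero_apply,
      Pi.one_apply, Finset.sum_const_zero, zero_add, add_zero, Fintype.card_sum,
      Fintype.card_sigma, Finset.sum_const, Finset.card_univ, Fintype.card_fin, smul_eq_mul,
      Fintype.card_unit, nsmul_eq_mul, mul_one]
    push_cast
    rw [h5, rhoQ, h4]
    ring

end Admissible

/-! ### Polar decomposition of the hyperboloid -/

section Polar

variable {F : Type*} [NormedDivisionRing F] [StarRing F] [InnerProductSpace ℝ F] {p q : ℕ}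

/-- The Householder reflection in the hyperplane orthogonal to `x`. -/
def householder {m : ℕ} (x : Fin m → F) : Matrix (Fin m) (Fin m) F :=
  1 - (2 / ∑ i, ‖x i‖ ^ 2 : ℝ) • Matrix.of fun i j => x i * star (x j)

theorem householder_conjTranspose_mul [StarModule ℝ F] (hF : IsClassicalField F) {m : ℕ}
    (x : Fin m → F) : (householder x)ᴴ * householder x = 1 := by
  have hst := hF.isScalarTower
  have hsc := hF.smulCommClass
  set N : ℝ := ∑ i, ‖x i‖ ^ 2 with hN
  set X : Matrix (Fin m) (Fin m) F := Matrix.of fun i j => x i * star (x j) with hX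
  have hherm : Xᴴ = X := by
    ext i j
    simp [hX]
  have hsq : X * X = N • X := by
    ext i j
    simp only [hX, Matrix.mul_apply, Matrix.of_apply, Matrix.smul_apply]
    have : ∀ l, x i * star (x l) * (x l * star (x j)) = (‖x l‖ ^ 2) • (x i * star (x j)) := by
      intro l
      rw [mul_assoc, ← mul_assoc (star (x l)), hF.star_mul_self, hF.smul_mul, one_mul, hF.mul_smul]
    simp only [this, ← Finset.sum_smul, hN]
  -- For x = 0 the convention 2 / 0 = 0 makes the reflection the identity, so no case is excluded.
  have hc : (2 / N) * ((2 / N) * N) = 2 * (2 / N) := by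
    rcases eq_or_ne N 0 with h | h
    · simp [h]
    · field_simp
  have : householder x = 1 - (2 / N) • X := rfl
  rw [this, Matrix.conjTranspose_sub, Matrix.conjTranspose_one, Matrix.conjTranspose_smul, hherm,
    star_trivial, sub_mul, mul_sub, mul_sub, one_mul, mul_one, one_mul, Matrix.smul_mul,
    Matrix.mul_smul, hsq, smul_smul, smul_smul, mul_assoc, hc]
  module

/-- A reflection sends e_0 to a given unit vector when the zeroth entry of that vector is real. The
phase c of y_0 is therefore removed on the right, the reflection in x = e_0 - y c* is used, and the
phase is restored by a diagonal unitary matrix. -/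
theorem exists_unitary_col [StarModule ℝ F] (hF : IsClassicalField F) {m : ℕ}
    (y : Fin (m + 1) → F) (hy : ∑ i, ‖y i‖ ^ 2 = 1) :
    ∃ k : Matrix (Fin (m + 1)) (Fin (m + 1)) F, kᴴ * k = 1 ∧ ∀ i, k i 0 = y i := by
  have hst := hF.isScalarTower
  have hsc := hF.smulCommClass
  obtain ⟨c, r, hc, hr⟩ : ∃ (c : F) (r : ℝ), ‖c‖ = 1 ∧ y 0 = r • c := by
    rcases eq_or_ne (y 0) 0 with h | h
    · exact ⟨1, 0, norm_one, by rw [h, zero_smul]⟩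
    · have h' : ‖y 0‖ ≠ 0 := norm_ne_zero_iff.2 h
      refine ⟨‖y 0‖⁻¹ • y 0, ‖y 0‖, ?_, ?_⟩
      · rw [norm_smul, norm_inv, norm_norm, inv_mul_cancel₀ h']
      · rw [smul_smul, mul_inv_cancel₀ h', one_smul]
  have hcc : star c * c = 1 := by rw [hF.star_mul_self, hc]; simp
  have hcc' : c * star c = 1 := by rw [hF.mul_star_self, hc]; simp
  set x : Fin (m + 1) → F := fun i => (Pi.single 0 1 : Fin (m + 1) → F) i - y i * star c with hx
  have hx0 : x 0 = (1 - r) • (1 : F) := by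
    simp only [hx, Pi.single_eq_same, hr, hF.smul_mul, hcc']
    module
  set N : ℝ := ∑ i, ‖x i‖ ^ 2 with hN
  have hNr : N = 2 * (1 - r) := by
    rw [Fin.sum_univ_succ] at hy
    have h1 : ‖y 0‖ ^ 2 = r ^ 2 := by rw [hr, norm_smul, hc, mul_one, Real.norm_eq_abs, sq_abs]
    have h2 : ∀ i : Fin m, ‖x i.succ‖ ^ 2 = ‖y i.succ‖ ^ 2 := by
      intro i
      simp [hx, hF.norm_star, hc]
    have h3 : ‖x 0‖ ^ 2 = (1 - r) ^ 2 := by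
      rw [hx0, norm_smul, norm_one, mul_one, Real.norm_eq_abs, sq_abs]
    rw [hN, Fin.sum_univ_succ, h3]
    simp only [h2]
    linear_combination hy - h1
  have hcol : ∀ i, householder x i 0 = y i * star c := by
    intro i
    have h1 : householder x i 0 = (1 : Matrix (Fin (m + 1)) (Fin (m + 1)) F) i 0 - (2 / N) • (x i * star (x 0)) := rfl
    have h2 : (2 / N) • (x i * star (x 0)) = x i := by
      rcases eq_or_ne N 0 with h | h
      · have h0 := (Finset.sum_eq_zero_iff_of_nonneg (fun i _ => sq_nonneg ‖x i‖)).1 h i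
          (Finset.mem_univ i)
        have : x i = 0 := by simpa using h0
        rw [this, zero_mul, smul_zero]
      · rw [hx0, star_smul, star_one, star_trivial, hF.mul_smul, mul_one, smul_smul]
        have : 2 / N * (1 - r) = 1 := by
          rw [div_mul_eq_mul_div, ← hNr, div_self h]
        rw [this, one_smul]
    rw [h1, h2]
    simp only [hx]
    have : (1 : Matrix (Fin (m + 1)) (Fin (m + 1)) F) i 0 =
        (Pi.single 0 1 : Fin (m + 1) → F) i := by
      rw [Matrix.one_apply, Pi.single_apply]
    rw [this]
    abel
  set D : Matrix (Fin (m + 1)) (Fin (m + 1)) F := Matrix.diagonal (Function.update 1 0 c) with hD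
  refine ⟨householder x * D, ?_, fun i => ?_⟩
  · rw [Matrix.conjTranspose_mul, Matrix.mul_assoc, ← Matrix.mul_assoc (householder x)ᴴ,
      householder_conjTranspose_mul hF, Matrix.one_mul, hD, Matrix.diagonal_conjTranspose,
      Matrix.diagonal_mul_diagonal, ← Matrix.diagonal_one]
    congr 1
    funext i
    rcases eq_or_ne i 0 with rfl | hi
    · simp [hcc]
    · simp [Function.update_of_ne hi]
  · rw [hD, Matrix.mul_diagonal, Function.update_self, hcol, mul_assoc, hcc, mul_one]

/-- The square of the norm of the negative part of a vector. -/
def negNormSq (z : Vec F p q) : ℝ := ∑ j : Fin (q + 1), ‖z (Sum.inr j)‖ ^ 2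

/-- The negative part of a vector. -/
def negPart (z : Vec F p q) : Vec F p q := Sum.elim 0 fun j => z (Sum.inr j)

theorem aElt_mulVec_basePt (s : ℝ) : aElt F p q s *ᵥ basePt F p q =
    Pi.single (Sum.inl 0) (Real.sinh s • (1 : F)) + Pi.single (Sum.inr 0) (Real.cosh s • (1 : F)) := by
  funext i
  rw [basePt, Matrix.mulVec_single_one]
  rcases i with i | i
  · by_cases hi : i = 0
    · subst hi
      simp [aElt, Matrix.col]
    · simp [aElt, Matrix.col, hi, Ne.symm hi]
  · by_cases hi : i = 0
    · subst hi
      simp [aElt, Matrix.col]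
    · simp [aElt, Matrix.col, hi]

/-- Besides z itself, the same k also carries the base point to the normalized negative part of z.
This lets the K-dependence of ψ be read off from its value at the negative part. -/
theorem exists_polar [StarModule ℝ F] (hF : IsClassicalField F) (z : Vec F p q)
    (hz : form z = -1) :
    ∃ k ∈ groupK F p q, ∃ s : ℝ, (k * aElt F p q s) *ᵥ basePt F p q = z ∧
      (k * aElt F p q 0) *ᵥ basePt F p q = (Real.cosh s)⁻¹ • negPart z ∧
      Real.cosh s ^ 2 = negNormSq z := by
  set A : ℝ := √(∑ i : Fin (p + 1), ‖z (Sum.inl i)‖ ^ 2) with hA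
  have hA2 : A ^ 2 = ∑ i : Fin (p + 1), ‖z (Sum.inl i)‖ ^ 2 :=
    Real.sq_sqrt (Finset.sum_nonneg fun _ _ => sq_nonneg _)
  set s := Real.arsinh A with hs
  have hsinh : Real.sinh s = A := Real.sinh_arsinh A
  have hcosh : Real.cosh s ^ 2 = negNormSq z := by
    rw [Real.cosh_sq, hsinh, hA2, negNormSq]
    rw [form] at hz
    linarith
  have hcpos : 0 < Real.cosh s := Real.cosh_pos s
  obtain ⟨k₂, hk₂, hcol₂⟩ := exists_unitary_col hF
    (fun j => (Real.cosh s)⁻¹ • z (Sum.inr j)) (by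
      simp only [norm_smul, mul_pow, ← Finset.mul_sum]
      have : ∑ j : Fin (q + 1), ‖z (Sum.inr j)‖ ^ 2 = Real.cosh s ^ 2 := hcosh.symm
      rw [this, Real.norm_of_nonneg (by positivity), ← mul_pow, inv_mul_cancel₀ hcpos.ne', one_pow])
  obtain ⟨k₁, hk₁, hcol₁⟩ : ∃ k : Matrix (Fin (p + 1)) (Fin (p + 1)) F, kᴴ * k = 1 ∧
      ∀ i, A • k i 0 = z (Sum.inl i) := by
    -- When the positive part vanishes, sinh s = 0 and any unitary block will do.
    rcases eq_or_ne A 0 with h | h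
    · refine ⟨1, by simp, fun i => ?_⟩
      rw [h, zero_smul]
      rw [h] at hA2
      have h0 := (Finset.sum_eq_zero_iff_of_nonneg
        (fun i _ => sq_nonneg ‖z (Sum.inl i)‖)).1 (by rw [← hA2]; simp) i (Finset.mem_univ i)
      exact (by simpa using h0 : z (Sum.inl i) = 0).symm
    · obtain ⟨k, hk, hcol⟩ := exists_unitary_col hF (fun j => A⁻¹ • z (Sum.inl j)) (by
        simp only [norm_smul, mul_pow, ← Finset.mul_sum]
        rw [← hA2, norm_inv, Real.norm_eq_abs, ← sq_abs A, ← mul_pow,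
          inv_mul_cancel₀ (abs_ne_zero.2 h), one_pow])
      refine ⟨k, hk, fun i => ?_⟩
      rw [hcol, smul_smul, mul_inv_cancel₀ h, one_smul]
  have hmul : ∀ t : ℝ, (Matrix.fromBlocks k₁ 0 0 k₂ * aElt F p q t) *ᵥ basePt F p q =
      Sum.elim (fun i => Real.sinh t • k₁ i 0) fun j => Real.cosh t • k₂ j 0 := by
    intro t
    rw [← Matrix.mulVec_mulVec, aElt_mulVec_basePt, Matrix.mulVec_add]
    funext i
    rcases i with i | i <;>
      simp [Matrix.mulVec_single, hF.mul_smul]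
  refine ⟨Matrix.fromBlocks k₁ 0 0 k₂, ⟨?_, ?_⟩, s, ?_, ?_, hcosh⟩
  · simp [groupG, formMatrix, Matrix.fromBlocks_conjTranspose, Matrix.fromBlocks_multiply, hk₁, hk₂]
  · simp [Matrix.fromBlocks_conjTranspose, Matrix.fromBlocks_multiply, hk₁, hk₂]
  · rw [hmul, hsinh]
    funext i
    rcases i with i | i
    · exact hcol₁ i
    · simp only [Sum.elim_inr, hcol₂]
      rw [smul_smul, mul_inv_cancel₀ hcpos.ne', one_smul]
  · rw [hmul]
    funext i
    rcases i with i | i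
    · simp [negPart]
    · simp [negPart, hcol₂]

/-- In the special case, the rotations `k_θ` suffice. -/
theorem exists_polar_special (hF : IsClassicalField F) (hd : dimF F = 1) (z : Vec F 0 1) (hz : form z = -1) :
    ∃ θ s : ℝ, (kElt F 0 1 θ * aElt F 0 1 s) *ᵥ basePt F 0 1 = z ∧
      (kElt F 0 1 θ * aElt F 0 1 0) *ᵥ basePt F 0 1 = (Real.cosh s)⁻¹ • negPart z ∧
      Real.cosh s ^ 2 = negNormSq z := by
  have hreal : ∀ a : F, ∃ r : ℝ, a = r • 1 := fun a => by
    obtain ⟨r, hr⟩ := (finrank_eq_one_iff_of_nonzero' (1 : F) one_ne_zero).1 hd a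
    exact ⟨r, hr.symm⟩
  obtain ⟨a, ha⟩ := hreal (z (Sum.inl 0))
  obtain ⟨b, hb⟩ := hreal (z (Sum.inr 0))
  obtain ⟨c, hc⟩ := hreal (z (Sum.inr 1))
  have hneg : negNormSq z = b ^ 2 + c ^ 2 := by
    simp [negNormSq, Fin.sum_univ_two, hb, hc, norm_smul]
  have hform : a ^ 2 - (b ^ 2 + c ^ 2) = -1 := by
    rw [← hz, form, ← hneg, negNormSq]
    simp [ha, norm_smul]
  set s := Real.arsinh a with hs
  have hsinh : Real.sinh s = a := Real.sinh_arsinh a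
  have hcosh : Real.cosh s ^ 2 = b ^ 2 + c ^ 2 := by
    rw [Real.cosh_sq, hsinh]
    linarith
  have hcpos : 0 < Real.cosh s := Real.cosh_pos s
  obtain ⟨θ, hθc, hθs⟩ : ∃ θ : ℝ, Real.cosh s * Real.cos θ = b ∧ Real.cosh s * Real.sin θ = c := by
    let w : ℂ := ⟨b, c⟩
    have hw : ‖w‖ = Real.cosh s := by
      rw [Complex.norm_eq_sqrt_sq_add_sq, ← hcosh, Real.sqrt_sq hcpos.le]
    refine ⟨w.arg, ?_, ?_⟩
    · rw [← hw, Complex.norm_mul_cos_arg]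
    · rw [← hw, Complex.norm_mul_sin_arg]
  have hmul : ∀ t : ℝ, (kElt F 0 1 θ * aElt F 0 1 t) *ᵥ basePt F 0 1 =
      Sum.elim (fun _ => Real.sinh t • (1 : F))
        ![(Real.cosh t * Real.cos θ) • (1 : F), (Real.cosh t * Real.sin θ) • (1 : F)] := by
    intro t
    rw [← Matrix.mulVec_mulVec, aElt_mulVec_basePt, Matrix.mulVec_add]
    funext i
    rcases i with i | i
    · fin_cases i
      simp [kElt, Matrix.mulVec_single]
    · fin_cases i <;> simp [kElt, Matrix.mulVec_single, hF.smul_mul, smul_smul, mul_comm]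
  refine ⟨θ, s, ?_, ?_, hcosh.trans hneg.symm⟩
  · rw [hmul, hsinh, hθc, hθs]
    funext i
    rcases i with i | i
    · fin_cases i
      exact ha.symm
    · fin_cases i
      · exact hb.symm
      · exact hc.symm
  · have hb' : (Real.cosh s)⁻¹ • z (Sum.inr 0) = Real.cos θ • (1 : F) := by
      rw [hb, ← hθc, smul_smul, inv_mul_cancel_left₀ hcpos.ne']
    have hc' : (Real.cosh s)⁻¹ • z (Sum.inr 1) = Real.sin θ • (1 : F) := by
      rw [hc, ← hθs, smul_smul, inv_mul_cancel_left₀ hcpos.ne']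
    rw [hmul]
    funext i
    rcases i with i | i
    · fin_cases i
      simp [negPart]
    · fin_cases i
      · simpa [negPart] using hb'.symm
      · simpa [negPart] using hc'.symm

end Polar

/-! ### Homogeneous extension of the generating function -/

section Extension

variable {F : Type*} [NormedDivisionRing F] [InnerProductSpace ℝ F] {p q : ℕ}

theorem contDiff_form : ContDiff ℝ ∞ (form : Vec F p q → ℝ) := by
  unfold form
  exact (ContDiff.sum fun i _ => (contDiff_apply ℝ F (Sum.inl i)).norm_sq ℝ).sub
    (ContDiff.sum fun i _ => (contDiff_apply ℝ F (Sum.inr i)).norm_sq ℝ)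

theorem contDiff_negNormSq : ContDiff ℝ ∞ (negNormSq : Vec F p q → ℝ) := by
  unfold negNormSq
  exact ContDiff.sum fun i _ => (contDiff_apply ℝ F (Sum.inr i)).norm_sq ℝ

theorem contDiff_negPart : ContDiff ℝ ∞ (negPart : Vec F p q → Vec F p q) := by
  refine contDiff_pi.2 fun i => ?_
  rcases i with i | i
  · exact contDiff_const
  · exact contDiff_apply ℝ F (Sum.inr i)

theorem negNormSq_smul (c : ℝ) (z : Vec F p q) : negNormSq (c • z) = c ^ 2 * negNormSq z := by
  simp only [negNormSq, Pi.smul_apply, norm_smul, mul_pow, ← Finset.mul_sum, Real.norm_eq_abs,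
    sq_abs]

theorem negPart_smul (c : ℝ) (z : Vec F p q) : negPart (c • z) = c • negPart z := by
  funext i
  rcases i with i | i <;> simp [negPart]

theorem form_negPart (z : Vec F p q) : form (negPart z) = -negNormSq z := by
  simp [form, negPart, negNormSq]

theorem negNormSq_pos {z : Vec F p q} (hz : z ∈ negNonzero F p q) : 0 < negNormSq z := by
  obtain ⟨j, hj⟩ := hz
  exact Finset.sum_pos' (fun _ _ => sq_nonneg _) ⟨j, Finset.mem_univ j, by positivity⟩

theorem isOpen_negCone : IsOpen (negCone F p q) :=
  isOpen_lt contDiff_form.continuous continuous_const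

theorem smul_mem_negNonzero {c : ℝ} (hc : 0 < c) {z : Vec F p q} (hz : z ∈ negNonzero F p q) :
    c • z ∈ negNonzero F p q := by
  obtain ⟨j, hj⟩ := hz
  exact ⟨j, smul_ne_zero hc.ne' hj⟩

theorem smul_mem_negCone {c : ℝ} (hc : c ≠ 0) {z : Vec F p q} (hz : z ∈ negCone F p q) :
    c • z ∈ negCone F p q := by
  change form (c • z) < 0
  rw [form_smul]
  exact mul_neg_of_pos_of_neg (by positivity) hz

theorem sq_mul_rpow {c x : ℝ} (hc : 0 < c) (hx : 0 < x) (r : ℝ) :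
    (c ^ 2 * x) ^ r = c ^ (2 * r) * x ^ r := by
  rw [Real.mul_rpow (by positivity) hx.le, Real.rpow_mul hc.le]
  norm_cast

theorem IsFunctionOnX.map_smul [StarRing F] (hF : IsClassicalField F) {ψ : Vec F p q → ℂ}
    (hψ : IsFunctionOnX ψ) {c : ℝ} (hc : c ≠ 0) {z : Vec F p q} (hz : z ∈ negCone F p q) :
    ψ (c • z) = ψ z := by
  rw [← hψ z hz (c • 1) (smul_ne_zero hc one_ne_zero)]
  congr 1
  funext i
  rw [hF.mul_smul, mul_one]
  rfl

/-- The extension in the case of a zonal `K`-type. -/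
theorem homog_zonal [StarRing F] (hF : IsClassicalField F) {ψ : Vec F p q → ℂ}
    (hψ : IsFunctionOnX ψ) (hs : ContDiffOn ℝ ∞ ψ (negCone F p q)) (σ : ℝ) :
    HomogOn σ (negNonzero F p q) (fun z => negNormSq z ^ (-(σ / 2)) • ψ (negPart z)) ∧
      ContDiffOn ℝ ∞ (fun z => negNormSq z ^ (-(σ / 2)) • ψ (negPart z)) (negNonzero F p q) := by
  have hmem : ∀ z ∈ negNonzero F p q, negPart z ∈ negCone F p q := fun z hz => by
    change form (negPart z) < 0
    rw [form_negPart]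
    linarith [negNormSq_pos hz]
  refine ⟨⟨isOpen_negNonzero, fun c hc z hz => smul_mem_negNonzero hc hz, fun c hc z hz => ?_⟩, ?_⟩
  · rw [negNormSq_smul, negPart_smul, hψ.map_smul hF hc.ne' (hmem z hz),
      sq_mul_rpow hc (negNormSq_pos hz), smul_smul]
    congr 3
    ring
  · exact (contDiff_negNormSq.contDiffOn.rpow_const_of_ne fun z hz => (negNormSq_pos hz).ne').smul
      (hs.comp contDiff_negPart.contDiffOn hmem)

/-- The extension in the case of a polynomial profile. -/
theorem homog_polynomial (P : Polynomial ℂ) (m : ℕ) (σ : ℝ) :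
    HomogOn σ (negNonzero F p q) (fun z => ∑ i ∈ Finset.range (m + 1),
      ((-form z) ^ (m - i) * negNormSq z ^ ((i : ℝ) - m - σ / 2)) • P.coeff i) ∧
      ContDiffOn ℝ ∞ (fun z => ∑ i ∈ Finset.range (m + 1),
        ((-form z) ^ (m - i) * negNormSq z ^ ((i : ℝ) - m - σ / 2)) • P.coeff i)
        (negNonzero F p q) := by
  refine ⟨⟨isOpen_negNonzero, fun c hc z hz => smul_mem_negNonzero hc hz, fun c hc z hz => ?_⟩, ?_⟩
  · rw [Finset.smul_sum]
    refine Finset.sum_congr rfl fun i hi => ?_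
    rw [form_smul, negNormSq_smul, sq_mul_rpow hc (negNormSq_pos hz), smul_smul]
    congr 1
    have him : i ≤ m := Nat.lt_succ_iff.1 (Finset.mem_range.1 hi)
    have h1 : c ^ (-σ) = c ^ (2 * (m - i)) * c ^ (2 * ((i : ℝ) - m - σ / 2)) := by
      rw [← Real.rpow_natCast, ← Real.rpow_add hc]
      congr 1
      push_cast [him]
      ring
    rw [h1, ← mul_neg, mul_pow, ← pow_mul]
    ring
  · refine ContDiffOn.sum fun i _ => ?_
    have h : ContDiffOn ℝ ∞ (fun z : Vec F p q =>
        (-form z) ^ (m - i) * negNormSq z ^ ((i : ℝ) - m - σ / 2)) (negNonzero F p q) :=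
      (contDiff_form.neg.pow _).contDiffOn.mul
        (contDiff_negNormSq.contDiffOn.rpow_const_of_ne fun z hz => (negNormSq_pos hz).ne')
    exact h.smul contDiffOn_const

theorem cosh_rpow {s x : ℝ} (h : Real.cosh s ^ 2 = x) (r : ℝ) :
    Real.cosh s ^ (-r) = x ^ (-(r / 2)) := by
  rw [← h, ← Real.rpow_natCast, ← Real.rpow_mul (Real.cosh_pos s).le]
  congr 1
  push_cast
  ring

/-- For μ_λ > 0, and in the special case, cosh s is the norm of the negative part z₋, and Ψ(z) =
‖z₋‖^(-σ) ψ(z₋), with Euclidean norm. For μ_λ = -2m the polynomial P_λ is homogenized with powers of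
`-form z`, which equals 1 on the hyperboloid; on the isotropic cone only the top coefficient then
remains. -/
theorem exists_extension [StarRing F] [StarModule ℝ F] [FiniteDimensional ℝ F]
    (hF : IsClassicalField F) (hpq : p < q) {lam : ℝ}
    (hlam : IsDiscreteSeriesParam F p q lam) {ψ : Vec F p q → ℂ}
    (hψ : IsGeneratingFunction lam ψ) :
    ∃ Ψ : Vec F p q → ℂ, HomogOn (|lam| + rhoQ F p q) (negNonzero F p q) Ψ ∧
      ContDiffOn ℝ ∞ Ψ (negNonzero F p q) ∧ (∀ z, form z = -1 → ψ z = Ψ z) ∧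
      (muParam F p q lam ≤ 0 → ∃ a : ℂ, a ≠ 0 ∧ ∀ z, form z = 0 →
        Ψ z = negNormSq z ^ (-((|lam| + rhoQ F p q) / 2)) • a) := by
  have hcone : ∀ z : Vec F p q, form z = -1 → negPart z ∈ negCone F p q := fun z hz => by
    change form (negPart z) < 0
    rw [form_negPart]
    have : z ∈ negNonzero F p q := negCone_subset (show form z < 0 by rw [hz]; norm_num)
    linarith [negNormSq_pos this]
  by_cases hsp : IsSpecial F q
  · obtain ⟨h1, h2⟩ := homog_zonal hF hψ.isFunctionOnX hψ.smooth (|lam| + rhoQ F p q)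
    refine ⟨_, h1, h2, fun z hz => ?_, fun hmu => ?_⟩
    · obtain ⟨hq, hd⟩ := id hsp
      subst hq
      obtain rfl : p = 0 := by omega
      obtain ⟨θ, s, e1, e2, e3⟩ := exists_polar_special hF hd z hz
      have f1 := hψ.formula_special hsp θ s
      have f2 := hψ.formula_special hsp θ 0
      rw [e1] at f1
      rw [e2, hψ.isFunctionOnX.map_smul hF (inv_ne_zero (Real.cosh_pos s).ne') (hcone z hz),
        Real.cosh_zero, Real.one_rpow, Complex.ofReal_one, mul_one] at f2
      rw [f1, ← f2, ← cosh_rpow e3, neg_add', Complex.real_smul, mul_comm]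
    · obtain ⟨hq, hd⟩ := id hsp
      subst hq
      obtain rfl : p = 0 := by omega
      -- Here μ_λ = |λ| + 1/2 > 0, so the nonpositive case is void.
      rw [muParam, hd] at hmu
      norm_num at hmu
      linarith [abs_nonneg lam]
  · obtain ⟨-, hpos, n, hn⟩ | ⟨h, -⟩ := hlam
    swap
    · exact absurd h hsp
    rw [abs_of_pos hpos]
    by_cases hmu : 0 < muParam F p q lam
    · obtain ⟨h1, h2⟩ := homog_zonal hF hψ.isFunctionOnX hψ.smooth (lam + rhoQ F p q)
      refine ⟨_, h1, h2, fun z hz => ?_, fun h => absurd hmu (not_lt.2 h)⟩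
      obtain ⟨φ, -, hφ⟩ := hψ.formula_nonneg hsp hmu.le
      obtain ⟨k, hk, s, e1, e2, e3⟩ := exists_polar hF z hz
      have f1 := hφ k hk s
      -- At s = 0 the formula identifies φ(k) with ψ at the rescaled negative part of z, which
      -- removes φ from the expression.
      have f2 := hφ k hk 0
      rw [e1] at f1
      rw [e2, hψ.isFunctionOnX.map_smul hF (inv_ne_zero (Real.cosh_pos s).ne') (hcone z hz),
        Real.cosh_zero, Real.one_rpow, Complex.ofReal_one, mul_one] at f2
      rw [f1, ← f2, ← cosh_rpow e3, neg_add', Complex.real_smul, mul_comm]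
    · have hn0 : n ≤ 0 := by
        rw [hn] at hmu
        by_contra h
        push Not at h hmu
        have : (0 : ℝ) < n := by exact_mod_cast h
        linarith
      obtain ⟨m, rfl⟩ : ∃ m : ℕ, n = -m := ⟨n.natAbs, by omega⟩
      obtain ⟨P, hdeg, hP⟩ := hψ.formula_nonpos hsp m (by rw [hn]; push_cast; ring)
      obtain ⟨h1, h2⟩ := homog_polynomial (F := F) (p := p) (q := q) P m (lam + rhoQ F p q)
      have hnat : P.natDegree = m := Polynomial.natDegree_eq_of_degree_eq_some hdeg
      refine ⟨_, h1, h2, fun z hz => ?_, fun _ => ⟨P.coeff m, ?_, fun z hz => ?_⟩⟩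
      · obtain ⟨k, hk, s, e1, -, e3⟩ := exists_polar hF z hz
        have f1 := hP k hk s
        have hx : 0 < negNormSq z := by
          rw [← e3]
          have := Real.cosh_pos s
          positivity
        rw [e1, e3, show -lam - rhoQ F p q - 2 * m = -(lam + rhoQ F p q + 2 * m) by ring,
          cosh_rpow e3, Polynomial.eval_eq_sum_range, hnat, Finset.sum_mul] at f1
        rw [f1]
        refine Finset.sum_congr rfl fun i _ => ?_
        rw [hz, neg_neg, one_pow, one_mul, Complex.real_smul,
          show (i : ℝ) - m - (lam + rhoQ F p q) / 2 = i + -((lam + rhoQ F p q + 2 * m) / 2) by ring,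
          Real.rpow_add hx, Real.rpow_natCast]
        push_cast
        ring
      · rw [← hnat, ← Polynomial.leadingCoeff, Polynomial.leadingCoeff_ne_zero]
        rintro rfl
        simp at hdeg
      -- All terms with i < m carry a positive power of the form and vanish on the cone.
      · rw [hz, Finset.sum_eq_single_of_mem m (by simp)]
        · simp only [Nat.sub_self, pow_zero, one_mul, sub_self, zero_sub]
        · intro i hi him
          have : m - i ≠ 0 := by
            have := Finset.mem_range.1 hi
            omega
          simp [this]

end Extension

/-! ### From the eigenvalue equation to the ultrahyperbolic equation -/

section Box

variable {F : Type*} [NormedDivisionRing F] [InnerProductSpace ℝ F] {p q : ℕ} {κ : Type*}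
  [Fintype κ]

theorem laplacian_update [FiniteDimensional ℝ F] (o : OrthonormalBasis κ ℝ F) {ψ : Vec F p q → ℂ}
    {U : Set (Vec F p q)} (hU : IsOpen U) (hψ : ContDiffOn ℝ ∞ ψ U) {z : Vec F p q} (hz : z ∈ U)
    (i : Idx p q) :
    (Δ fun y : F => ψ (Function.update z i y)) (z i) =
      ∑ k, fderiv ℝ (fderiv ℝ ψ) z (Pi.single i (o k)) (Pi.single i (o k)) := by
  let S : F →L[ℝ] Vec F p q := ContinuousLinearMap.single ℝ (fun _ => F) i
  have hA : ∀ y, HasFDerivAt (fun y => Function.update z i y) S y := by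
    intro y
    have h : (fun y => Function.update z i y) = fun y => Function.update z i 0 + S y := by
      funext y j
      by_cases hj : j = i
      · subst hj; simp [S]
      · simp [S, hj]
    rw [h]
    exact S.hasFDerivAt.const_add _
  have hzi : Function.update z i (z i) = z := Function.update_eq_self i z
  have hev : ∀ᶠ y in 𝓝 (z i), Function.update z i y ∈ U :=
    (hA (z i)).continuousAt.eventually_mem (hU.mem_nhds (by rwa [hzi]))
  let C := (ContinuousLinearMap.compL ℝ F (Vec F p q) ℂ).flip S
  have h1 : fderiv ℝ (fun y => ψ (Function.update z i y)) =ᶠ[𝓝 (z i)]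
      fun y => C (fderiv ℝ ψ (Function.update z i y)) := by
    filter_upwards [hev] with y hy
    exact (((hψ.differentiableOn (by simp)).differentiableAt
      (hU.mem_nhds hy)).hasFDerivAt.comp y (hA y)).fderiv
  have hs1 : ContDiffOn ℝ ∞ (fderiv ℝ ψ) U := hψ.fderiv_of_isOpen (m := ∞) hU (by simp)
  have h2 : HasFDerivAt (fun y => C (fderiv ℝ ψ (Function.update z i y)))
      (C.comp ((fderiv ℝ (fderiv ℝ ψ) z).comp S)) (z i) := by
    have h3 : HasFDerivAt (fderiv ℝ ψ) (fderiv ℝ (fderiv ℝ ψ) z) (Function.update z i (z i)) := by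
      rw [hzi]
      exact ((hs1.differentiableOn (by simp)).differentiableAt (hU.mem_nhds hz)).hasFDerivAt
    exact C.hasFDerivAt.comp (z i) (h3.comp (z i) (hA (z i)))
  rw [InnerProductSpace.laplacian_eq_iteratedFDeriv_orthonormalBasis _ o]
  refine Finset.sum_congr rfl fun k _ => ?_
  rw [iteratedFDeriv_two_apply, h1.fderiv_eq, h2.fderiv]
  rfl

theorem laplaceBeltrami_eq [FiniteDimensional ℝ F] (o : OrthonormalBasis κ ℝ F)
    {ψ : Vec F p q → ℂ} (hψ : ContDiffOn ℝ ∞ ψ (negCone F p q)) {z : Vec F p q}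
    (hz : z ∈ negCone F p q) :
    laplaceBeltrami ψ z = boxTrace o (fderiv ℝ (fderiv ℝ ψ) z) := by
  rw [laplaceBeltrami, boxTrace, Fintype.sum_sum_type]
  simp only [laplacian_update o isOpen_negCone hψ hz, sgn, Sum.elim_inl, Sum.elim_inr, one_smul,
    neg_smul, Finset.sum_neg_distrib, sub_eq_add_neg]

theorem form_add_smul (z w : Vec F p q) (t : ℝ) :
    form (z + t • w) = form z + 2 * t * bform z w + t ^ 2 * form w := by
  have h := bform_eq z (t • w)
  have h1 : bform z (t • w) = t * bform z w := by
    simp only [bform, Pi.smul_apply, inner_smul_right, Finset.mul_sum]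
    exact Finset.sum_congr rfl fun i _ => by ring
  rw [h1, form_smul] at h
  linarith

theorem bform_add_smul (z w : Vec F p q) (t : ℝ) :
    bform (z + t • w) w = bform z w + t * form w := by
  simp only [bform, form_eq_sum, Pi.add_apply, Pi.smul_apply, inner_add_left, inner_smul_left,
    mul_add, Finset.sum_add_distrib, Finset.mul_sum, real_inner_self_eq_norm_sq]
  congr 1
  refine Finset.sum_congr rfl fun i _ => ?_
  simp
  ring

theorem hasDerivAt_form (z w : Vec F p q) :
    HasDerivAt (fun t : ℝ => form (z + t • w)) (2 * bform z w) 0 := by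
  simp only [form_add_smul]
  have h1 : HasDerivAt (fun t : ℝ => 2 * t * bform z w) (2 * bform z w) 0 :=
    (((hasDerivAt_id (0 : ℝ)).const_mul 2).mul_const _).congr_deriv (by simp)
  have h2 : HasDerivAt (fun t : ℝ => t ^ 2 * form w) 0 0 :=
    ((hasDerivAt_pow 2 (0 : ℝ)).mul_const _).congr_deriv (by simp)
  exact ((h1.const_add (form z)).add h2).congr_deriv (by simp)

theorem hasDerivAt_form_rpow {z : Vec F p q} (hz : z ∈ negCone F p q) (w : Vec F p q) (r : ℝ) :
    HasDerivAt (fun t : ℝ => (-form (z + t • w)) ^ r)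
      (-2 * r * (-form z) ^ (r - 1) * bform z w) 0 := by
  have hz' : form z < 0 := hz
  have h := (hasDerivAt_form z w).neg.rpow_const (p := r) (Or.inl (by simp; linarith))
  refine h.congr_deriv ?_
  simp
  ring

theorem hasDerivAt_line {W : Type*} [NormedAddCommGroup W] [NormedSpace ℝ W] {E : Type*}
    [NormedAddCommGroup E] [NormedSpace ℝ E] {h : E → W} {z : E} (hh : DifferentiableAt ℝ h z)
    (w : E) : HasDerivAt (fun t : ℝ => h (z + t • w)) (fderiv ℝ h z w) 0 :=
  hh.hasFDerivAt.hasLineDerivAt w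

/-- The product rule along the line z + t w, applied twice. Pure second derivatives suffice, since
the operator is a signed sum of them in coordinate directions. -/
theorem sndDeriv_rpow_smul {ψ Ψ : Vec F p q → ℂ} (hψ : ContDiffOn ℝ ∞ ψ (negCone F p q))
    (hΨ : ContDiffOn ℝ ∞ Ψ (negCone F p q)) (r : ℝ)
    (h : ∀ z ∈ negCone F p q, Ψ z = (-form z) ^ (-r) • ψ z) {z : Vec F p q} (hz : form z = -1)
    (w : Vec F p q) :
    fderiv ℝ (fderiv ℝ Ψ) z w w = fderiv ℝ (fderiv ℝ ψ) z w w +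
      (4 * r * bform z w) • fderiv ℝ ψ z w +
      (4 * r * (r + 1) * bform z w ^ 2 + 2 * r * form w) • ψ z := by
  have hzc : z ∈ negCone F p q := by
    change form z < 0
    rw [hz]
    norm_num
  have hd : ∀ {f : Vec F p q → ℂ}, ContDiffOn ℝ ∞ f (negCone F p q) → ∀ y ∈ negCone F p q,
      DifferentiableAt ℝ f y := fun hf y hy =>
    (hf.differentiableOn (by simp)).differentiableAt (isOpen_negCone.mem_nhds hy)
  have hd2 : ∀ {f : Vec F p q → ℂ}, ContDiffOn ℝ ∞ f (negCone F p q) →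
      DifferentiableAt ℝ (fderiv ℝ f) z := fun hf =>
    ((hf.fderiv_of_isOpen (m := ∞) isOpen_negCone (by simp)).differentiableOn
      (by simp)).differentiableAt (isOpen_negCone.mem_nhds hzc)
  have hmem : ∀ y ∈ negCone F p q, ∀ᶠ t : ℝ in 𝓝 0, y + t • w ∈ negCone F p q := by
    intro y hy
    have hc : ContinuousAt (fun t : ℝ => y + t • w) 0 := by fun_prop
    exact hc.eventually_mem (isOpen_negCone.mem_nhds (by simpa using hy))
  have hfst : ∀ y ∈ negCone F p q, fderiv ℝ Ψ y w = (-form y) ^ (-r) • fderiv ℝ ψ y w +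
      ((2 * r) * (-form y) ^ (-r - 1) * bform y w) • ψ y := by
    intro y hy
    have h1 := hasDerivAt_line (hd hΨ y hy) w
    have h2 := (hasDerivAt_form_rpow hy w (-r)).smul (hasDerivAt_line (hd hψ y hy) w)
    refine (h1.unique (h2.congr_of_eventuallyEq ?_)).trans ?_
    · filter_upwards [hmem y hy] with t ht using h _ ht
    · simp only [zero_smul, add_zero]
      module
  have h1 : HasDerivAt (fun t : ℝ => fderiv ℝ Ψ (z + t • w) w) (fderiv ℝ (fderiv ℝ Ψ) z w w) 0 :=
    (ContinuousLinearMap.apply ℝ ℂ w).hasFDerivAt.comp_hasDerivAt (0 : ℝ)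
      (hasDerivAt_line (hd2 hΨ) w)
  have h2 : HasDerivAt (fun t : ℝ => fderiv ℝ ψ (z + t • w) w) (fderiv ℝ (fderiv ℝ ψ) z w w) 0 :=
    (ContinuousLinearMap.apply ℝ ℂ w).hasFDerivAt.comp_hasDerivAt (0 : ℝ)
      (hasDerivAt_line (hd2 hψ) w)
  have h3 : HasDerivAt (fun t : ℝ => bform (z + t • w) w) (form w) 0 := by
    simp only [bform_add_smul]
    exact (((hasDerivAt_id (0 : ℝ)).mul_const _).const_add _).congr_deriv (by simp)
  have h4 := ((hasDerivAt_form_rpow hzc w (-r)).smul h2).add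
    ((((hasDerivAt_form_rpow hzc w (-r - 1)).const_mul (2 * r)).mul h3).smul
      (hasDerivAt_line (hd hψ z hzc) w))
  refine (h1.unique (h4.congr_of_eventuallyEq ?_)).trans ?_
  · filter_upwards [hmem z hzc] with t ht using hfst _ ht
  · simp only [Pi.mul_apply, zero_smul, add_zero, hz, neg_neg, Real.one_rpow]
    module

/-- On the cone Ψ = (-form)^(-σ/2) ψ. In the trace the cross terms sum to a multiple of the radial
derivative of ψ, which vanishes because ψ has degree 0, and the remaining terms multiply ψ by a
number that is zero for this σ. -/
theorem boxTrace_extension [StarRing F] [StarModule ℝ F] [FiniteDimensional ℝ F]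
    (hF : IsClassicalField F) {lam : ℝ} {ψ Ψ : Vec F p q → ℂ}
    (hψ : IsGeneratingFunction lam ψ)
    (hom : HomogOn (|lam| + rhoQ F p q) (negNonzero F p q) Ψ)
    (smooth : ContDiffOn ℝ ∞ Ψ (negNonzero F p q)) (heq : ∀ z, form z = -1 → ψ z = Ψ z) :
    ∀ z ∈ negCone F p q, boxTrace hF.basis (fderiv ℝ (fderiv ℝ Ψ) z) = 0 := by
  set o := hF.basis
  set σ := |lam| + rhoQ F p q with hσ
  have hscale : ∀ z ∈ negCone F p q, ∃ c : ℝ, 0 < c ∧ c ^ 2 = -form z ∧ form (c⁻¹ • z) = -1 := by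
    intro z hz
    have hz' : form z < 0 := hz
    have hc : 0 < √(-form z) := Real.sqrt_pos.2 (by linarith)
    have hc2 : √(-form z) ^ 2 = -form z := Real.sq_sqrt (by linarith)
    refine ⟨_, hc, hc2, ?_⟩
    rw [form_smul, inv_pow, hc2, inv_mul_eq_div, div_neg, div_self hz'.ne]
  have hcone1 : ∀ z : Vec F p q, form z = -1 → z ∈ negCone F p q := fun z hz => by
    change form z < 0
    rw [hz]
    norm_num
  have hrel : ∀ z ∈ negCone F p q, Ψ z = (-form z) ^ (-(σ / 2)) • ψ z := by
    intro z hz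
    obtain ⟨c, hc, hc2, h1⟩ := hscale z hz
    have h2 : z = c • c⁻¹ • z := by rw [smul_smul, mul_inv_cancel₀ hc.ne', one_smul]
    have h3 := hcone1 _ h1
    have h4 : Ψ z = c ^ (-σ) • Ψ (c⁻¹ • z) := by
      conv_lhs => rw [h2]
      exact hom.map_smul c hc _ (negCone_subset h3)
    rw [h4, ← heq _ h1, hψ.isFunctionOnX.map_smul hF (inv_ne_zero hc.ne') hz, ← hc2,
      ← Real.rpow_natCast, ← Real.rpow_mul hc.le]
    congr 2
    push_cast
    ring
  have hon : ∀ z, form z = -1 → boxTrace o (fderiv ℝ (fderiv ℝ Ψ) z) = 0 := by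
    intro z hz
    have hzc := hcone1 z hz
    have hbf : ∀ i k, bform z (Pi.single i (o k)) = sgn i * inner ℝ (z i) (o k) := by
      intro i k
      rw [bform, Finset.sum_eq_single i]
      · rw [Pi.single_eq_same]
      · intro j _ hj
        rw [Pi.single_eq_of_ne hj, inner_zero_right, mul_zero]
      · simp
    have hfs : ∀ (i : Idx p q) k, form (Pi.single i (o k)) = sgn i := by
      intro i k
      rw [form_eq_sum, Finset.sum_eq_single i]
      · rw [Pi.single_eq_same, o.norm_eq_one]
        ring
      · intro j _ hj
        rw [Pi.single_eq_of_ne hj, norm_zero]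
        ring
      · simp
    have heuler : fderiv ℝ ψ z z = 0 := by
      have h0 : HomogOn 0 (negCone F p q) ψ :=
        ⟨isOpen_negCone, fun c hc z hz => smul_mem_negCone hc.ne' hz, fun c hc z hz => by
          rw [neg_zero, Real.rpow_zero, one_smul, hψ.isFunctionOnX.map_smul hF hc.ne' hz]⟩
      have := h0.fderiv_self (hψ.smooth.differentiableOn (by simp)) hzc
      simpa using this
    have hlb := hψ.eigen z hz
    rw [laplaceBeltrami_eq o hψ.smooth hzc] at hlb
    have hlin : ∀ D : Vec F p q →L[ℝ] ℂ, ∑ i : Idx p q, ∑ k, (inner ℝ (z i) (o k)) •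
        D (Pi.single i (o k)) = D z := by
      intro D
      conv_rhs => rw [vec_eq_sum o z]
      rw [Fintype.sum_prod_type, map_sum]
      refine Finset.sum_congr rfl fun i _ => ?_
      rw [map_sum]
      refine Finset.sum_congr rfl fun k _ => ?_
      rw [map_smul, real_inner_comm]
    have hsum1 := (hlin (fderiv ℝ ψ z)).trans heuler
    have hsum2 : ∑ i : Idx p q, sgn i * ∑ k, (inner ℝ (z i) (o k)) ^ 2 = -1 := by
      rw [← hz, form_eq_sum]
      refine Finset.sum_congr rfl fun i _ => ?_
      rw [← o.sum_sq_norm_inner_left (z i)]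
      simp
    have hcard : ∑ i : Idx p q, ∑ _k : FieldIdx F, (1 : ℝ) = dimF F * (p + q + 2) := by
      have : (Fintype.card (FieldIdx F) : ℝ) = dimF F := by
        rw [hF.dimF_eq]
        simp
      simp only [Finset.sum_const, Finset.card_univ, nsmul_eq_mul, mul_one, this]
      rw [Fintype.card_sum, Fintype.card_fin, Fintype.card_fin]
      push_cast
      ring
    have hterm : ∀ (i : Idx p q) k, sgn i • fderiv ℝ (fderiv ℝ Ψ) z (Pi.single i (o k))
        (Pi.single i (o k)) = sgn i • fderiv ℝ (fderiv ℝ ψ) z (Pi.single i (o k))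
        (Pi.single i (o k)) + (2 * σ) • ((inner ℝ (z i) (o k)) •
        fderiv ℝ ψ z (Pi.single i (o k))) + ((σ * (σ + 2)) * (sgn i * (inner ℝ (z i) (o k)) ^ 2) +
          σ * 1) • ψ z := by
      intro i k
      rw [sndDeriv_rpow_smul hψ.smooth (smooth.mono negCone_subset) (σ / 2) hrel hz, hbf, hfs]
      rcases i with i | i
      · simp only [sgn, Sum.elim_inl]
        module
      · simp only [sgn, Sum.elim_inr]
        module
    simp only [boxTrace, Finset.smul_sum] at hlb ⊢
    simp only [hterm, Finset.sum_add_distrib, ← Finset.smul_sum, ← Finset.sum_smul,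
      ← Finset.mul_sum, hsum1, hsum2, hcard, smul_zero, add_zero]
    have hρ : dimF F * ((p : ℝ) + q + 2) = 2 * rhoQ F p q + 2 := by
      rw [rhoQ]
      ring
    simp only [← Finset.smul_sum] at hlb ⊢
    rw [hlb, hρ, Complex.real_smul, ← add_mul, ← Complex.ofReal_add]
    -- With d(p + q + 2) = 2ρ_𝔮 + 2 this is λ² - (σ - ρ_𝔮)², which fixes the choice of σ.
    have : lam ^ 2 - rhoQ F p q ^ 2 + (σ * (σ + 2) * -1 + σ * (2 * rhoQ F p q + 2)) = 0 := by
      rw [hσ, ← sq_abs lam]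
      ring
    rw [this, Complex.ofReal_zero, zero_mul]
  intro z hz
  obtain ⟨c, hc, hc2, h1⟩ := hscale z hz
  have h2 : z = c • c⁻¹ • z := by rw [smul_smul, mul_inv_cancel₀ hc.ne', one_smul]
  have h3 := hcone1 _ h1
  have hs1 : ContDiffOn ℝ ∞ (fderiv ℝ Ψ) (negNonzero F p q) :=
    smooth.fderiv_of_isOpen (m := ∞) isOpen_negNonzero (by simp)
  -- The second derivative is homogeneous, so vanishing of the trace passes from the hyperboloid to
  -- the whole cone.
  have hh2 := (hom.fderiv (smooth.differentiableOn (by simp))).fderiv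
    (hs1.differentiableOn (by simp))
  have h4 : fderiv ℝ (fderiv ℝ Ψ) z = c ^ (-(σ + 1 + 1)) • fderiv ℝ (fderiv ℝ Ψ) (c⁻¹ • z) := by
    conv_lhs => rw [h2]
    exact hh2.map_smul c hc _ (negCone_subset h3)
  have h5 := hon _ h1
  rw [h4]
  simp only [boxTrace, _root_.smul_apply] at h5 ⊢
  simp only [← Finset.smul_sum, smul_comm _ (c ^ (-(σ + 1 + 1)))]
  rw [h5, smul_zero]

end Box

/-! ### The action of a_s on the isotropic orbit -/

section Final

variable {F : Type*} [NormedDivisionRing F] [StarRing F] [InnerProductSpace ℝ F]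
    [StarModule ℝ F] {p q : ℕ}

theorem aElt_mem_groupG (hF : IsClassicalField F) (s : ℝ) : aElt F p q s ∈ groupG F p q := by
  have hc := Real.cosh_sq s
  have hst := hF.isScalarTower
  have hsc := hF.smulCommClass
  have key : Real.cosh s • Real.cosh s • (1 : F) - Real.sinh s • Real.sinh s • (1 : F) = 1 := by
    rw [smul_smul, smul_smul, ← sub_smul, ← sq, ← sq, hc]
    simp
  change (aElt F p q s)ᴴ * formMatrix F p q * aElt F p q s = formMatrix F p q
  simp only [aElt, formMatrix, Matrix.fromBlocks_conjTranspose, Matrix.fromBlocks_multiply]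
  congr 1
  all_goals
    ext i j
    refine Fin.cases ?_ (fun i => ?_) i <;> refine Fin.cases ?_ (fun j => ?_) j <;>
    simp [Matrix.mul_apply, Matrix.diagonal_apply, Matrix.single_apply, Matrix.one_apply,
      Fin.succ_ne_zero, (Fin.succ_ne_zero _).symm, hF.smul_mul]
  · rw [← sub_eq_add_neg, key]
  · rw [← sub_eq_add_neg, ← neg_sub, key]
  · split_ifs <;> simp

theorem aElt_mulVec (hF : IsClassicalField F) (s : ℝ) (z : Vec F p q) :
    aElt F p q s *ᵥ z = Sum.elim
      (Fin.cons (Real.cosh s • z (Sum.inl 0) + Real.sinh s • z (Sum.inr 0))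
        fun i => z (Sum.inl i.succ))
      (Fin.cons (Real.sinh s • z (Sum.inl 0) + Real.cosh s • z (Sum.inr 0))
        fun i => z (Sum.inr i.succ)) := by
  funext i
  rcases i with i | i <;> refine Fin.cases ?_ (fun i => ?_) i <;>
    simp [aElt, Matrix.mulVec, dotProduct, Fintype.sum_sum_type, hF.smul_mul,
      Matrix.diagonal_apply, Matrix.single_apply, Fin.succ_ne_zero, (Fin.succ_ne_zero _).symm]

/-- The automorphism of `N^*` by which `a_s` acts. -/
def dilation (F : Type*) [NormedDivisionRing F] [StarRing F] [InnerProductSpace ℝ F]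
    [StarModule ℝ F] (p q : ℕ) (s : ℝ) : NStarCoord F p q →ₗ[ℝ] NStarCoord F p q :=
  (Real.exp s • LinearMap.id).prodMap ((Real.exp s • LinearMap.id).prodMap
    (Real.exp (2 * s) • LinearMap.id))

/-- The element a_s scales the apex by e^(-s) and the axis by e^s, so up to scale it moves the orbit
with parameter b to the one with parameter e^(2s) b. Only b = 0 is preserved, and there it acts by
the dilations of the graded group `N^*`. -/
theorem aElt_mulVec_orbitPt (hF : IsClassicalField F) (s : ℝ) (n : NStarCoord F p q) :
    aElt F p q s *ᵥ orbitPt 0 n = Real.exp (-s) • orbitPt 0 (dilation F p q s n) := by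
  have hd : dilation F p q s n =
      (Real.exp s • n.1, Real.exp s • n.2.1, Real.exp (2 * s) • n.2.2) := rfl
  have he : Real.exp s ^ 2 = Real.exp (2 * s) := by rw [← Real.exp_nat_mul]; norm_num
  have he' : Real.exp (-s) * Real.exp s = 1 := by rw [← Real.exp_add]; simp
  have he'' : Real.exp (-s) * Real.exp (2 * s) = Real.exp s := by
    rw [← Real.exp_add]; congr 1; ring
  have hq : ∑ m, ‖Real.exp s • n.2.1 m‖ ^ 2 = Real.exp (2 * s) * ∑ m, ‖n.2.1 m‖ ^ 2 := by
    simp only [norm_smul, mul_pow, ← Finset.mul_sum, Real.norm_eq_abs, sq_abs, he]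
  rw [aElt_mulVec hF, hd]
  funext i
  rcases i with i | i <;> refine Fin.cases ?_ (fun i => ?_) i <;>
    simp only [Sum.elim_inl, Sum.elim_inr, Fin.cons_zero, Fin.cons_succ, Pi.smul_apply,
      orbitPt_inl_zero, orbitPt_inr_zero, orbitPt_inl_succ, orbitPt_inr_succ, hq, vStar_smul,
      star_smul, star_trivial, smul_smul, he', one_smul, Submodule.coe_smul, smul_add, smul_neg,
      he'']
  · rw [Real.cosh_eq, Real.sinh_eq]
    have : ∀ x : ℝ, Real.exp (-s) * ((0 - Real.exp (2 * s) * x - 1) / 2) =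
        (-(Real.exp s * x) - Real.exp (-s)) / 2 := fun x => by rw [← he'']; ring
    rw [this]
    module
  · rw [Real.cosh_eq, Real.sinh_eq]
    have : ∀ x : ℝ, Real.exp (-s) * ((0 - Real.exp (2 * s) * x + 1) / 2) =
        (-(Real.exp s * x) + Real.exp (-s)) / 2 := fun x => by rw [← he'']; ring
    rw [this]
    module

theorem det_dilation [FiniteDimensional ℝ F] (hF : IsClassicalField F) (hpq : p < q) (s : ℝ) :
    LinearMap.det (dilation F p q s) = Real.exp (((dimF F : ℝ) * q + 2 * dimF F - 2) * s) := by
  have h5 : ((q - p : ℕ) : ℝ) = q - p := Nat.cast_sub hpq.le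
  rw [dilation, LinearMap.det_prodMap, LinearMap.det_prodMap]
  simp only [LinearMap.det_smul, LinearMap.det_id, mul_one, ← Real.exp_nat_mul, ← Real.exp_add,
    Module.finrank_pi_fintype, Finset.sum_const, Finset.card_univ, Fintype.card_fin, smul_eq_mul]
  congr 1
  rw [← dimF, hF.dimF_eq]
  push_cast
  rw [h5]
  ring

/-- The inequality σ > dim `N^*` amounts to μ_λ > 1, which parity provides. In the special case p =
0, q = d = 1 one has μ_λ = |λ| + ρ_𝔮, so the different parametrization gives the same parity. -/
theorem one_lt_muParam (hpq : p < q) {lam : ℝ} (hlam : IsDiscreteSeriesParam F p q lam)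
    (hmu : 0 < muParam F p q lam) : 1 < muParam F p q lam := by
  obtain ⟨n, hn⟩ : ∃ n : ℤ, muParam F p q lam = 2 * n := by
    rcases hlam with ⟨-, -, h⟩ | ⟨⟨hq, hd⟩, -, n, hn⟩
    · exact h
    · subst hq
      obtain rfl : p = 0 := by omega
      refine ⟨n, ?_⟩
      rw [← hn, muParam, rhoQ, hd]
      norm_num
      ring
  rw [hn] at hmu ⊢
  have : (0 : ℝ) < n := by linarith
  have : (1 : ℝ) ≤ n := by exact_mod_cast this
  linarith

variable [FiniteDimensional ℝ F] [MeasurableSpace F] [BorelSpace F]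

theorem integral_dilation (hF : IsClassicalField F) (hpq : p < q) (s : ℝ)
    (f : NStarCoord F p q → ℂ) :
    ∫ n, f (dilation F p q s n) ∂(haarNStar F p q) =
      Real.exp (-(((dimF F : ℝ) * q + 2 * dimF F - 2) * s)) • ∫ n, f n ∂(haarNStar F p q) := by
  have := borelSpace_nStarCoord (F := F) p q
  have := isAddHaarMeasure_haarNStar (F := F) p q
  have hdet := det_dilation (F := F) hF hpq s
  have hne : LinearMap.det (dilation F p q s) ≠ 0 := by
    rw [hdet]
    exact (Real.exp_pos _).ne'
  let e := LinearMap.equivOfDetNeZero (dilation F p q s) hne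
  let h := e.toContinuousLinearEquiv.toHomeomorph.toMeasurableEquiv
  have h1 : ∫ n, f (dilation F p q s n) ∂(haarNStar F p q) =
      ∫ n, f n ∂((haarNStar F p q).map (dilation F p q s)) :=
    (MeasureTheory.integral_map_equiv h f).symm
  rw [h1, Measure.map_linearMap_addHaar_eq_smul_addHaar _ hne, integral_smul_measure, hdet,
    ENNReal.toReal_ofReal (abs_nonneg _), ← Real.exp_neg, abs_of_pos (Real.exp_pos _)]

theorem mulVec_axis_ne_zero {g : Mat F p q} (hg : g ∈ groupG F p q) : g *ᵥ axis F p q ≠ 0 := by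
  intro h
  have h1 := mulVec_leftInverse hg (axis F p q)
  rw [h, Matrix.mulVec_zero] at h1
  have h2 := congrFun h1 (Sum.inl 0)
  simp only [axis, Pi.zero_apply, Pi.add_apply, Pi.single_eq_same, ne_eq, reduceCtorEq,
    not_false_eq_true, Pi.single_eq_of_ne, add_zero] at h2
  exact smul_ne_zero (by norm_num) one_ne_zero h2.symm

end Final

end ProjHyp

end

/-! ### The Radon transform of the generating function -/

theorem proposition8p1 {F : Type*} [NormedDivisionRing F] [StarRing F] [InnerProductSpace ℝ F]
    [StarModule ℝ F] [FiniteDimensional ℝ F] [MeasurableSpace F] [BorelSpace F]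
    (hF : IsClassicalField F) (p q : ℕ) (hpq : p < q) (lam : ℝ)
    (hlam : IsDiscreteSeriesParam F p q lam) (ψ : Vec F p q → ℂ)
    (hψ : IsGeneratingFunction lam ψ) :
    (∀ g ∈ groupG F p q, Integrable (radonIntegrand ψ g) (haarNStar F p q)) ∧
    (0 < muParam F p q lam → ∀ g ∈ groupG F p q, radon ψ g = 0) ∧
    (muParam F p q lam ≤ 0 → ∃ C : ℂ, C ≠ 0 ∧ ∀ s : ℝ,
      radon ψ (aElt F p q s) =
        C * ((Real.exp ((muParam F p q lam - (dimF F : ℝ)) * s) : ℝ) : ℂ)) := by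
  have := borelSpace_nStarCoord (F := F) p q
  have := isAddHaarMeasure_haarNStar (F := F) p q
  have hpos : 0 < |lam| := by
    rcases hlam with ⟨-, h, -⟩ | ⟨-, h, -⟩
    · exact abs_pos.2 h.ne'
    · exact abs_pos.2 h
  obtain ⟨Ψ, hom, smooth, heq, hlead⟩ := exists_extension hF hpq hlam hψ
  have hbox := boxTrace_extension hF hψ hom smooth heq
  have hadm := fun g (hg : g ∈ groupG F p q) =>
    admissible_orbitParaboloid hF hpq hg hpos hom smooth hbox
  have hrad : ∀ g ∈ groupG F p q, radonIntegrand ψ g =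
      fun n => Ψ ((orbitParaboloid hF g).pt 1 n) := by
    intro g hg
    funext n
    rw [radonIntegrand, ← Matrix.mulVec_mulVec, nStar_mulVec_basePt hF hpq, orbitParaboloid_pt,
      heq]
    rw [form_mulVec hF hg, form_orbitPt hF hpq]
  -- This form of σ is used twice: against dim `N^*` = dq + d - 1 for vanishing, and against the
  -- Jacobian exponent dq + 2d - 2 for the power of e^s.
  have hσ : |lam| + rhoQ F p q = muParam F p q lam + dimF F * q + dimF F - 2 := by
    rw [muParam, rhoQ]
    ring
  refine ⟨fun g hg => ?_, fun hmu g hg => ?_, fun hmu => ?_⟩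
  · rw [hrad g hg]
    exact (hadm g hg).integrable zero_le_one
  · rw [radon, hrad g hg]
    refine (hadm g hg).integral_eq_zero ?_ (mulVec_axis_ne_zero hg) zero_le_one
    have h1 := one_lt_muParam hpq hlam hmu
    have h5 : ((q - p : ℕ) : ℝ) = q - p := Nat.cast_sub hpq.le
    have h6 : (dimF F : ℝ) = 1 + (Module.finrank ℝ (imPart F) : ℝ) := by
      rw [hF.dimF_eq]
      push_cast
      ring
    have h7 : (Module.finrank ℝ (NStarCoord F p q) : ℝ) = dimF F * q + dimF F - 1 := by
      simp only [Module.finrank_prod, Module.finrank_pi_fintype, Finset.sum_const,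
        Finset.card_univ, Fintype.card_fin, smul_eq_mul]
      rw [← dimF]
      push_cast
      rw [h5]
      linear_combination (-1 : ℝ) * h6
    rw [h7, hσ]
    linarith
  · obtain ⟨a, ha, hΨ⟩ := hlead hmu
    have hone : (1 : Mat F p q) ∈ groupG F p q := by simp [groupG]
    have hzero : ∀ n : NStarCoord F p q, Ψ (orbitPt 0 n) =
        negNormSq (orbitPt 0 n) ^ (-((|lam| + rhoQ F p q) / 2)) • a := fun n =>
      hΨ _ (by rw [form_orbitPt hF hpq, neg_zero])
    have hmem : ∀ n : NStarCoord F p q, orbitPt 0 n ∈ negNonzero F p q := by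
      intro n
      have := (hadm 1 hone).pt_mem le_rfl n
      rwa [orbitParaboloid_pt, Matrix.one_mulVec] at this
    have hint : Integrable (fun n : NStarCoord F p q => Ψ (orbitPt 0 n)) (haarNStar F p q) := by
      have := (hadm 1 hone).integrable le_rfl
      simpa only [orbitParaboloid_pt, Matrix.one_mulVec] using this
    have hpow : ∀ n : NStarCoord F p q,
        0 < negNormSq (orbitPt 0 n) ^ (-((|lam| + rhoQ F p q) / 2)) := fun n =>
      Real.rpow_pos_of_pos (negNormSq_pos (hmem n)) _
    have hintr : Integrable (fun n : NStarCoord F p q =>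
        -- Integrability of the positive factor is inherited from Ψ after division by |a|; it is
        -- needed to conclude that its integral is strictly positive.
        negNormSq (orbitPt 0 n) ^ (-((|lam| + rhoQ F p q) / 2))) (haarNStar F p q) := by
      refine (hint.norm.const_mul ‖a‖⁻¹).congr (Filter.Eventually.of_forall fun n => ?_)
      simp only [hzero, norm_smul, Real.norm_of_nonneg (hpow n).le]
      field_simp [norm_ne_zero_iff.2 ha]
    refine ⟨∫ n, Ψ (orbitPt 0 n) ∂(haarNStar F p q), ?_, fun s => ?_⟩
    · simp only [hzero]
      rw [integral_smul_const]
      refine smul_ne_zero (ne_of_gt ?_) ha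
      rw [integral_pos_iff_support_of_nonneg (fun n => (hpow n).le) hintr]
      have : Function.support (fun n : NStarCoord F p q =>
          negNormSq (orbitPt 0 n) ^ (-((|lam| + rhoQ F p q) / 2))) = Set.univ :=
        Set.eq_univ_of_forall fun n => (hpow n).ne'
      rw [this]
      exact isOpen_univ.measure_pos _ Set.univ_nonempty
    · have hs := aElt_mem_groupG (p := p) (q := q) hF s
      -- The paraboloid translated by a_s is slid from b = 1 down to b = 0, where a_s becomes a
      -- dilation.
      rw [radon, hrad _ hs, (hadm _ hs).integral_eq zero_le_one]
      simp only [orbitParaboloid_pt, aElt_mulVec_orbitPt hF]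
      have h1 : ∀ n : NStarCoord F p q, Ψ (Real.exp (-s) • orbitPt 0 (dilation F p q s n)) =
          Real.exp (-s) ^ (-(|lam| + rhoQ F p q)) • Ψ (orbitPt 0 (dilation F p q s n)) := fun n =>
        hom.map_smul _ (Real.exp_pos _) _ (hmem _)
      simp only [h1]
      rw [integral_smul, integral_dilation hF hpq s fun n => Ψ (orbitPt 0 n), smul_smul,
        ← Real.exp_mul, ← Real.exp_add, Complex.real_smul, mul_comm]
      congr 3
      -- Homogeneity contributes e^(σs) and the change of variables e^(-(dq + 2d - 2)s); the
      -- exponents add up to (μ_λ - d)s.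
      rw [hσ]
      ring
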